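/- Let $\mathcal L$ be the language of primitive recursive arithmetic: equality is its only relation symbol, and it has a function symbol for every (definition of a) primitive recursive function. $\mathsf{HA}$ is the intuitionistic theory, and $\mathsf{PA}$ the classical theory, whose non-logical axioms are the axioms of Robinson arithmetic $\mathsf Q$, the defining equations of the primitive recursive functions, and the (universally closed) induction axioms for all $\mathcal L$-formulas. A formula is almost negative if it contains no $\lor$, and $\exists$ only immediately in front of atomic formulas. $\mathsf{ECT}_0$ is the schema $$\forall\vec v\Big(\forall x\big(\varphi(x,\vec v)\to\exists y\,\psi(x,y,\vec v)\big)\to\exists z\forall x\big(\varphi(x,\vec v)\to\exists u\,(T(z,x,u)\land\psi(x,U(u),\vec v))\big)\Big),$$ where $\varphi$ is almost negative, $\psi$ is arbitrary, and $T$ and $U$ are Kleene's $T$-predicate and result-extracting function. $\mathbf{Th}_{\Pi_2}(\mathsf{PA})$ is the set of all sentences $\forall\vec x\,\exists\vec y\,\theta$ with $\theta$ quantifier-free that are provable in $\mathsf{PA}$. For an $\mathcal L$-structure $\mathfrak M$, let $\mathcal L(\mathfrak M)$ be $\mathcal L$ with a constant $\underline c$ added for every $c\in\mathfrak M$, let $\mathsf{Diag}(\mathfrak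 M)$ be the set of atomic and negated atomic $\mathcal L(\mathfrak M)$-sentences true in $\mathfrak M$, and let $\mathbf T_{\mathfrak M}=\mathsf{HA}+\mathsf{ECT}_0+\mathsf{Diag}(\mathfrak M)$, a theory in $\mathcal L(\mathfrak M)$ with intuitionistic logic ($\vdash_i$). A Kripke model is a nonempty partial order of nodes $k$, each carrying a classical structure $\mathfrak M_k$, such that for $k\le k'$ the structure $\mathfrak M_k$ is a substructure of $\mathfrak M_{k'}$ (up to a compatible system of injections that preserve functions and relations); $\mathbf K\Vdash\varphi$ means that $\varphi$ is forced at every node, in the usual sense of Kripke forcing. Theorem. Let $\mathfrak M\models\mathbf{Th}_{\Pi_2}(\mathsf{PA})$. For every $\mathcal L(\mathfrak M)$-sentence $\theta$ with $\mathbf T_{\mathfrak M}\nvdash_i\theta$ there is a Kripke model $\mathbf K_\theta$ for $\mathcal L(\mathfrak M)$ with $\mathbf K_\theta\Vdash\mathbf T_{\mathfrak M}$ and $\mathbf K_\theta\nVdash\theta$. For any choice of such models $\mathbf K_\theta$, one for each $\theta$ with $\mathbf T_{\mathfrak M}\nvdash_i\theta$, let $\mathbf K(\mathfrak M,\mathbf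 T_{\mathfrak M})$ be the disjoint union of all the $\mathbf K_\theta$ together with a new root $r$ below all other nodes, with $\mathfrak M_r=\mathfrak M$, where each $c\in\mathfrak M$ is identified with the interpretation of $\underline c$ at every other node. Then $\mathbf K(\mathfrak M,\mathbf T_{\mathfrak M})$ is a (well-defined) Kripke model, and for every $\mathcal L(\mathfrak M)$-sentence $\varphi$, $$\mathbf K(\mathfrak M,\mathbf T_{\mathfrak M})\Vdash\varphi\iff\mathbf T_{\mathfrak M}\vdash_i\varphi.$$ -/

import Mathlib

open FirstOrder

universe u v w z

/-! ### First-order formulas with primitive intuitionistic connectives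

`IFml L n` is the type of `L`-formulas whose free variables are among `x₀, …, xₙ₋₁`.
A quantifier binds the variable `0` of its body; the other variables are shifted by one.
Negation is `φ → ⊥`. -/

inductive IFml (L : FirstOrder.Language.{u, v}) : ℕ → Type (max u v)
  | falsum {n : ℕ} : IFml L n
  | equal {n : ℕ} (t s : L.Term (Fin n)) : IFml L n
  | rel {n k : ℕ} (R : L.Relations k) (ts : Fin k → L.Term (Fin n)) : IFml L n
  | and {n : ℕ} (φ ψ : IFml L n) : IFml L n
  | or {n : ℕ} (φ ψ : IFml L n) : IFml L n
  | imp {n : ℕ} (φ ψ : IFml L n) : IFml L n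
  | all {n : ℕ} (φ : IFml L (n + 1)) : IFml L n
  | ex {n : ℕ} (φ : IFml L (n + 1)) : IFml L n

/-- Sentences. -/
abbrev ISent (L : FirstOrder.Language.{u, v}) := IFml L 0

namespace IFml

variable {L : FirstOrder.Language.{u, v}}

def neg {n : ℕ} (φ : IFml L n) : IFml L n := φ.imp falsum

/-- A simultaneous substitution, pushed under one binder. -/
def liftSubst {n m : ℕ} (σ : Fin n → L.Term (Fin m)) : Fin (n + 1) → L.Term (Fin (m + 1)) :=
  Fin.cons (FirstOrder.Language.Term.var 0) (fun i => (σ i).relabel Fin.succ)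

/-- Capture-free simultaneous substitution of terms for the free variables. -/
def subst : {n m : ℕ} → IFml L n → (Fin n → L.Term (Fin m)) → IFml L m
  | _, _, falsum, _ => falsum
  | _, _, equal t s, σ => equal (t.subst σ) (s.subst σ)
  | _, _, rel R ts, σ => rel R (fun i => (ts i).subst σ)
  | _, _, and φ ψ, σ => and (φ.subst σ) (ψ.subst σ)
  | _, _, or φ ψ, σ => or (φ.subst σ) (ψ.subst σ)
  | _, _, imp φ ψ, σ => imp (φ.subst σ) (ψ.subst σ)
  | _, _, all φ, σ => all (φ.subst (liftSubst σ))
  | _, _, ex φ, σ => ex (φ.subst (liftSubst σ))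

/-- Renaming of the free variables. -/
def rename {n m : ℕ} (φ : IFml L n) (f : Fin n → Fin m) : IFml L m :=
  φ.subst (fun i => FirstOrder.Language.Term.var (f i))

/-- Weakening by a fresh variable `0`. -/
def lift {n : ℕ} (φ : IFml L n) : IFml L (n + 1) := φ.rename Fin.succ

/-- `φ(t, x₀, …, xₙ₋₁)`. -/
def inst {n : ℕ} (φ : IFml L (n + 1)) (t : L.Term (Fin n)) : IFml L n :=
  φ.subst (Fin.cons t FirstOrder.Language.Term.var)

/-- Universal closure. -/
def closeAll : {n : ℕ} → IFml L n → ISent L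
  | 0, φ => φ
  | _ + 1, φ => closeAll (all φ)

/-- Translation along a map of languages. -/
def onLang {L' : FirstOrder.Language.{u, v}} {L'' : FirstOrder.Language.{w, z}} (g : L' →ᴸ L'') :
    {n : ℕ} → IFml L' n → IFml L'' n
  | _, falsum => falsum
  | _, equal t s => equal (g.onTerm t) (g.onTerm s)
  | _, rel R ts => rel (g.onRelation R) (fun i => g.onTerm (ts i))
  | _, and φ ψ => and (φ.onLang g) (ψ.onLang g)
  | _, or φ ψ => or (φ.onLang g) (ψ.onLang g)
  | _, imp φ ψ => imp (φ.onLang g) (ψ.onLang g)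
  | _, all φ => all (φ.onLang g)
  | _, ex φ => ex (φ.onLang g)

/-- Classical (Tarskian) satisfaction in a structure. -/
def Realize {M : Type w} [L.Structure M] : {n : ℕ} → IFml L n → (Fin n → M) → Prop
  | _, falsum, _ => False
  | _, equal t s, a => t.realize a = s.realize a
  | _, rel R ts, a => FirstOrder.Language.Structure.RelMap R (fun i => (ts i).realize a)
  | _, and φ ψ, a => φ.Realize a ∧ ψ.Realize a
  | _, or φ ψ, a => φ.Realize a ∨ ψ.Realize a
  | _, imp φ ψ, a => φ.Realize a → ψ.Realize a
  | _, all φ, a => ∀ d : M, φ.Realize (Fin.cons d a : Fin _ → M)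
  | _, ex φ, a => ∃ d : M, φ.Realize (Fin.cons d a : Fin _ → M)

/-- `M ⊨ φ` for a sentence `φ`. -/
def TrueIn (M : Type w) [L.Structure M] (φ : ISent L) : Prop := φ.Realize (Fin.elim0 : Fin 0 → M)

def IsAtomic : {n : ℕ} → IFml L n → Prop
  | _, falsum => True
  | _, equal _ _ => True
  | _, rel _ _ => True
  | _, _ => False

def IsQF : {n : ℕ} → IFml L n → Prop
  | _, falsum => True
  | _, equal _ _ => True
  | _, rel _ _ => True
  | _, and φ ψ => φ.IsQF ∧ ψ.IsQF
  | _, or φ ψ => φ.IsQF ∧ ψ.IsQF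
  | _, imp φ ψ => φ.IsQF ∧ ψ.IsQF
  | _, all _ => False
  | _, ex _ => False

/-- `∃ y⃗ ψ` with `ψ` quantifier-free. -/
inductive IsSigma1 : {n : ℕ} → IFml L n → Prop
  | qf {n : ℕ} {φ : IFml L n} : φ.IsQF → IsSigma1 φ
  | ex {n : ℕ} {φ : IFml L (n + 1)} : IsSigma1 φ → IsSigma1 φ.ex

/-- `∀ x⃗ ∃ y⃗ ψ` with `ψ` quantifier-free. -/
inductive IsPi2 : {n : ℕ} → IFml L n → Prop
  | sigma {n : ℕ} {φ : IFml L n} : IsSigma1 φ → IsPi2 φ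
  | all {n : ℕ} {φ : IFml L (n + 1)} : IsPi2 φ → IsPi2 φ.all

/-- Almost negative: no disjunction, and `∃` only immediately in front of atomic formulas. -/
def IsAlmostNeg : {n : ℕ} → IFml L n → Prop
  | _, falsum => True
  | _, equal _ _ => True
  | _, rel _ _ => True
  | _, and φ ψ => φ.IsAlmostNeg ∧ ψ.IsAlmostNeg
  | _, or _ _ => False
  | _, imp φ ψ => φ.IsAlmostNeg ∧ ψ.IsAlmostNeg
  | _, all φ => φ.IsAlmostNeg
  | _, ex φ => φ.IsAtomic

end IFml

/-! ### Natural deduction -/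

/-- `Deriv cl T Γ φ`: natural deduction derivability of `φ` from the axioms `T` and the open
assumptions `Γ`, with free variables among `x₀, …, xₙ₋₁`. The rule `dne` is available only if
`cl` holds: `cl = False` is intuitionistic logic with equality and `cl = True` is classical
logic with equality. (As usual for variable contexts, it is meant for languages with a closed
term; all languages below have the constant zero.) -/
inductive Deriv {L : FirstOrder.Language.{u, v}} (cl : Prop) (T : Set (ISent L)) :
    {n : ℕ} → List (IFml L n) → IFml L n → Prop
  | ax {n : ℕ} {Γ : List (IFml L n)} {φ : ISent L} :
      φ ∈ T → Deriv cl T Γ (φ.rename Fin.elim0)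
  | hyp {n : ℕ} {Γ : List (IFml L n)} {φ : IFml L n} : φ ∈ Γ → Deriv cl T Γ φ
  | falsumE {n : ℕ} {Γ : List (IFml L n)} {φ : IFml L n} :
      Deriv cl T Γ IFml.falsum → Deriv cl T Γ φ
  | andI {n : ℕ} {Γ : List (IFml L n)} {φ ψ : IFml L n} :
      Deriv cl T Γ φ → Deriv cl T Γ ψ → Deriv cl T Γ (φ.and ψ)
  | andE₁ {n : ℕ} {Γ : List (IFml L n)} {φ ψ : IFml L n} :
      Deriv cl T Γ (φ.and ψ) → Deriv cl T Γ φ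
  | andE₂ {n : ℕ} {Γ : List (IFml L n)} {φ ψ : IFml L n} :
      Deriv cl T Γ (φ.and ψ) → Deriv cl T Γ ψ
  | orI₁ {n : ℕ} {Γ : List (IFml L n)} {φ ψ : IFml L n} :
      Deriv cl T Γ φ → Deriv cl T Γ (φ.or ψ)
  | orI₂ {n : ℕ} {Γ : List (IFml L n)} {φ ψ : IFml L n} :
      Deriv cl T Γ ψ → Deriv cl T Γ (φ.or ψ)
  | orE {n : ℕ} {Γ : List (IFml L n)} {φ ψ χ : IFml L n} :
      Deriv cl T Γ (φ.or ψ) → Deriv cl T (φ :: Γ) χ → Deriv cl T (ψ :: Γ) χ → Deriv cl T Γ χ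
  | impI {n : ℕ} {Γ : List (IFml L n)} {φ ψ : IFml L n} :
      Deriv cl T (φ :: Γ) ψ → Deriv cl T Γ (φ.imp ψ)
  | impE {n : ℕ} {Γ : List (IFml L n)} {φ ψ : IFml L n} :
      Deriv cl T Γ (φ.imp ψ) → Deriv cl T Γ φ → Deriv cl T Γ ψ
  | allI {n : ℕ} {Γ : List (IFml L n)} {φ : IFml L (n + 1)} :
      Deriv cl T (Γ.map IFml.lift) φ → Deriv cl T Γ φ.all
  | allE {n : ℕ} {Γ : List (IFml L n)} {φ : IFml L (n + 1)} (t : L.Term (Fin n)) :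
      Deriv cl T Γ φ.all → Deriv cl T Γ (φ.inst t)
  | exI {n : ℕ} {Γ : List (IFml L n)} {φ : IFml L (n + 1)} (t : L.Term (Fin n)) :
      Deriv cl T Γ (φ.inst t) → Deriv cl T Γ φ.ex
  | exE {n : ℕ} {Γ : List (IFml L n)} {φ : IFml L (n + 1)} {χ : IFml L n} :
      Deriv cl T Γ φ.ex → Deriv cl T (φ :: Γ.map IFml.lift) χ.lift → Deriv cl T Γ χ
  | eqRefl {n : ℕ} {Γ : List (IFml L n)} (t : L.Term (Fin n)) : Deriv cl T Γ (IFml.equal t t)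
  | eqSubst {n : ℕ} {Γ : List (IFml L n)} (φ : IFml L (n + 1)) {t s : L.Term (Fin n)} :
      Deriv cl T Γ (IFml.equal t s) → Deriv cl T Γ (φ.inst t) → Deriv cl T Γ (φ.inst s)
  | dne {n : ℕ} {Γ : List (IFml L n)} {φ : IFml L n} :
      cl → Deriv cl T Γ φ.neg.neg → Deriv cl T Γ φ

/-- `T ⊢ᵢ φ`. -/
def ProvI {L : FirstOrder.Language.{u, v}} (T : Set (ISent L)) (φ : ISent L) : Prop := Deriv False T [] φ

/-- `T ⊢_c φ`. -/
def ProvC {L : FirstOrder.Language.{u, v}} (T : Set (ISent L)) (φ : ISent L) : Prop := Deriv True T [] φ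

/-! ### The language of primitive recursive arithmetic -/

/-- Function symbols: one for every definition of a primitive recursive function.
`prec f g` stands for the `h` with `h(0, x⃗) = f(x⃗)` and `h(y + 1, x⃗) = g(y, h(y, x⃗), x⃗)`. -/
inductive PRSym : ℕ → Type
  | zero : PRSym 0
  | succ : PRSym 1
  | proj {n : ℕ} (i : Fin n) : PRSym n
  | comp {m n : ℕ} (f : PRSym m) (g : Fin m → PRSym n) : PRSym n
  | prec {n : ℕ} (f : PRSym n) (g : PRSym (n + 2)) : PRSym (n + 1)

/-- The language `𝓛`, with equality as its only relation. -/
def LPR : FirstOrder.Language.{0, 0} := ⟨PRSym, fun _ => Empty⟩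

namespace PRSym

/-! #### Basic arithmetic

`addS(x, y) = x + y`, `mulS(x, y) = x · y` and `subS(x, y) = x ∸ y` are defined by recursion
on `y`. `num k` is the constant function `k`. The instances below let `+`, `*` and `-`
(truncated) be used on symbols of the same arity, read pointwise. -/

def app₁ {n : ℕ} (f : PRSym 1) (a : PRSym n) : PRSym n := comp f ![a]

def app₂ {n : ℕ} (f : PRSym 2) (a b : PRSym n) : PRSym n := comp f ![a, b]

/-- `h(x, 0) = f(x)`, `h(x, y + 1) = g(y, h(x, y), x)`. -/
def recR (f : PRSym 1) (g : PRSym 3) : PRSym 2 := app₂ (prec f g) (proj 1) (proj 0)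

def num {n : ℕ} : ℕ → PRSym n
  | 0 => comp zero ![]
  | k + 1 => app₁ succ (num k)

def predS : PRSym 1 := prec zero (proj 0)

def addS : PRSym 2 := recR (proj 0) (app₁ succ (proj 1))

def mulS : PRSym 2 := recR (num 0) (app₂ addS (proj 1) (proj 2))

def subS : PRSym 2 := recR (proj 0) (app₁ predS (proj 1))

instance {n : ℕ} : Add (PRSym n) := ⟨app₂ addS⟩

instance {n : ℕ} : Mul (PRSym n) := ⟨app₂ mulS⟩

instance {n : ℕ} : Sub (PRSym n) := ⟨app₂ subS⟩

/-! In what follows a condition is represented by a number that is `0` iff the condition is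
true; hence `+` is conjunction, `*` is disjunction, `1 ∸ a` is the negation of `a`. -/

/-- `a = b`. -/
def eqn {n : ℕ} (a b : PRSym n) : PRSym n := (a - b) + (b - a)

/-! #### Cantor's pairing `⟨x, y⟩ = (x + y)(x + y + 1)/2 + y` and its projections -/

/-- `triS(n) = 0 + 1 + ⋯ + n`. -/
def triS : PRSym 1 := prec zero (proj 1 + app₁ succ (proj 0))

def pair {n : ℕ} (a b : PRSym n) : PRSym n := app₁ triS (a + b) + b

/-- The largest `w` with `triS(w) ≤ z`, by recursion on `z`. -/
def diagS : PRSym 1 :=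
  prec zero (proj 1 + (num 1 - eqn (app₁ triS (app₁ succ (proj 1))) (app₁ succ (proj 0))))

def sndS : PRSym 1 := proj 0 - app₁ triS diagS

def fstS : PRSym 1 := diagS - sndS

def fst {n : ℕ} (a : PRSym n) : PRSym n := app₁ fstS a

def snd {n : ℕ} (a : PRSym n) : PRSym n := app₁ sndS a

/-! #### Course-of-values recursion

Lists are coded by `[] = 0` and `a :: l = ⟨a, l⟩ + 1`. -/

/-- `dropS(k, l)` is the list `l` without its first `k` entries. -/
def dropS : PRSym 2 := prec (proj 0) (snd (app₁ predS (proj 1)))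

/-- `table F (n) = [c(n - 1), …, c(0)]`, where `c(k) = F(k, [c(k - 1), …, c(0)])`. -/
def table (F : PRSym 2) : PRSym 1 :=
  prec zero (app₁ succ (pair (app₂ F (proj 0) (proj 1)) (proj 1)))

/-- The function `c` with `c(k) = F(k, [c(k - 1), …, c(0)])`. -/
def courseOfValues (F : PRSym 2) : PRSym 1 := app₂ F (proj 0) (table F)

/-- The value `c(k)` read off from the list `l = [c(n - 1), …, c(0)]`, for `k < n`. -/
def look {m : ℕ} (n l k : PRSym m) : PRSym m :=
  fst (app₁ predS (app₂ dropS ((n - num 1) - k) l))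

/-! #### Kleene's `T`-predicate

A number `e = ⟨tag, ⟨f, g⟩⟩` is read as a program for a partial recursive function of one
argument `x`, as follows.

* tag `0`: the value is `0`;
* tag `1`: the value is `x + 1`;
* tag `2`: the value is the first projection of `x`;
* tag `3`: the value is the second projection of `x`;
* tag `4`: the value is `⟨{f}(x), {g}(x)⟩`;
* tag `5`: the value is `{f}({g}(x))`;
* tag `6`: primitive recursion, `{e}(⟨a, 0⟩) = {f}(a)` and
  `{e}(⟨a, m + 1⟩) = {g}(⟨a, ⟨m, {e}(⟨a, m⟩)⟩⟩)`;
* tag `7`: unbounded search, `{e}(⟨a, m⟩)` is the least `k ≥ m` with `{f}(⟨a, k⟩) = 0`, all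
  earlier values being defined; that is, it is `m` if `{f}(⟨a, m⟩) = 0`, and
  `{e}(⟨a, m + 1⟩)` if `{f}(⟨a, m⟩)` is defined and nonzero;
* other tags: nowhere defined.

A computation is a binary tree: `0` is the empty tree, and `⟨e, ⟨x, ⟨y, ⟨l, r⟩⟩⟩⟩ + 1` is the
tree whose root says that `{e}(x) = y` and whose immediate subtrees are `l` and `r`. It is valid
if every node follows from its immediate subtrees by the clauses above (subtrees that are not
needed being empty). -/

/-- The program at the root of a tree. -/
def idx {n : ℕ} (a : PRSym n) : PRSym n := fst (app₁ predS a)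

/-- The input at the root of a tree. -/
def inp {n : ℕ} (a : PRSym n) : PRSym n := fst (snd (app₁ predS a))

/-- The output at the root of a tree. -/
def out {n : ℕ} (a : PRSym n) : PRSym n := fst (snd (snd (app₁ predS a)))

/-- The left subtree. -/
def lft {n : ℕ} (a : PRSym n) : PRSym n := fst (snd (snd (snd (app₁ predS a))))

/-- The right subtree. -/
def rgt {n : ℕ} (a : PRSym n) : PRSym n := snd (snd (snd (snd (app₁ predS a))))

/-- Given the tree `u` and the list `h` of the validity values of all numbers below `u`: the
condition that the tree `w < u` is valid, with program `e` and input `x` at its root. -/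
def subOK (w e x : PRSym 2) : PRSym 2 :=
  look (proj 0) (proj 1) w + eqn (idx w) e + eqn (inp w) x

/-- The validity of the tree `u`, given the list `h` of the validity values of all numbers
below `u`. -/
def validBody : PRSym 2 :=
  let u : PRSym 2 := proj 0
  let e := idx u
  let x := inp u
  let y := out u
  let l := lft u
  let r := rgt u
  let tag := fst e
  let f := fst (snd e)
  let g := snd (snd e)
  let a := fst x
  let m := snd x
  (num 1 - u) +
    (eqn tag (num 0) + (y + l + r)) *
    (eqn tag (num 1) + (eqn y (x + num 1) + l + r)) *
    (eqn tag (num 2) + (eqn y (fst x) + l + r)) *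
    (eqn tag (num 3) + (eqn y (snd x) + l + r)) *
    (eqn tag (num 4) + (subOK l f x + subOK r g x + eqn y (pair (out l) (out r)))) *
    (eqn tag (num 5) + (subOK l g x + subOK r f (out l) + eqn y (out r))) *
    (eqn tag (num 6) +
      (m + subOK l f a + eqn y (out l) + r) *
      ((num 1 - m) + subOK l e (pair a (m - num 1)) +
        subOK r g (pair a (pair (m - num 1) (out l))) + eqn y (out r))) *
    (eqn tag (num 7) + (subOK l f x +
      (out l + eqn y m + r) *
      ((num 1 - out l) + subOK r e (pair a (m + num 1)) + eqn y (out r))))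

def validS : PRSym 1 := courseOfValues validBody

/-- Kleene's `T`-predicate: `kleeneT(e, x, u) = 0` iff `u` is the computation of the program `e`
at the input `x`. -/
def kleeneT : PRSym 3 :=
  app₁ validS (proj 2) + eqn (idx (proj 2)) (proj 0) + eqn (inp (proj 2)) (proj 1)

/-- The result-extracting function. -/
def kleeneU : PRSym 1 := out (proj 0)

end PRSym

/-! ### Arithmetical theories -/

/-- The variable `xᵢ` as a term. -/
def vr {n : ℕ} (i : Fin n) : LPR.Term (Fin n) := FirstOrder.Language.Term.var i

/-- Application of a function symbol of `𝓛` to terms. -/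
def fn {n k : ℕ} (f : PRSym k) (ts : Fin k → LPR.Term (Fin n)) : LPR.Term (Fin n) :=
  FirstOrder.Language.Term.func (L := LPR) f ts

def tZero {n : ℕ} : LPR.Term (Fin n) := fn PRSym.zero ![]

def tSucc {n : ℕ} (t : LPR.Term (Fin n)) : LPR.Term (Fin n) := fn PRSym.succ ![t]

def tAdd {n : ℕ} (t s : LPR.Term (Fin n)) : LPR.Term (Fin n) := fn PRSym.addS ![t, s]

def tMul {n : ℕ} (t s : LPR.Term (Fin n)) : LPR.Term (Fin n) := fn PRSym.mulS ![t, s]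

/-- The induction formula `φ(0) ∧ ∀ x (φ(x) → φ(Sx)) → ∀ x φ(x)`, where `x` is the variable `0`
of `φ` and the other variables are parameters. -/
def indFml {n : ℕ} (φ : IFml LPR (n + 1)) : IFml LPR n :=
  ((φ.inst tZero).and
    (φ.imp (φ.subst (Fin.cons (tSucc (vr 0)) (fun i => vr i.succ)))).all).imp φ.all

/-- The non-logical axioms common to `HA` and `PA`. -/
inductive ArithAx : ISent LPR → Prop
  | succ_ne_zero : ArithAx (IFml.equal (tSucc (vr (0 : Fin 1))) tZero).neg.closeAll
  | succ_inj : ArithAx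
      ((IFml.equal (tSucc (vr (0 : Fin 2))) (tSucc (vr 1))).imp
        (IFml.equal (vr 0) (vr 1))).closeAll
  | zero_or_succ : ArithAx
      ((IFml.equal (vr (0 : Fin 1)) tZero).neg.imp
        (IFml.equal (vr (1 : Fin 2)) (tSucc (vr 0))).ex).closeAll
  | add_zero : ArithAx (IFml.equal (tAdd (vr (0 : Fin 1)) tZero) (vr 0)).closeAll
  | add_succ : ArithAx
      (IFml.equal (tAdd (vr (0 : Fin 2)) (tSucc (vr 1))) (tSucc (tAdd (vr 0) (vr 1)))).closeAll
  | mul_zero : ArithAx (IFml.equal (tMul (vr (0 : Fin 1)) tZero) tZero).closeAll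
  | mul_succ : ArithAx
      (IFml.equal (tMul (vr (0 : Fin 2)) (tSucc (vr 1)))
        (tAdd (tMul (vr 0) (vr 1)) (vr 0))).closeAll
  | proj {n : ℕ} (i : Fin n) : ArithAx (IFml.equal (fn (PRSym.proj i) vr) (vr i)).closeAll
  | comp {m n : ℕ} (f : PRSym m) (g : Fin m → PRSym n) : ArithAx
      (IFml.equal (fn (PRSym.comp f g) vr) (fn f (fun i => fn (g i) vr))).closeAll
  | prec_zero {n : ℕ} (f : PRSym n) (g : PRSym (n + 2)) : ArithAx
      (IFml.equal (fn (PRSym.prec f g) (Fin.cons tZero vr)) (fn f vr)).closeAll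
  | prec_succ {n : ℕ} (f : PRSym n) (g : PRSym (n + 2)) : ArithAx
      (IFml.equal
        (fn (PRSym.prec f g) (Fin.cons (tSucc (vr 0)) (fun i : Fin n => vr i.succ)))
        (fn g (Fin.cons (vr 0) (Fin.cons (fn (PRSym.prec f g) vr)
          (fun i : Fin n => vr i.succ))))).closeAll
  | ind {n : ℕ} (φ : IFml LPR (n + 1)) : ArithAx (indFml φ).closeAll

/-- Heyting arithmetic, used with `ProvI`. -/
def HA : Set (ISent LPR) := {φ | ArithAx φ}

/-- Peano arithmetic, used with `ProvC`: the same non-logical axioms. -/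
def PA : Set (ISent LPR) := {φ | ArithAx φ}

/-- `∀ x (φ(x, v⃗) → ∃ y ψ(x, y, v⃗)) → ∃ z ∀ x (φ(x, v⃗) → ∃ u (T(z, x, u) ∧ ψ(x, U(u), v⃗)))`.
In `φ` the variable `0` is `x` and the variables `i + 1` are `v⃗`; in `ψ` the variable `0` is
`y`, the variable `1` is `x` and the variables `i + 2` are `v⃗`. -/
def ectFml {n : ℕ} (φ : IFml LPR (n + 1)) (ψ : IFml LPR (n + 2)) : IFml LPR n :=
  (φ.imp ψ.ex).all.imp
    ((φ.rename (Fin.cons 0 (fun i : Fin n => i.succ.succ))).imp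
      ((IFml.equal (fn PRSym.kleeneT ![vr 2, vr 1, vr 0]) tZero).and
        (ψ.subst (Fin.cons (fn PRSym.kleeneU ![vr 0])
          (Fin.cons (vr 1) (fun i : Fin n => vr i.succ.succ.succ))))).ex).all.ex

/-- The extended Church's thesis schema. -/
def ECT₀ : Set (ISent LPR) :=
  {χ | ∃ (n : ℕ) (φ : IFml LPR (n + 1)) (ψ : IFml LPR (n + 2)),
    φ.IsAlmostNeg ∧ χ = (ectFml φ ψ).closeAll}

/-- `M ⊨ Th_{Π₂}(PA)`. -/
def ModelsThPi2PA (M : Type w) [LPR.Structure M] : Prop :=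
  ∀ φ : ISent LPR, φ.IsPi2 → ProvC PA φ → φ.TrueIn M

/-- The diagram of `M`: the atomic and negated atomic `L(M)`-sentences true in `M`. -/
def Diag (L : FirstOrder.Language.{u, v}) (M : Type w) [L.Structure M] : Set (ISent (L[[M]])) :=
  {φ | φ.TrueIn M ∧ (φ.IsAtomic ∨ ∃ p : ISent (L[[M]]), p.IsAtomic ∧ φ = p.neg)}

/-- `T_M = HA + ECT₀ + Diag(M)`, a theory in the language `𝓛(M)`. -/
def TM (M : Type w) [LPR.Structure M] : Set (ISent (LPR[[M]])) :=
  (IFml.onLang (LPR.lhomWithConstants M)) '' (HA ∪ ECT₀) ∪ Diag LPR M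

/-! ### Kripke models -/

/-- The data of a Kripke model for the language `L`, without the conditions on them. The
inclusion of the domain of a node in the domains of later nodes is given by a map. -/
structure KripkeData (L : FirstOrder.Language.{u, v}) where
  Node : Type w
  le : Node → Node → Prop
  Dom : Node → Type w
  str : ∀ k, L.Structure (Dom k)
  map : ∀ {k k' : Node}, le k k' → Dom k → Dom k'

attribute [instance] KripkeData.str

namespace KripkeData

variable {L : FirstOrder.Language.{u, v}}

/-- The data form a Kripke model: the nodes are a nonempty partial order, and the transition
maps are a compatible system of injections preserving functions and relations, so that each
structure is (identified with) a part of all later ones, which satisfy its positive diagram. -/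
structure IsKripkeModel (K : KripkeData.{u, v, w} L) : Prop where
  nonempty : Nonempty K.Node
  refl : ∀ k, K.le k k
  trans : ∀ {k₁ k₂ k₃}, K.le k₁ k₂ → K.le k₂ k₃ → K.le k₁ k₃
  antisymm : ∀ {k₁ k₂}, K.le k₁ k₂ → K.le k₂ k₁ → k₁ = k₂
  dom_nonempty : ∀ k, Nonempty (K.Dom k)
  map_self : ∀ {k} (h : K.le k k) (d : K.Dom k), K.map h d = d
  map_map : ∀ {k₁ k₂ k₃} (h₁ : K.le k₁ k₂) (h₂ : K.le k₂ k₃) (h₃ : K.le k₁ k₃) (d : K.Dom k₁),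
    K.map h₂ (K.map h₁ d) = K.map h₃ d
  map_injective : ∀ {k k'} (h : K.le k k'), Function.Injective (K.map h)
  map_fun : ∀ {k k'} (h : K.le k k') {n : ℕ} (f : L.Functions n) (a : Fin n → K.Dom k),
    K.map h (FirstOrder.Language.Structure.funMap f a) = FirstOrder.Language.Structure.funMap f (K.map h ∘ a)
  map_rel : ∀ {k k'} (h : K.le k k') {n : ℕ} (R : L.Relations n) (a : Fin n → K.Dom k),
    FirstOrder.Language.Structure.RelMap R a → FirstOrder.Language.Structure.RelMap R (K.map h ∘ a)

/-- The forcing relation `k ⊩ φ(a)`, for parameters `a` in the domain of `k`. -/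
def Forces (K : KripkeData.{u, v, w} L) :
    {n : ℕ} → IFml L n → (k : K.Node) → (Fin n → K.Dom k) → Prop
  | _, .falsum, _, _ => False
  | _, .equal t s, _, a => t.realize a = s.realize a
  | _, .rel R ts, _, a => FirstOrder.Language.Structure.RelMap R (fun i => (ts i).realize a)
  | _, .and φ ψ, k, a => K.Forces φ k a ∧ K.Forces ψ k a
  | _, .or φ ψ, k, a => K.Forces φ k a ∨ K.Forces ψ k a
  | _, .imp φ ψ, k, a =>
      ∀ (k' : K.Node) (h : K.le k k'), K.Forces φ k' (K.map h ∘ a) → K.Forces ψ k' (K.map h ∘ a)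
  | _, .all φ, k, a =>
      ∀ (k' : K.Node) (h : K.le k k') (d : K.Dom k'),
        K.Forces φ k' (Fin.cons d (K.map h ∘ a) : Fin _ → K.Dom k')
  | _, .ex φ, k, a => ∃ d : K.Dom k, K.Forces φ k (Fin.cons d a : Fin _ → K.Dom k)

/-- `K ⊩ φ` for a sentence `φ`: it is forced at every node. -/
def Models (K : KripkeData.{u, v, w} L) (φ : ISent L) : Prop :=
  ∀ k : K.Node, K.Forces φ k Fin.elim0

/-- `K` is a Kripke model with `K ⊩ T` and `K ⊮ φ`. -/
def IsCountermodel (K : KripkeData.{u, v, w} L) (T : Set (ISent L)) (φ : ISent L) : Prop :=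
  K.IsKripkeModel ∧ (∀ θ ∈ T, K.Models θ) ∧ ¬ K.Models φ

end KripkeData

/-! ### The universal model -/

/-- `𝓢(M, T)`: the sentences that are not provable in `T`. -/
def Unprovable {L : FirstOrder.Language.{u, v}} (T : Set (ISent L)) : Type (max u v) :=
  {φ : ISent L // ¬ ProvI T φ}

section Universal


variable {L : FirstOrder.Language.{u, v}} {M : Type w} [L.Structure M] {S : Type w}

/-- The order of the disjoint union of the `K θ` with a new root `none`. -/
def univLe (K : S → KripkeData.{max u w, v, w} (L[[M]])) :
    Option (Σ θ, (K θ).Node) → Option (Σ θ, (K θ).Node) → Prop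
  | none, _ => True
  | some _, none => False
  | some ⟨θ, k⟩, some ⟨θ', k'⟩ => ∃ h : θ = θ', (K θ').le (h ▸ k) k'

/-- The domains: `M` at the root, unchanged elsewhere. -/
def univDom (K : S → KripkeData.{max u w, v, w} (L[[M]])) : Option (Σ θ, (K θ).Node) → Type w
  | none => M
  | some ⟨θ, k⟩ => (K θ).Dom k

/-- The structures: at the root the constant of `c ∈ M` is interpreted by `c`. -/
@[reducible] def univStr (K : S → KripkeData.{max u w, v, w} (L[[M]])) :
    (k : Option (Σ θ, (K θ).Node)) → (L[[M]]).Structure (univDom K k)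
  | none => inferInstanceAs ((L[[M]]).Structure M)
  | some ⟨θ, k⟩ => (K θ).str k

/-- The transition maps: from the root to a node `k`, the element `c ∈ M` is identified with the
interpretation of its constant in the structure at `k`; unchanged elsewhere. -/
def univMap (K : S → KripkeData.{max u w, v, w} (L[[M]])) :
    (k k' : Option (Σ θ, (K θ).Node)) → univLe K k k' → univDom K k → univDom K k'
  | none, none, _ => fun c => c
  | none, some ⟨θ, k'⟩, _ => fun c => (((L.con c : (L[[M]]).Constants) : (K θ).Dom k'))
  | some _, none, h => h.elim
  | some ⟨θ, k⟩, some ⟨θ', k'⟩, h => by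
      have e : θ = θ' := h.fst
      subst e
      exact (K θ).map h.snd

/-- Take the disjoint union of the `K θ` and add a new root with the structure `M`. -/
def univModel (M : Type w) [L.Structure M] (K : S → KripkeData.{max u w, v, w} (L[[M]])) :
    KripkeData.{max u w, v, w} (L[[M]]) where
  Node := Option (Σ θ, (K θ).Node)
  le := univLe K
  Dom := univDom K
  str := univStr K
  map := fun {k k'} h => univMap K k k' h

end Universal

/-! Write T for `TM M`. The new root forces exactly the theorems of T: for parameters c in M, it
forces φ(c) iff T proves φ(c). This is proved by induction on φ (`univModel_forces_root`). Atomic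
formulas are settled by the diagram and the consistency of T. For → and ∀ the nodes above the root
do the work, because a sentence is provable in T iff it is forced throughout all the `K θ`
(`provI_subst_iff`: soundness one way, the countermodel of the sentence itself the other way), while
the root adds only what the induction hypothesis gives. The cases ∨ and ∃ amount to the disjunction
property of T and to its existence property with witnesses named by elements of M
(`provI_or_of_provI_or`, `exists_provI_of_provI_ex`).

Both properties come from Kleene realizability in two variants: plain number realizability (`b =
false`) and realizability combined with truth (`b = true`). A derivation from HA + ECT₀ and some
literals yields a program that computes a realizer of the conclusion (`Deriv.exists_realizesSeq`).
The plain variant is sound in every Kripke model of HA, without ECT₀, since ECT₀ is itself realized.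
This matters because ECT₀ is classically refutable, whereas HA is part of PA. So HA proves that the
program terminates if the finitely many diagram literals used in the derivation hold. This is a Π₂
statement; it is provable in PA and therefore true in M (`ModelsThPi2PA.exists_realize`), and M
itself contains a computation, with a value c.

The diagram fixes all primitive recursive facts about elements of M, and computations are
deterministic. Hence in every Kripke model of T the constant for c denotes the value of the program,
and by the truth variant it realizes the given theorem together with its truth (`exists_realizer`).
For a disjunction, the first component of c, evaluated in M, singles out a disjunct that is forced
in all models of T; for an existential sentence it is the witness. Completeness turns this back into
provability. The same transfer with ⊥ as conclusion gives consistency (`not_provI_falsum`).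

The countermodels come from a Henkin construction with saturated theories
(`exists_preModel_of_not_provI`). Its transition maps need not be injective, but HA decides
equality, which makes them so (`map_injective`). Arithmetic is carried out semantically: the
structure at any node of a Kripke model of HA satisfies classical primitive recursive arithmetic
with quantifier-free induction (`isPRA`), which suffices for pairing and for unwinding the
T-predicate. The uniqueness of computations and the termination of recursions of possibly
nonstandard length use Π₁- and Σ₁-induction in the model (`forall_ind`, `app_ind`). -/

namespace FirstOrder.Language.Term

/-! ### Substitution in terms and formulas. -/

variable {L : FirstOrder.Language.{u, v}} {α β γ : Type*}

theorem relabel_subst (t : L.Term α) (g : α → β) (σ : β → L.Term γ) :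
    (t.relabel g).subst σ = t.subst (σ ∘ g) := by
  induction t with
  | var => rfl
  | func f ts ih => simp [subst, ih]

theorem subst_relabel (t : L.Term α) (σ : α → L.Term β) (g : β → γ) :
    (t.subst σ).relabel g = t.subst (fun i => (σ i).relabel g) := by
  induction t with
  | var => rfl
  | func f ts ih => simp [subst, ih]

theorem subst_subst (t : L.Term α) (σ : α → L.Term β) (τ : β → L.Term γ) :
    (t.subst σ).subst τ = t.subst (fun i => (σ i).subst τ) := by
  induction t with
  | var => rfl
  | func f ts ih => simp [subst, ih]

theorem subst_var (t : L.Term α) : t.subst var = t := by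
  induction t with
  | var => rfl
  | func f ts ih => simp [subst, ih]

theorem relabel_eq_subst (t : L.Term α) (g : α → β) : t.relabel g = t.subst (var ∘ g) := by
  induction t with
  | var => rfl
  | func f ts ih => simp [subst, ih]

end FirstOrder.Language.Term

open FirstOrder.Language

namespace IFml

variable {L : FirstOrder.Language.{u, v}}

theorem liftSubst_subst {n m p : ℕ} (σ : Fin n → L.Term (Fin m)) (τ : Fin m → L.Term (Fin p)) :
    (fun i => (liftSubst σ i).subst (liftSubst τ)) = liftSubst (fun i => (σ i).subst τ) := by
  funext i
  refine Fin.cases ?_ (fun i => ?_) i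
  · rfl
  · simp [liftSubst, Term.relabel_subst, Term.subst_relabel]

theorem liftSubst_var {n : ℕ} : liftSubst (Term.var : Fin n → L.Term (Fin n)) = Term.var := by
  funext i
  refine Fin.cases ?_ (fun i => ?_) i <;> rfl

theorem subst_subst {n m p : ℕ} (φ : IFml L n) (σ : Fin n → L.Term (Fin m))
    (τ : Fin m → L.Term (Fin p)) :
    (φ.subst σ).subst τ = φ.subst (fun i => (σ i).subst τ) := by
  induction φ generalizing m p with
  | falsum => rfl
  | equal t s => simp [subst, Term.subst_subst]
  | rel R ts => simp [subst, Term.subst_subst]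
  | and φ ψ h₁ h₂ => simp [subst, h₁, h₂]
  | or φ ψ h₁ h₂ => simp [subst, h₁, h₂]
  | imp φ ψ h₁ h₂ => simp [subst, h₁, h₂]
  | all φ h => simp [subst, h, liftSubst_subst]
  | ex φ h => simp [subst, h, liftSubst_subst]

theorem subst_var {n : ℕ} (φ : IFml L n) : φ.subst Term.var = φ := by
  induction φ with
  | falsum => rfl
  | equal t s => simp [subst, Term.subst_var]
  | rel R ts => simp [subst, Term.subst_var]
  | and φ ψ h₁ h₂ => simp [subst, h₁, h₂]
  | or φ ψ h₁ h₂ => simp [subst, h₁, h₂]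
  | imp φ ψ h₁ h₂ => simp [subst, h₁, h₂]
  | all φ h => simp [subst, h, liftSubst_var]
  | ex φ h => simp [subst, h, liftSubst_var]

theorem lift_subst {n m : ℕ} (φ : IFml L n) (σ : Fin (n + 1) → L.Term (Fin m)) :
    φ.lift.subst σ = φ.subst (fun i => σ i.succ) := by
  simp [lift, rename, subst_subst, Term.subst]

theorem lift_inst {n : ℕ} (φ : IFml L n) (t : L.Term (Fin n)) : φ.lift.inst t = φ := by
  rw [inst, lift_subst]
  simpa using φ.subst_var

theorem liftSubst_inst {n m : ℕ} (φ : IFml L (n + 1)) (t : L.Term (Fin m))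
    (σ : Fin n → L.Term (Fin m)) :
    (φ.subst (liftSubst σ)).inst t = φ.subst (Fin.cons t σ) := by
  rw [inst, subst_subst]
  congr 1
  funext i
  refine Fin.cases ?_ (fun i => ?_) i
  · rfl
  · simp [liftSubst, Term.relabel_subst]
    exact Term.subst_var _

theorem rename_elim0_subst {n m : ℕ} (φ : ISent L) (σ : Fin n → L.Term (Fin m)) :
    (φ.rename Fin.elim0).subst σ = φ.rename Fin.elim0 := by
  rw [rename, rename, subst_subst]
  congr 1
  funext i
  exact i.elim0

theorem rename_elim0_lift {n : ℕ} (φ : ISent L) :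
    (φ.rename Fin.elim0 : IFml L n).lift = φ.rename Fin.elim0 := rename_elim0_subst _ _

theorem rename_elim0_self (φ : ISent L) : φ.rename Fin.elim0 = φ := by
  rw [rename]
  convert φ.subst_var using 2

end IFml

/-! ### Structural properties of derivations. -/

namespace Deriv

variable {L : FirstOrder.Language.{u, v}} {cl : Prop} {T : Set (ISent L)}

theorem weaken {n : ℕ} {Γ Δ : List (IFml L n)} {φ : IFml L n} (h : Deriv cl T Γ φ) (hs : Γ ⊆ Δ) :
    Deriv cl T Δ φ := by
  induction h with
  | ax h => exact .ax h
  | hyp h => exact .hyp (hs h)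
  | falsumE _ ih => exact .falsumE (ih hs)
  | andI _ _ ih₁ ih₂ => exact .andI (ih₁ hs) (ih₂ hs)
  | andE₁ _ ih => exact .andE₁ (ih hs)
  | andE₂ _ ih => exact .andE₂ (ih hs)
  | orI₁ _ ih => exact .orI₁ (ih hs)
  | orI₂ _ ih => exact .orI₂ (ih hs)
  | orE _ _ _ ih₁ ih₂ ih₃ =>
    exact .orE (ih₁ hs) (ih₂ (List.cons_subset_cons _ hs)) (ih₃ (List.cons_subset_cons _ hs))
  | impI _ ih => exact .impI (ih (List.cons_subset_cons _ hs))
  | impE _ _ ih₁ ih₂ => exact .impE (ih₁ hs) (ih₂ hs)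
  | allI _ ih => exact .allI (ih (List.map_subset _ hs))
  | allE t _ ih => exact .allE t (ih hs)
  | exI t _ ih => exact .exI t (ih hs)
  | exE _ _ ih₁ ih₂ =>
    exact .exE (ih₁ hs) (ih₂ (List.cons_subset_cons _ (List.map_subset _ hs)))
  | eqRefl t => exact .eqRefl t
  | eqSubst φ _ _ ih₁ ih₂ => exact .eqSubst φ (ih₁ hs) (ih₂ hs)
  | dne hc _ ih => exact .dne hc (ih hs)

theorem mono {cl' : Prop} {T' : Set (ISent L)} {n : ℕ} {Γ : List (IFml L n)} {φ : IFml L n}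
    (h : Deriv cl T Γ φ) (hc : cl → cl') (hT : T ⊆ T') : Deriv cl' T' Γ φ := by
  induction h with
  | ax h => exact .ax (hT h)
  | hyp h => exact .hyp h
  | falsumE _ ih => exact .falsumE ih
  | andI _ _ ih₁ ih₂ => exact .andI ih₁ ih₂
  | andE₁ _ ih => exact .andE₁ ih
  | andE₂ _ ih => exact .andE₂ ih
  | orI₁ _ ih => exact .orI₁ ih
  | orI₂ _ ih => exact .orI₂ ih
  | orE _ _ _ ih₁ ih₂ ih₃ => exact .orE ih₁ ih₂ ih₃
  | impI _ ih => exact .impI ih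
  | impE _ _ ih₁ ih₂ => exact .impE ih₁ ih₂
  | allI _ ih => exact .allI ih
  | allE t _ ih => exact .allE t ih
  | exI t _ ih => exact .exI t ih
  | exE _ _ ih₁ ih₂ => exact .exE ih₁ ih₂
  | eqRefl t => exact .eqRefl t
  | eqSubst φ _ _ ih₁ ih₂ => exact .eqSubst φ ih₁ ih₂
  | dne h _ ih => exact .dne (hc h) ih

/-- A derivation from `A ∪ B` uses only finitely many axioms of `B`, which can be turned into
open assumptions. -/
theorem exists_hyps {A B : Set (ISent L)} {n : ℕ} {Γ : List (IFml L n)} {φ : IFml L n}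
    (h : Deriv cl (A ∪ B) Γ φ) :
    ∃ Δ : List (ISent L), (∀ χ ∈ Δ, χ ∈ B) ∧
      Deriv cl A (Γ ++ Δ.map (fun χ => χ.rename Fin.elim0)) φ := by
  have key : ∀ {n : ℕ} {Γ : List (IFml L n)} {φ : IFml L n} {Δ Δ' : List (ISent L)},
      Deriv cl A (Γ ++ Δ.map (fun χ => χ.rename Fin.elim0)) φ → Δ ⊆ Δ' →
      Deriv cl A (Γ ++ Δ'.map (fun χ => χ.rename Fin.elim0)) φ := fun h hs =>
    h.weaken (List.append_subset.2 ⟨List.subset_append_left _ _,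
      List.Subset.trans (List.map_subset _ hs) (List.subset_append_right _ _)⟩)
  have app : ∀ {Δ Δ' : List (ISent L)}, (∀ χ ∈ Δ, χ ∈ B) → (∀ χ ∈ Δ', χ ∈ B) →
      ∀ χ ∈ Δ ++ Δ', χ ∈ B := by
    intro Δ Δ' h h' χ hχ
    rcases List.mem_append.1 hχ with hχ | hχ
    exacts [h _ hχ, h' _ hχ]
  -- Sentences are unchanged by lifting, so the added assumptions pass unharmed through the
  -- quantifier rules.
  have lft : ∀ {n : ℕ} (Δ : List (ISent L)),
      (Δ.map (fun χ => (χ.rename Fin.elim0 : IFml L n))).map IFml.lift =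
        Δ.map (fun χ => χ.rename Fin.elim0) := by
    intro n Δ
    simp [IFml.rename_elim0_lift]
  induction h with
  | @ax n Γ φ h =>
    rcases h with h | h
    · exact ⟨[], by simp, .ax h⟩
    · exact ⟨[φ], by simpa using h, .hyp (by simp)⟩
  | hyp h => exact ⟨[], by simp, .hyp (by simpa using h)⟩
  | falsumE _ ih =>
    obtain ⟨Δ, h, d⟩ := ih
    exact ⟨Δ, h, .falsumE d⟩
  | andI _ _ ih₁ ih₂ =>
    obtain ⟨Δ, h, d⟩ := ih₁
    obtain ⟨Δ', h', d'⟩ := ih₂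
    exact ⟨Δ ++ Δ', app h h', .andI (key d (by simp)) (key d' (by simp))⟩
  | andE₁ _ ih =>
    obtain ⟨Δ, h, d⟩ := ih
    exact ⟨Δ, h, .andE₁ d⟩
  | andE₂ _ ih =>
    obtain ⟨Δ, h, d⟩ := ih
    exact ⟨Δ, h, .andE₂ d⟩
  | orI₁ _ ih =>
    obtain ⟨Δ, h, d⟩ := ih
    exact ⟨Δ, h, .orI₁ d⟩
  | orI₂ _ ih =>
    obtain ⟨Δ, h, d⟩ := ih
    exact ⟨Δ, h, .orI₂ d⟩
  | orE _ _ _ ih₁ ih₂ ih₃ =>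
    obtain ⟨Δ, h, d⟩ := ih₁
    obtain ⟨Δ', h', d'⟩ := ih₂
    obtain ⟨Δ'', h'', d''⟩ := ih₃
    exact ⟨Δ ++ (Δ' ++ Δ''), app h (app h' h''), .orE (key d (by simp)) (key d' (by simp))
      (key d'' (by simp))⟩
  | impI _ ih =>
    obtain ⟨Δ, h, d⟩ := ih
    exact ⟨Δ, h, .impI d⟩
  | impE _ _ ih₁ ih₂ =>
    obtain ⟨Δ, h, d⟩ := ih₁
    obtain ⟨Δ', h', d'⟩ := ih₂
    exact ⟨Δ ++ Δ', app h h', .impE (key d (by simp)) (key d' (by simp))⟩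
  | allI _ ih =>
    obtain ⟨Δ, h, d⟩ := ih
    exact ⟨Δ, h, .allI (by rw [List.map_append, lft]; exact d)⟩
  | allE t _ ih =>
    obtain ⟨Δ, h, d⟩ := ih
    exact ⟨Δ, h, .allE t d⟩
  | exI t _ ih =>
    obtain ⟨Δ, h, d⟩ := ih
    exact ⟨Δ, h, .exI t d⟩
  | exE _ _ ih₁ ih₂ =>
    obtain ⟨Δ, h, d⟩ := ih₁
    obtain ⟨Δ', h', d'⟩ := ih₂
    exact ⟨Δ ++ Δ', app h h', .exE (key d (by simp))
      (by rw [List.map_append, lft]; exact key d' (by simp))⟩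
  | eqRefl t => exact ⟨[], by simp, .eqRefl t⟩
  | eqSubst φ _ _ ih₁ ih₂ =>
    obtain ⟨Δ, h, d⟩ := ih₁
    obtain ⟨Δ', h', d'⟩ := ih₂
    exact ⟨Δ ++ Δ', app h h', .eqSubst φ (key d (by simp)) (key d' (by simp))⟩
  | dne hc _ ih =>
    obtain ⟨Δ, h, d⟩ := ih
    exact ⟨Δ, h, .dne hc d⟩

theorem cut_list {n : ℕ} {Γ Δ : List (IFml L n)} {φ : IFml L n} (h : Deriv cl T (Δ ++ Γ) φ)
    (hΔ : ∀ χ ∈ Δ, Deriv cl T Γ χ) : Deriv cl T Γ φ := by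
  induction Δ generalizing φ with
  | nil => exact h
  | cons χ Δ ih =>
    exact .impE (ih (.impI h) fun ψ hψ => hΔ ψ (List.mem_cons_of_mem _ hψ))
      (hΔ χ List.mem_cons_self)

end Deriv

/-! ### Deduction theorem, cut and compactness for sentences. -/

namespace ProvI

variable {L : FirstOrder.Language.{u, v}} {T : Set (ISent L)}

theorem of_mem {φ : ISent L} (h : φ ∈ T) : ProvI T φ := by
  have := Deriv.ax (cl := False) (T := T) (Γ := []) (n := 0) h
  rwa [IFml.rename_elim0_self] at this

theorem mono {T' : Set (ISent L)} {φ : ISent L} (h : ProvI T φ) (hT : T ⊆ T') : ProvI T' φ :=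
  Deriv.mono h id hT

theorem exists_list {A B : Set (ISent L)} {φ : ISent L} (h : ProvI (A ∪ B) φ) :
    ∃ Δ : List (ISent L), (∀ χ ∈ Δ, χ ∈ B) ∧ Deriv False A Δ φ := by
  obtain ⟨Δ, h, d⟩ := Deriv.exists_hyps h
  exact ⟨Δ, h, by simpa [IFml.rename_elim0_self] using d⟩

theorem of_deriv {Δ : List (ISent L)} {φ : ISent L} (h : Deriv False T Δ φ)
    (hΔ : ∀ χ ∈ Δ, ProvI T χ) : ProvI T φ :=
  Deriv.cut_list (Γ := []) (by simpa using h) hΔ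

/-- The deduction theorem. -/
theorem imp_of_insert {φ ψ : ISent L} (h : ProvI (insert ψ T) φ) : ProvI T (ψ.imp φ) := by
  rw [Set.insert_eq, Set.union_comm] at h
  obtain ⟨Δ, h, d⟩ := exists_list h
  refine Deriv.impI (d.weaken fun χ hχ => ?_)
  rw [h χ hχ]
  exact List.mem_cons_self

theorem cut {T' : Set (ISent L)} {φ : ISent L} (h : ProvI T' φ) (hT : ∀ χ ∈ T', ProvI T χ) :
    ProvI T φ := by
  rw [← Set.empty_union T'] at h
  obtain ⟨Δ, h, d⟩ := exists_list h
  exact of_deriv (d.mono id (Set.empty_subset _)) fun χ hχ => hT χ (h χ hχ)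

/-- A derivation uses finitely many axioms, and these lie in a single member of the family. This
feeds Zorn's lemma and the union over stages in the Henkin construction. -/
theorem exists_mem_of_directed {c : Set (Set (ISent L))} (hc : DirectedOn (· ⊆ ·) c)
    (hne : c.Nonempty) {φ : ISent L} (h : ProvI (⋃₀ c) φ) : ∃ T ∈ c, ProvI T φ := by
  rw [← Set.empty_union (⋃₀ c)] at h
  obtain ⟨Δ, h, d⟩ := exists_list h
  have : ∃ T ∈ c, ∀ χ ∈ Δ, χ ∈ T := by
    clear d
    induction Δ with
    | nil => exact ⟨hne.some, hne.some_mem, by simp⟩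
    | cons χ Δ ih =>
      obtain ⟨T, hT, h₁⟩ := ih fun χ hχ => h χ (List.mem_cons_of_mem _ hχ)
      obtain ⟨T', hT', h₂⟩ := h χ List.mem_cons_self
      obtain ⟨T'', hT'', h₃, h₄⟩ := hc T hT T' hT'
      refine ⟨T'', hT'', fun ψ hψ => ?_⟩
      rcases List.mem_cons.1 hψ with rfl | hψ
      exacts [h₄ h₂, h₃ (h₁ _ hψ)]
  obtain ⟨T, hT, h⟩ := this
  exact ⟨T, hT, of_deriv (d.mono id (Set.empty_subset _)) fun χ hχ => of_mem (h χ hχ)⟩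

end ProvI

/-! ### Translation of constants into terms -/

section Translation

universe u' v' x

variable {L : FirstOrder.Language.{u, v}} {L' : FirstOrder.Language.{u', v'}} {X : Type x}

/-- The value at a constant symbol of a function on the constants. -/
def constVal {β : Type*} (ρ : X → β) : {n : ℕ} → (constantsOn X).Functions n → β
  | 0, c => ρ c
  | _ + 1, c => PEmpty.elim c

/-- Translation of `L[[X]]`-terms into `L'`-terms: the constant of `x : X` becomes the term
`ρ x`, and the variable `a` becomes `f a`. -/
def trTerm (g : L →ᴸ L') {α β : Type*} (ρ : X → L'.Term β) (f : α → L'.Term β) :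
    L[[X]].Term α → L'.Term β
  | .var a => f a
  | .func (Sum.inl F) ts => .func (g.onFunction F) (fun i => trTerm g ρ f (ts i))
  | .func (Sum.inr c) _ => constVal ρ c

/-- The constants of `X` occurring in a term. -/
def termConsts {α : Type*} : L[[X]].Term α → Set X
  | .var _ => ∅
  | .func (Sum.inl _) ts => ⋃ i, termConsts (ts i)
  | .func (Sum.inr c) _ => {constVal id c}

variable {α β γ : Type*}

/-- The constant of `x : X` as a term. -/
def conTerm (L : FirstOrder.Language.{u, v}) (x : X) : L[[X]].Term α := (L.con x).term

/-- Induction for terms of a language with constants. -/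
theorem withConstants_term_induction {P : L[[X]].Term α → Prop} (hvar : ∀ a, P (.var a))
    (hfun : ∀ {n : ℕ} (F : L.Functions n) (ts : Fin n → L[[X]].Term α),
      (∀ i, P (ts i)) → P (.func (Sum.inl F) ts))
    (hcon : ∀ x, P (conTerm L x)) (t : L[[X]].Term α) : P t := by
  induction t with
  | var a => exact hvar a
  | @func n F ts ih =>
    rcases F with F | c
    · exact hfun F ts ih
    · match n, c with
      | 0, c =>
        have : ts = default := Subsingleton.elim _ _
        rw [this]
        exact hcon c
      | n + 1, c => exact PEmpty.elim c

@[simp] theorem trTerm_var (g : L →ᴸ L') (ρ : X → L'.Term β) (f : α → L'.Term β) (a : α) :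
    trTerm g ρ f (.var a) = f a := rfl

@[simp] theorem trTerm_func (g : L →ᴸ L') (ρ : X → L'.Term β) (f : α → L'.Term β) {n : ℕ}
    (F : L.Functions n) (ts : Fin n → L[[X]].Term α) :
    trTerm g ρ f (.func (Sum.inl F) ts) =
      .func (g.onFunction F) (fun i => trTerm g ρ f (ts i)) := rfl

@[simp] theorem trTerm_con (g : L →ᴸ L') (ρ : X → L'.Term β) (f : α → L'.Term β) (x : X) :
    trTerm g ρ f (conTerm L x) = ρ x := rfl

@[simp] theorem conTerm_subst (x : X) (σ : α → L[[X]].Term β) :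
    (conTerm L x).subst σ = conTerm L x := by
  simp only [conTerm, Constants.term, Term.subst]
  congr 1
  exact Subsingleton.elim _ _

@[simp] theorem conTerm_relabel (x : X) (g : α → β) :
    (conTerm L x).relabel g = conTerm L x := by
  simp only [conTerm, Constants.term, Term.relabel]
  congr 1
  exact Subsingleton.elim _ _

theorem trTerm_subst (g : L →ᴸ L') (ρ : X → L'.Term γ) (f : β → L'.Term γ)
    (σ : α → L[[X]].Term β) (t : L[[X]].Term α) :
    trTerm g ρ f (t.subst σ) = trTerm g ρ (fun i => trTerm g ρ f (σ i)) t := by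
  induction t using withConstants_term_induction with
  | hvar a => rfl
  | hfun F ts ih => simp [Term.subst, ih]
  | hcon x => simp

theorem subst_trTerm (g : L →ᴸ L') (ρ : X → L'.Term β) (f : α → L'.Term β)
    (σ : β → L'.Term γ) (t : L[[X]].Term α) :
    (trTerm g ρ f t).subst σ = trTerm g (fun x => (ρ x).subst σ) (fun i => (f i).subst σ) t := by
  induction t using withConstants_term_induction with
  | hvar a => rfl
  | hfun F ts ih => simp [Term.subst, ih]
  | hcon x => simp

theorem trTerm_conTerm (f : α → L[[X]].Term β) (t : L[[X]].Term α) :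
    trTerm (L.lhomWithConstants X) (conTerm L) f t = t.subst f := by
  induction t using withConstants_term_induction with
  | hvar a => rfl
  | hfun F ts ih => exact congrArg (Term.func _) (funext ih)
  | hcon x => simp

theorem trTerm_onTerm (g : L →ᴸ L') (ρ : X → L'.Term β) (f : α → L'.Term β) (t : L.Term α) :
    trTerm g ρ f ((L.lhomWithConstants X).onTerm t) = (g.onTerm t).subst f := by
  induction t with
  | var => rfl
  | func F ts ih => exact congrArg (Term.func _) (funext ih)

theorem trTerm_congr (g : L →ᴸ L') {ρ ρ' : X → L'.Term β} (f : α → L'.Term β) (t : L[[X]].Term α)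
    (h : ∀ x ∈ termConsts t, ρ x = ρ' x) : trTerm g ρ f t = trTerm g ρ' f t := by
  induction t using withConstants_term_induction with
  | hvar a => rfl
  | hfun F ts ih =>
    simp only [trTerm_func]
    congr 1
    funext i
    exact ih i fun x hx => h x (Set.mem_iUnion.2 ⟨i, hx⟩)
  | hcon x => exact h x rfl

theorem termConsts_subst (t : L[[X]].Term α) (σ : α → L[[X]].Term β) {S : Set X}
    (ht : termConsts t ⊆ S) (hσ : ∀ i, termConsts (σ i) ⊆ S) : termConsts (t.subst σ) ⊆ S := by
  induction t using withConstants_term_induction with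
  | hvar a => exact hσ a
  | hfun F ts ih =>
    exact Set.iUnion_subset fun i => ih i ((Set.subset_iUnion (fun i => termConsts (ts i)) i).trans ht)
  | hcon x =>
    rw [conTerm_subst]
    exact ht

theorem termConsts_relabel (t : L[[X]].Term α) (g : α → β) :
    termConsts (t.relabel g) = termConsts t := by
  induction t using withConstants_term_induction with
  | hvar a => rfl
  | hfun F ts ih => exact Set.iUnion_congr ih
  | hcon x => simp; rfl

theorem termConsts_finite (t : L[[X]].Term α) : (termConsts t).Finite := by
  induction t using withConstants_term_induction with
  | hvar a => exact Set.finite_empty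
  | hfun F ts ih => exact Set.finite_iUnion ih
  | hcon x => exact Set.finite_singleton _

theorem termConsts_onTerm (t : L.Term α) : termConsts ((L.lhomWithConstants X).onTerm t) = ∅ := by
  induction t with
  | var => rfl
  | func F ts ih => exact Set.iUnion_eq_empty.2 ih

namespace IFml

/-- Translation of `L[[X]]`-formulas into `L'`-formulas, with the constants of `X` replaced by
terms and a simultaneous substitution for the variables. -/
def tr (g : L →ᴸ L') : {n m : ℕ} → IFml L[[X]] n → (X → L'.Term (Fin m)) →
    (Fin n → L'.Term (Fin m)) → IFml L' m
  | _, _, falsum, _, _ => falsum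
  | _, _, equal t s, ρ, f => equal (trTerm g ρ f t) (trTerm g ρ f s)
  | _, _, rel (Sum.inl R) ts, ρ, f => rel (g.onRelation R) (fun i => trTerm g ρ f (ts i))
  | _, _, rel (Sum.inr R) _, _, _ => Empty.elim R
  | _, _, and φ ψ, ρ, f => and (φ.tr g ρ f) (ψ.tr g ρ f)
  | _, _, or φ ψ, ρ, f => or (φ.tr g ρ f) (ψ.tr g ρ f)
  | _, _, imp φ ψ, ρ, f => imp (φ.tr g ρ f) (ψ.tr g ρ f)
  | _, _, all φ, ρ, f => all (φ.tr g (fun x => (ρ x).relabel Fin.succ) (liftSubst f))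
  | _, _, ex φ, ρ, f => ex (φ.tr g (fun x => (ρ x).relabel Fin.succ) (liftSubst f))

/-- The constants of `X` occurring in a formula. -/
def consts : {n : ℕ} → IFml L[[X]] n → Set X
  | _, falsum => ∅
  | _, equal t s => termConsts t ∪ termConsts s
  | _, rel _ ts => ⋃ i, termConsts (ts i)
  | _, and φ ψ => φ.consts ∪ ψ.consts
  | _, or φ ψ => φ.consts ∪ ψ.consts
  | _, imp φ ψ => φ.consts ∪ ψ.consts
  | _, all φ => φ.consts
  | _, ex φ => φ.consts

theorem trTerm_liftSubst {n m p : ℕ} (g : L →ᴸ L') (ρ : X → L'.Term (Fin p))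
    (f : Fin m → L'.Term (Fin p)) (σ : Fin n → L[[X]].Term (Fin m)) :
    (fun i => trTerm g (fun x => (ρ x).relabel Fin.succ) (liftSubst f) (liftSubst σ i)) =
      liftSubst (fun i => trTerm g ρ f (σ i)) := by
  funext i
  refine Fin.cases ?_ (fun i => ?_) i
  · rfl
  · simp only [liftSubst, Fin.cons_succ, Term.relabel_eq_subst, trTerm_subst, subst_trTerm]
    rfl

theorem tr_subst (g : L →ᴸ L') {n m p : ℕ} (φ : IFml L[[X]] n) (ρ : X → L'.Term (Fin p))
    (f : Fin m → L'.Term (Fin p)) (σ : Fin n → L[[X]].Term (Fin m)) :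
    (φ.subst σ).tr g ρ f = φ.tr g ρ (fun i => trTerm g ρ f (σ i)) := by
  induction φ generalizing m p with
  | falsum => rfl
  | equal t s => simp [subst, tr, trTerm_subst]
  | rel R ts =>
    rcases R with R | R
    · simp [subst, tr, trTerm_subst]
    · exact Empty.elim R
  | and φ ψ h₁ h₂ => simp [subst, tr, h₁, h₂]
  | or φ ψ h₁ h₂ => simp [subst, tr, h₁, h₂]
  | imp φ ψ h₁ h₂ => simp [subst, tr, h₁, h₂]
  | all φ h => simp [subst, tr, h, trTerm_liftSubst]
  | ex φ h => simp [subst, tr, h, trTerm_liftSubst]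

theorem subst_tr (g : L →ᴸ L') {n m p : ℕ} (φ : IFml L[[X]] n) (ρ : X → L'.Term (Fin m))
    (f : Fin n → L'.Term (Fin m)) (σ : Fin m → L'.Term (Fin p)) :
    (φ.tr g ρ f).subst σ = φ.tr g (fun x => (ρ x).subst σ) (fun i => (f i).subst σ) := by
  have key : ∀ {m p : ℕ} (ρ : X → L'.Term (Fin m)) (σ : Fin m → L'.Term (Fin p)),
      (fun x => ((ρ x).relabel Fin.succ).subst (liftSubst σ)) =
        fun x => ((ρ x).subst σ).relabel Fin.succ := by
    intro m p ρ σ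
    funext x
    rw [Term.relabel_subst, Term.subst_relabel]
    rfl
  induction φ generalizing m p with
  | falsum => rfl
  | equal t s => simp [subst, tr, subst_trTerm]
  | rel R ts =>
    rcases R with R | R
    · simp [subst, tr, subst_trTerm]
    · exact Empty.elim R
  | and φ ψ h₁ h₂ => simp [subst, tr, h₁, h₂]
  | or φ ψ h₁ h₂ => simp [subst, tr, h₁, h₂]
  | imp φ ψ h₁ h₂ => simp [subst, tr, h₁, h₂]
  | all φ h => simp [subst, tr, h, liftSubst_subst, key]
  | ex φ h => simp [subst, tr, h, liftSubst_subst, key]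

/-- Sending every constant to itself turns the translation into a plain substitution. Changing the
value of a single constant then expresses the replacement of that constant by a variable. -/
theorem tr_conTerm {n m : ℕ} (φ : IFml L[[X]] n) (f : Fin n → L[[X]].Term (Fin m)) :
    φ.tr (L.lhomWithConstants X) (conTerm L) f = φ.subst f := by
  induction φ generalizing m with
  | falsum => rfl
  | equal t s => simp [subst, tr, trTerm_conTerm]
  | rel R ts =>
    rcases R with R | R
    · simp only [subst, tr, trTerm_conTerm]
      rfl
    · exact Empty.elim R
  | and φ ψ h₁ h₂ => simp [subst, tr, h₁, h₂]
  | or φ ψ h₁ h₂ => simp [subst, tr, h₁, h₂]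
  | imp φ ψ h₁ h₂ => simp [subst, tr, h₁, h₂]
  | all φ h => simp [subst, tr, ← h]
  | ex φ h => simp [subst, tr, ← h]

theorem tr_onLang (g : L →ᴸ L') {n m : ℕ} (φ : IFml L n) (ρ : X → L'.Term (Fin m))
    (f : Fin n → L'.Term (Fin m)) :
    (φ.onLang (L.lhomWithConstants X)).tr g ρ f = (φ.onLang g).subst f := by
  induction φ generalizing m with
  | falsum => rfl
  | equal t s => simp [onLang, subst, tr, trTerm_onTerm]
  | rel R ts => simp [onLang, subst, tr, trTerm_onTerm]
  | and φ ψ h₁ h₂ => simp [onLang, subst, tr, h₁, h₂]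
  | or φ ψ h₁ h₂ => simp [onLang, subst, tr, h₁, h₂]
  | imp φ ψ h₁ h₂ => simp [onLang, subst, tr, h₁, h₂]
  | all φ h => simp [onLang, subst, tr, h]
  | ex φ h => simp [onLang, subst, tr, h]

theorem onLang_id {n : ℕ} (φ : IFml L n) : φ.onLang (LHom.id L) = φ := by
  induction φ with
  | falsum => rfl
  | equal t s => simp [onLang]
  | rel R ts => simp [onLang]
  | and φ ψ h₁ h₂ => simp [onLang, h₁, h₂]
  | or φ ψ h₁ h₂ => simp [onLang, h₁, h₂]
  | imp φ ψ h₁ h₂ => simp [onLang, h₁, h₂]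
  | all φ h => simp [onLang, h]
  | ex φ h => simp [onLang, h]

/-- Arguments about fresh constants rest on this: altering the value of a constant that does not
occur has no effect. -/
theorem tr_congr (g : L →ᴸ L') {n m : ℕ} (φ : IFml L[[X]] n) {ρ ρ' : X → L'.Term (Fin m)}
    (f : Fin n → L'.Term (Fin m)) (h : ∀ x ∈ φ.consts, ρ x = ρ' x) :
    φ.tr g ρ f = φ.tr g ρ' f := by
  induction φ generalizing m with
  | falsum => rfl
  | equal t s =>
    simp only [tr]
    rw [trTerm_congr g f t fun x hx => h x (Or.inl hx),
      trTerm_congr g f s fun x hx => h x (Or.inr hx)]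
  | rel R ts =>
    rcases R with R | R
    · simp only [tr]
      congr 1
      funext i
      exact trTerm_congr g f _ fun x hx => h x (Set.mem_iUnion.2 ⟨i, hx⟩)
    · exact Empty.elim R
  | and φ ψ h₁ h₂ =>
    simp only [tr]
    rw [h₁ f fun x hx => h x (Or.inl hx), h₂ f fun x hx => h x (Or.inr hx)]
  | or φ ψ h₁ h₂ =>
    simp only [tr]
    rw [h₁ f fun x hx => h x (Or.inl hx), h₂ f fun x hx => h x (Or.inr hx)]
  | imp φ ψ h₁ h₂ =>
    simp only [tr]
    rw [h₁ f fun x hx => h x (Or.inl hx), h₂ f fun x hx => h x (Or.inr hx)]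
  | all φ ih =>
    simp only [tr]
    rw [ih _ fun x hx => congrArg _ (h x hx)]
  | ex φ ih =>
    simp only [tr]
    rw [ih _ fun x hx => congrArg _ (h x hx)]

theorem consts_subst {n m : ℕ} (φ : IFml L[[X]] n) (σ : Fin n → L[[X]].Term (Fin m)) {S : Set X}
    (hφ : φ.consts ⊆ S) (hσ : ∀ i, termConsts (σ i) ⊆ S) : (φ.subst σ).consts ⊆ S := by
  have key : ∀ {n m : ℕ} (σ : Fin n → L[[X]].Term (Fin m)), (∀ i, termConsts (σ i) ⊆ S) →
      ∀ i, termConsts (liftSubst σ i) ⊆ S := by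
    intro n m σ hσ i
    refine Fin.cases ?_ (fun i => ?_) i
    · exact Set.empty_subset _
    · simpa [liftSubst, termConsts_relabel] using hσ i
  induction φ generalizing m with
  | falsum => exact hφ
  | equal t s =>
    exact Set.union_subset (termConsts_subst t σ (Set.union_subset_iff.1 hφ).1 hσ)
      (termConsts_subst s σ (Set.union_subset_iff.1 hφ).2 hσ)
  | rel R ts =>
    exact Set.iUnion_subset fun i => termConsts_subst _ σ (Set.iUnion_subset_iff.1 hφ i) hσ
  | and φ ψ h₁ h₂ =>
    exact Set.union_subset (h₁ σ (Set.union_subset_iff.1 hφ).1 hσ)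
      (h₂ σ (Set.union_subset_iff.1 hφ).2 hσ)
  | or φ ψ h₁ h₂ =>
    exact Set.union_subset (h₁ σ (Set.union_subset_iff.1 hφ).1 hσ)
      (h₂ σ (Set.union_subset_iff.1 hφ).2 hσ)
  | imp φ ψ h₁ h₂ =>
    exact Set.union_subset (h₁ σ (Set.union_subset_iff.1 hφ).1 hσ)
      (h₂ σ (Set.union_subset_iff.1 hφ).2 hσ)
  | all φ h => exact h _ hφ (key σ hσ)
  | ex φ h => exact h _ hφ (key σ hσ)

theorem consts_finite {n : ℕ} (φ : IFml L[[X]] n) : φ.consts.Finite := by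
  induction φ with
  | falsum => exact Set.finite_empty
  | equal t s => exact (termConsts_finite t).union (termConsts_finite s)
  | rel R ts => exact Set.finite_iUnion fun i => termConsts_finite _
  | and φ ψ h₁ h₂ => exact h₁.union h₂
  | or φ ψ h₁ h₂ => exact h₁.union h₂
  | imp φ ψ h₁ h₂ => exact h₁.union h₂
  | all φ h => exact h
  | ex φ h => exact h

theorem consts_onLang {n : ℕ} (φ : IFml L n) :
    (φ.onLang (L.lhomWithConstants X)).consts = ∅ := by
  induction φ with
  | falsum => rfl
  | equal t s => simp [onLang, consts, termConsts_onTerm]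
  | rel R ts => simp [onLang, consts, termConsts_onTerm]
  | and φ ψ h₁ h₂ => simp [onLang, consts, h₁, h₂]
  | or φ ψ h₁ h₂ => simp [onLang, consts, h₁, h₂]
  | imp φ ψ h₁ h₂ => simp [onLang, consts, h₁, h₂]
  | all φ h => simp [onLang, consts, h]
  | ex φ h => simp [onLang, consts, h]

theorem tr_lift (g : L →ᴸ L') {n m : ℕ} (φ : IFml L[[X]] n) (ρ : X → L'.Term (Fin m))
    (f : Fin n → L'.Term (Fin m)) :
    φ.lift.tr g (fun x => (ρ x).relabel Fin.succ) (liftSubst f) = (φ.tr g ρ f).lift := by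
  rw [lift, rename, tr_subst, lift, rename, subst_tr]
  congr 1
  · funext x
    rw [Term.relabel_eq_subst]
    rfl
  · funext i
    simp [liftSubst, Term.relabel_eq_subst]
    rfl

theorem tr_inst (g : L →ᴸ L') {n m : ℕ} (φ : IFml L[[X]] (n + 1)) (t : L[[X]].Term (Fin n))
    (ρ : X → L'.Term (Fin m)) (f : Fin n → L'.Term (Fin m)) :
    (φ.inst t).tr g ρ f =
      (φ.tr g (fun x => (ρ x).relabel Fin.succ) (liftSubst f)).inst (trTerm g ρ f t) := by
  rw [inst, tr_subst, inst, subst_tr]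
  congr 1
  · funext x
    rw [Term.relabel_subst]
    exact (Term.subst_var _).symm
  · funext i
    refine Fin.cases ?_ (fun i => ?_) i
    · rfl
    · simp only [Fin.cons_succ, liftSubst, Term.relabel_subst, trTerm_var]
      exact (Term.subst_var _).symm

end IFml

/-- Derivations are preserved by translations that send axioms to axioms. -/
theorem Deriv.tr {cl : Prop} {T : Set (ISent L[[X]])} {T' : Set (ISent L')} (g : L →ᴸ L')
    (S : Set X) (κ : X → L'.Term (Fin 0))
    -- Axioms must be handled for all `ρ` because each quantifier rule shifts the values of the
    -- constants. The constants in `S` keep closed values `κ`, which survive the shift; the others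
    -- may become open terms.
    (hT : ∀ χ ∈ T, ∀ {m : ℕ} (ρ : X → L'.Term (Fin m)),
      (∀ x ∈ S, ρ x = (κ x).relabel Fin.elim0) →
      ∃ χ' ∈ T', χ.tr g ρ Fin.elim0 = χ'.rename Fin.elim0)
    {n m : ℕ} {Γ : List (IFml L[[X]] n)} {φ : IFml L[[X]] n} (h : Deriv cl T Γ φ)
    (ρ : X → L'.Term (Fin m)) (hρ : ∀ x ∈ S, ρ x = (κ x).relabel Fin.elim0)
    (f : Fin n → L'.Term (Fin m)) :
    Deriv cl T' (Γ.map fun χ => χ.tr g ρ f) (φ.tr g ρ f) := by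
  have hl : ∀ {m : ℕ} {ρ : X → L'.Term (Fin m)}, (∀ x ∈ S, ρ x = (κ x).relabel Fin.elim0) →
      ∀ x ∈ S, (ρ x).relabel Fin.succ = (κ x).relabel Fin.elim0 := by
    intro m ρ hρ x hx
    rw [hρ x hx, Term.relabel_relabel]
    congr 1
    funext i
    exact i.elim0
  have hΓ : ∀ {n m : ℕ} (Γ : List (IFml L[[X]] n)) (ρ : X → L'.Term (Fin m))
      (f : Fin n → L'.Term (Fin m)),
      (Γ.map IFml.lift).map
        (fun χ => χ.tr g (fun x => (ρ x).relabel Fin.succ) (IFml.liftSubst f)) =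
        (Γ.map fun χ => χ.tr g ρ f).map IFml.lift := by
    intro n m Γ ρ f
    simp [IFml.tr_lift]
  induction h generalizing m with
  | @ax n Γ φ h =>
    obtain ⟨χ', h', e⟩ := hT φ h ρ hρ
    rw [IFml.rename, IFml.tr_subst]
    have : (fun i : Fin 0 => trTerm g ρ f (Term.var (Fin.elim0 i))) = Fin.elim0 := by
      funext i
      exact i.elim0
    rw [this, e]
    exact .ax h'
  | hyp h => exact .hyp (List.mem_map_of_mem h)
  | falsumE _ ih => exact .falsumE (ih ρ hρ f)
  | andI _ _ ih₁ ih₂ => exact .andI (ih₁ ρ hρ f) (ih₂ ρ hρ f)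
  | andE₁ _ ih => exact .andE₁ (ih ρ hρ f)
  | andE₂ _ ih => exact .andE₂ (ih ρ hρ f)
  | orI₁ _ ih => exact .orI₁ (ih ρ hρ f)
  | orI₂ _ ih => exact .orI₂ (ih ρ hρ f)
  | orE _ _ _ ih₁ ih₂ ih₃ => exact .orE (ih₁ ρ hρ f) (ih₂ ρ hρ f) (ih₃ ρ hρ f)
  | impI _ ih => exact .impI (ih ρ hρ f)
  | impE _ _ ih₁ ih₂ => exact .impE (ih₁ ρ hρ f) (ih₂ ρ hρ f)
  | allI _ ih =>
    refine .allI ?_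
    have := ih _ (hl hρ) (IFml.liftSubst f)
    rwa [hΓ] at this
  | allE t _ ih =>
    rw [IFml.tr_inst]
    exact .allE _ (ih ρ hρ f)
  | exI t _ ih =>
    refine .exI (trTerm g ρ f t) ?_
    rw [← IFml.tr_inst]
    exact ih ρ hρ f
  | exE _ _ ih₁ ih₂ =>
    refine .exE (ih₁ ρ hρ f) ?_
    have := ih₂ _ (hl hρ) (IFml.liftSubst f)
    rwa [List.map_cons, hΓ, IFml.tr_lift] at this
  | eqRefl t => exact .eqRefl _
  | eqSubst φ _ _ ih₁ ih₂ =>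
    have h₂ := ih₂ ρ hρ f
    rw [IFml.tr_inst] at h₂ ⊢
    exact .eqSubst _ (ih₁ ρ hρ f) h₂
  | dne hc _ ih => exact .dne hc (ih ρ hρ f)

end Translation

/-! ### Kripke semantics and soundness -/

namespace KripkeData

variable {L : FirstOrder.Language.{u, v}}

/-- The conditions on a Kripke model that are needed for the soundness of intuitionistic logic:
the transition maps need not be injective. -/
structure IsPreModel (K : KripkeData.{u, v, w} L) : Prop where
  refl : ∀ k, K.le k k
  trans : ∀ {k₁ k₂ k₃}, K.le k₁ k₂ → K.le k₂ k₃ → K.le k₁ k₃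
  map_self : ∀ {k} (h : K.le k k) (d : K.Dom k), K.map h d = d
  map_map : ∀ {k₁ k₂ k₃} (h₁ : K.le k₁ k₂) (h₂ : K.le k₂ k₃) (h₃ : K.le k₁ k₃) (d : K.Dom k₁),
    K.map h₂ (K.map h₁ d) = K.map h₃ d
  map_fun : ∀ {k k'} (h : K.le k k') {n : ℕ} (f : L.Functions n) (a : Fin n → K.Dom k),
    K.map h (Structure.funMap f a) = Structure.funMap f (K.map h ∘ a)
  map_rel : ∀ {k k'} (h : K.le k k') {n : ℕ} (R : L.Relations n) (a : Fin n → K.Dom k),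
    Structure.RelMap R a → Structure.RelMap R (K.map h ∘ a)

theorem IsKripkeModel.isPreModel {K : KripkeData.{u, v, w} L} (hK : K.IsKripkeModel) :
    K.IsPreModel :=
  ⟨hK.refl, hK.trans, hK.map_self, hK.map_map, hK.map_fun, hK.map_rel⟩

variable {K : KripkeData.{u, v, w} L}

theorem map_cons {k k' : K.Node} (h : K.le k k') {n : ℕ} (d : K.Dom k) (a : Fin n → K.Dom k) :
    K.map h ∘ (Fin.cons d a : Fin (n + 1) → K.Dom k) = Fin.cons (K.map h d) (K.map h ∘ a) := by
  funext i
  refine Fin.cases ?_ (fun i => ?_) i <;> rfl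

theorem forces_sentence {φ : ISent L} {k : K.Node} {a b : Fin 0 → K.Dom k} (h : K.Forces φ k a) :
    K.Forces φ k b := Subsingleton.elim a b ▸ h

namespace IsPreModel

theorem map_comp_self (hK : K.IsPreModel) {k : K.Node} (h : K.le k k) {n : ℕ}
    (a : Fin n → K.Dom k) : K.map h ∘ a = a := funext fun i => hK.map_self h (a i)

theorem map_comp_map (hK : K.IsPreModel) {k₁ k₂ k₃ : K.Node} (h₁ : K.le k₁ k₂)
    (h₂ : K.le k₂ k₃) (h₃ : K.le k₁ k₃) {n : ℕ} (a : Fin n → K.Dom k₁) :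
    K.map h₂ ∘ (K.map h₁ ∘ a) = K.map h₃ ∘ a := funext fun i => hK.map_map h₁ h₂ h₃ (a i)

theorem realize_map (hK : K.IsPreModel) {k k' : K.Node} (h : K.le k k') {α : Type*}
    (t : L.Term α) (a : α → K.Dom k) : t.realize (K.map h ∘ a) = K.map h (t.realize a) := by
  induction t with
  | var => rfl
  | func f ts ih =>
    simp only [Term.realize, ih, hK.map_fun]
    rfl

theorem forces_mono (hK : K.IsPreModel) {n : ℕ} (φ : IFml L n) {k k' : K.Node} (h : K.le k k')
    {a : Fin n → K.Dom k} (hf : K.Forces φ k a) : K.Forces φ k' (K.map h ∘ a) := by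
  induction φ generalizing k k' with
  | falsum => exact hf
  | equal t s =>
    simp only [Forces, hK.realize_map] at hf ⊢
    rw [hf]
  | rel R ts =>
    simp only [Forces, hK.realize_map] at hf ⊢
    exact hK.map_rel h R _ hf
  | and φ ψ h₁ h₂ => exact ⟨h₁ h hf.1, h₂ h hf.2⟩
  | or φ ψ h₁ h₂ => exact hf.imp (h₁ h) (h₂ h)
  | imp φ ψ h₁ h₂ =>
    intro k'' h'
    have := hf k'' (hK.trans h h')
    rwa [hK.map_comp_map h h' (hK.trans h h')]
  | all φ ih =>
    intro k'' h' d
    have := hf k'' (hK.trans h h') d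
    rwa [hK.map_comp_map h h' (hK.trans h h')]
  | ex φ ih =>
    obtain ⟨d, hd⟩ := hf
    refine ⟨K.map h d, ?_⟩
    have := ih h hd
    rwa [map_cons] at this

theorem realize_liftSubst {n m : ℕ} (σ : Fin n → L.Term (Fin m)) {D : Type*} [L.Structure D]
    (d : D) (a : Fin m → D) :
    (fun i => (IFml.liftSubst σ i).realize (Fin.cons d a : Fin (m + 1) → D)) =
      (Fin.cons d fun i => (σ i).realize a : Fin (n + 1) → D) := by
  funext i
  refine Fin.cases ?_ (fun i => ?_) i
  · rfl
  · simp only [IFml.liftSubst, Fin.cons_succ, Term.realize_relabel]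
    rfl

theorem forces_subst (hK : K.IsPreModel) {n m : ℕ} (φ : IFml L n) (σ : Fin n → L.Term (Fin m))
    {k : K.Node} (a : Fin m → K.Dom k) :
    K.Forces (φ.subst σ) k a ↔ K.Forces φ k (fun i => (σ i).realize a) := by
  have key : ∀ {n m : ℕ} (σ : Fin n → L.Term (Fin m)) {k k' : K.Node} (h : K.le k k')
      (a : Fin m → K.Dom k), (fun i => (σ i).realize (K.map h ∘ a)) =
        K.map h ∘ fun i => (σ i).realize a := by
    intro n m σ k k' h a
    funext i
    exact hK.realize_map h _ _
  induction φ generalizing m k with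
  | falsum => rfl
  | equal t s => simp [IFml.subst, Forces, Term.realize_subst]
  | rel R ts => simp [IFml.subst, Forces, Term.realize_subst]
  | and φ ψ h₁ h₂ => simp only [IFml.subst, Forces, h₁, h₂]
  | or φ ψ h₁ h₂ => simp only [IFml.subst, Forces, h₁, h₂]
  | imp φ ψ h₁ h₂ => simp only [IFml.subst, Forces, h₁, h₂, key]
  | all φ ih => simp only [IFml.subst, Forces, ih, realize_liftSubst, key]
  | ex φ ih => simp only [IFml.subst, Forces, ih, realize_liftSubst]

theorem forces_rename (hK : K.IsPreModel) {n m : ℕ} (φ : IFml L n) (f : Fin n → Fin m)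
    {k : K.Node} (a : Fin m → K.Dom k) : K.Forces (φ.rename f) k a ↔ K.Forces φ k (a ∘ f) :=
  hK.forces_subst φ _ a

theorem forces_lift (hK : K.IsPreModel) {n : ℕ} (φ : IFml L n) {k : K.Node} (d : K.Dom k)
    (a : Fin n → K.Dom k) :
    K.Forces φ.lift k (Fin.cons d a : Fin (n + 1) → K.Dom k) ↔ K.Forces φ k a :=
  hK.forces_rename φ _ _

theorem forces_inst (hK : K.IsPreModel) {n : ℕ} (φ : IFml L (n + 1)) (t : L.Term (Fin n))
    {k : K.Node} (a : Fin n → K.Dom k) :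
    K.Forces (φ.inst t) k a ↔
      K.Forces φ k (Fin.cons (t.realize a) a : Fin (n + 1) → K.Dom k) := by
  rw [IFml.inst, hK.forces_subst]
  have : (fun i => (Fin.cons t Term.var : Fin (n + 1) → L.Term (Fin n)) i |>.realize a) =
      (Fin.cons (t.realize a) a : Fin (n + 1) → K.Dom k) := by
    funext i
    refine Fin.cases ?_ (fun i => ?_) i <;> rfl
  rw [this]

/-- Soundness of intuitionistic logic for Kripke models. -/
theorem sound (hK : K.IsPreModel) {T : Set (ISent L)} (hT : ∀ θ ∈ T, K.Models θ) {n : ℕ}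
    {Γ : List (IFml L n)} {φ : IFml L n} (h : Deriv False T Γ φ) (k : K.Node)
    (a : Fin n → K.Dom k) (hΓ : ∀ χ ∈ Γ, K.Forces χ k a) : K.Forces φ k a := by
  have hcons : ∀ {n : ℕ} {Γ : List (IFml L n)} {ψ : IFml L n} {k : K.Node} {a : Fin n → K.Dom k},
      K.Forces ψ k a → (∀ χ ∈ Γ, K.Forces χ k a) → ∀ χ ∈ ψ :: Γ, K.Forces χ k a := by
    intro n Γ ψ k a h h' χ hχ
    rcases List.mem_cons.1 hχ with rfl | hχ
    exacts [h, h' _ hχ]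
  have hlift : ∀ {n : ℕ} {Γ : List (IFml L n)} {k : K.Node} {a : Fin n → K.Dom k} (d : K.Dom k),
      (∀ χ ∈ Γ, K.Forces χ k a) →
      ∀ χ ∈ Γ.map IFml.lift, K.Forces χ k (Fin.cons d a : Fin (n + 1) → K.Dom k) := by
    intro n Γ k a d h χ hχ
    obtain ⟨ψ, hψ, rfl⟩ := List.mem_map.1 hχ
    exact (hK.forces_lift ψ d a).2 (h ψ hψ)
  induction h generalizing k with
  | @ax n Γ φ h =>
    rw [hK.forces_rename]
    have := hT φ h k
    convert this
  | hyp h => exact hΓ _ h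
  | falsumE _ ih => exact (ih k a hΓ).elim
  | andI _ _ ih₁ ih₂ => exact ⟨ih₁ k a hΓ, ih₂ k a hΓ⟩
  | andE₁ _ ih => exact (ih k a hΓ).1
  | andE₂ _ ih => exact (ih k a hΓ).2
  | orI₁ _ ih => exact Or.inl (ih k a hΓ)
  | orI₂ _ ih => exact Or.inr (ih k a hΓ)
  | orE _ _ _ ih₁ ih₂ ih₃ =>
    rcases ih₁ k a hΓ with h | h
    exacts [ih₂ k a (hcons h hΓ), ih₃ k a (hcons h hΓ)]
  | impI _ ih =>
    exact fun k' h hφ => ih k' _ (hcons hφ fun χ hχ => hK.forces_mono χ h (hΓ χ hχ))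
  | impE _ _ ih₁ ih₂ =>
    have := ih₁ k a hΓ k (hK.refl k)
    rw [hK.map_comp_self] at this
    exact this (ih₂ k a hΓ)
  | allI _ ih =>
    exact fun k' h d => ih k' _ (hlift d fun χ hχ => hK.forces_mono χ h (hΓ χ hχ))
  | allE t _ ih =>
    have := ih k a hΓ k (hK.refl k) (t.realize a)
    rw [hK.map_comp_self] at this
    exact (hK.forces_inst _ t a).2 this
  | exI t _ ih => exact ⟨t.realize a, (hK.forces_inst _ t a).1 (ih k a hΓ)⟩
  | exE _ _ ih₁ ih₂ =>
    obtain ⟨d, hd⟩ := ih₁ k a hΓ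
    exact (hK.forces_lift _ d a).1 (ih₂ k _ (hcons hd (hlift d hΓ)))
  | eqRefl t => rfl
  | eqSubst φ _ _ ih₁ ih₂ =>
    have h₁ : _ = _ := ih₁ k a hΓ
    have h₂ := (hK.forces_inst _ _ a).1 (ih₂ k a hΓ)
    exact (hK.forces_inst _ _ a).2 (h₁ ▸ h₂)
  | dne hc _ _ => exact hc.elim

theorem models_of_provI (hK : K.IsPreModel) {T : Set (ISent L)} (hT : ∀ θ ∈ T, K.Models θ)
    {φ : ISent L} (h : ProvI T φ) : K.Models φ :=
  fun k => hK.sound hT h k _ (by simp)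

theorem models_closeAll (hK : K.IsPreModel) {n : ℕ} (φ : IFml L n) :
    K.Models φ.closeAll ↔ ∀ k (a : Fin n → K.Dom k), K.Forces φ k a := by
  induction n with
  | zero =>
    refine forall_congr' fun k => ⟨fun h a => ?_, fun h => h _⟩
    rwa [Subsingleton.elim a Fin.elim0]
  | succ n ih =>
    rw [IFml.closeAll, ih]
    refine ⟨fun h k a => ?_, fun h k a k' hk d => h k' _⟩
    have := h k (Fin.tail a) k (hK.refl k) (a 0)
    rwa [hK.map_comp_self, Fin.cons_self_tail] at this

theorem forces_imp (hK : K.IsPreModel) {n : ℕ} {φ ψ : IFml L n} {k : K.Node}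
    {a : Fin n → K.Dom k} (h : K.Forces (φ.imp ψ) k a) (h' : K.Forces φ k a) :
    K.Forces ψ k a := by
  have := h k (hK.refl k)
  rw [hK.map_comp_self] at this
  exact this h'

theorem forces_all (hK : K.IsPreModel) {n : ℕ} {φ : IFml L (n + 1)} {k : K.Node}
    {a : Fin n → K.Dom k} (h : K.Forces φ.all k a) (d : K.Dom k) :
    K.Forces φ k (Fin.cons d a : Fin (n + 1) → K.Dom k) := by
  have := h k (hK.refl k) d
  rwa [hK.map_comp_self] at this

end IsPreModel

end KripkeData

/-! ### The number of formulas -/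

section Cardinality

open Cardinal

variable {L : FirstOrder.Language.{u, v}}

/-- Labels of the nodes of syntax trees, with the number of subtrees as first component. -/
abbrev SyntaxLabel (L : FirstOrder.Language.{u, v}) := ℕ × ((ℕ × ℕ) ⊕ L.Symbols)

abbrev SyntaxTree (L : FirstOrder.Language.{u, v}) := WType fun a : SyntaxLabel L => Fin a.1

def termTree {n : ℕ} : L.Term (Fin n) → SyntaxTree L
  | .var i => ⟨(0, Sum.inl (0, i)), Fin.elim0⟩
  | .func (l := l) f ts => ⟨(l, Sum.inr (Sum.inl ⟨l, f⟩)), fun i => termTree (ts i)⟩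

theorem termTree_injective {n : ℕ} : Function.Injective (termTree : L.Term (Fin n) → _) := by
  intro t
  induction t with
  | var i =>
    rintro (j | ⟨f, ts⟩) h
    · simp [termTree] at h
      rw [Fin.ext h]
    · simp [termTree] at h
  | @func l f ts ih =>
    rintro (j | @⟨l', g, ss⟩) h
    · simp [termTree] at h
    · simp only [termTree, WType.mk.injEq, Prod.mk.injEq, Sum.inr.injEq, Sum.inl.injEq,
        Sigma.mk.injEq] at h
      obtain ⟨⟨rfl, -, hf⟩, hs⟩ := h
      obtain rfl := eq_of_heq hf
      congr 1
      funext i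
      exact ih i (congrFun (eq_of_heq hs) i)

def IFml.tree : {n : ℕ} → IFml L n → SyntaxTree L
  | _, falsum => ⟨(0, Sum.inl (1, 0)), Fin.elim0⟩
  | _, equal t s => ⟨(2, Sum.inl (2, 0)), ![termTree t, termTree s]⟩
  | _, rel (k := k) R ts => ⟨(k, Sum.inr (Sum.inr ⟨k, R⟩)), fun i => termTree (ts i)⟩
  | _, and φ ψ => ⟨(2, Sum.inl (3, 0)), ![φ.tree, ψ.tree]⟩
  | _, or φ ψ => ⟨(2, Sum.inl (4, 0)), ![φ.tree, ψ.tree]⟩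
  | _, imp φ ψ => ⟨(2, Sum.inl (5, 0)), ![φ.tree, ψ.tree]⟩
  | _, all φ => ⟨(1, Sum.inl (6, 0)), ![φ.tree]⟩
  | _, ex φ => ⟨(1, Sum.inl (7, 0)), ![φ.tree]⟩

theorem IFml.tree_injective {n : ℕ} : Function.Injective (IFml.tree : IFml L n → _) := by
  intro φ
  induction φ with
  | falsum =>
    intro ψ h
    cases ψ <;> simp [IFml.tree] at h ⊢
  | equal t s =>
    intro ψ h
    cases ψ <;> simp [IFml.tree] at h ⊢
    exact ⟨termTree_injective h.1, termTree_injective h.2⟩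
  | @rel n k R ts =>
    intro ψ h
    cases ψ with
    | rel R' ts' =>
      simp only [IFml.tree, WType.mk.injEq, Prod.mk.injEq, Sum.inr.injEq, Sigma.mk.injEq] at h
      obtain ⟨⟨rfl, -, hf⟩, hs⟩ := h
      obtain rfl := eq_of_heq hf
      congr 1
      funext i
      exact termTree_injective (congrFun (eq_of_heq hs) i)
    | _ => simp [IFml.tree] at h
  | and φ ψ h₁ h₂ =>
    intro ψ h
    cases ψ <;> simp [IFml.tree] at h ⊢
    exact ⟨h₁ h.1, h₂ h.2⟩
  | or φ ψ h₁ h₂ =>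
    intro ψ h
    cases ψ <;> simp [IFml.tree] at h ⊢
    exact ⟨h₁ h.1, h₂ h.2⟩
  | imp φ ψ h₁ h₂ =>
    intro ψ h
    cases ψ <;> simp [IFml.tree] at h ⊢
    exact ⟨h₁ h.1, h₂ h.2⟩
  | all φ h₁ =>
    intro ψ h
    cases ψ <;> simp [IFml.tree] at h ⊢
    exact h₁ h
  | ex φ h₁ =>
    intro ψ h
    cases ψ <;> simp [IFml.tree] at h ⊢
    exact h₁ h

/-- A formula is determined by its labelled syntax tree, and there are no more finitely branching
trees than labels, up to ℵ₀. -/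
theorem IFml.card_le (n : ℕ) : #(IFml L n) ≤ max ℵ₀ L.card := by
  refine (mk_le_of_injective IFml.tree_injective).trans
    (WType.cardinalMk_le_max_aleph0_of_finite'.trans ?_)
  have h : ℵ₀ ≤ max ℵ₀ L.card := le_max_left _ _
  refine max_le ?_ h
  simp only [mk_prod, mk_sum, lift_id, lift_uzero, mk_nat, lift_aleph0, aleph0_mul_aleph0]
  refine mul_le_of_le h h (add_le_of_le h h (le_trans (le_of_eq ?_) (le_max_right _ _)))
  rw [Language.card, Symbols, mk_sum]

/-- There is a type `A` that is large enough to serve as a supply of names for the formulas of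
the language extended by constants from `ℕ × ℕ × A`. -/
theorem exists_henkin_names (L : FirstOrder.Language.{u, v}) :
    ∃ A : Type (max u v w), Nonempty (IFml L[[ℕ × ℕ × A]] 1 ↪ A) := by
  -- This set is infinite and at least as large as the set of symbols, so adding `ℕ × ℕ × A` as
  -- constants does not raise the number of formulas above its cardinality.
  refine ⟨ULift.{w} (L.Symbols ⊕ ℕ), ?_⟩
  rw [← Cardinal.le_def]
  refine (IFml.card_le 1).trans ?_
  have h : ℵ₀ ≤ #(ULift.{w} (L.Symbols ⊕ ℕ)) := aleph0_le_mk _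
  refine max_le h ?_
  rw [card_withConstants]
  refine add_le_of_le h ?_ ?_
  · have : lift.{max u v w} L.card = #(ULift.{max u v w} L.Symbols) := (mk_uLift _).symm
    rw [this]
    refine mk_le_of_injective (f := fun s => ULift.up (Sum.inl s.down)) fun s t h => ?_
    simpa using h
  · have : #(ℕ × ℕ × ULift.{w} (L.Symbols ⊕ ℕ)) = #(ULift.{w} (L.Symbols ⊕ ℕ)) := by
      rw [mk_prod, mk_prod, mk_nat, lift_aleph0, lift_uzero, lift_uzero,
        aleph0_mul_eq h, aleph0_mul_eq h]
    rw [this]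
    exact (lift_id'.{max u v, max u v w} _).le

end Cardinality

/-! ### Completeness -/

section Equality

variable {L : FirstOrder.Language.{u, v}} {cl : Prop} {T : Set (ISent L)} {m : ℕ}
  {Γ : List (IFml L m)}

/-- The equality rule exchanges one term at a time, so the positions are switched from `σ` to `τ`
one after another, by induction on the finite set of positions already switched. -/
theorem Deriv.subst_congr {n : ℕ} (φ : IFml L n) {σ τ : Fin n → L.Term (Fin m)}
    (h : ∀ i, Deriv cl T Γ (IFml.equal (σ i) (τ i))) (hφ : Deriv cl T Γ (φ.subst σ)) :
    Deriv cl T Γ (φ.subst τ) := by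
  classical
  have step : ∀ F : Finset (Fin n), Deriv cl T Γ (φ.subst fun i => if i ∈ F then τ i else σ i) := by
    intro F
    induction F using Finset.induction_on with
    | empty => simpa using hφ
    | insert j F hj ih =>
      -- The position `j` is left open as the variable `0`; instantiating it with `σ j` or `τ j`
      -- gives the formula before or after the switch.
      let θ : IFml L (m + 1) := φ.subst fun i => if i = j then Term.var 0 else
        (if i ∈ F then τ i else σ i).relabel Fin.succ
      have key : ∀ t : L.Term (Fin m), θ.inst t =
          φ.subst fun i => if i = j then t else if i ∈ F then τ i else σ i := by
        intro t
        simp only [θ, IFml.inst, IFml.subst_subst]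
        congr 1
        funext i
        split_ifs with h₁ h₂
        · rfl
        · rw [Term.relabel_subst]
          exact Term.subst_var _
        · rw [Term.relabel_subst]
          exact Term.subst_var _
      have h₁ : Deriv cl T Γ (θ.inst (σ j)) := by
        rw [key]
        convert ih using 3 with i
        by_cases hij : i = j
        · subst hij
          simp [hj]
        · simp [hij]
      have h₂ := Deriv.eqSubst θ (h j) h₁
      rw [key] at h₂
      convert h₂ using 3 with i
      by_cases hij : i = j
      · subst hij
        simp
      · simp [hij]
  simpa using step Finset.univ

theorem Deriv.eqSymm {t s : L.Term (Fin m)} (h : Deriv cl T Γ (IFml.equal t s)) :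
    Deriv cl T Γ (IFml.equal s t) := by
  have key : ∀ r : L.Term (Fin m),
      (IFml.equal (Term.var 0) (t.relabel Fin.succ)).inst r = IFml.equal r t := by
    intro r
    simp only [IFml.inst, IFml.subst, Term.relabel_subst]
    congr 1
    exact Term.subst_var _
  have := Deriv.eqSubst (IFml.equal (Term.var 0) (t.relabel Fin.succ)) h
    (by rw [key]; exact .eqRefl t)
  rwa [key] at this

theorem Deriv.eqTrans {t s r : L.Term (Fin m)} (h : Deriv cl T Γ (IFml.equal t s))
    (h' : Deriv cl T Γ (IFml.equal s r)) : Deriv cl T Γ (IFml.equal t r) := by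
  have key : ∀ q : L.Term (Fin m),
      (IFml.equal (t.relabel Fin.succ) (Term.var 0)).inst q = IFml.equal t q := by
    intro q
    simp only [IFml.inst, IFml.subst, Term.relabel_subst]
    congr 1
    exact Term.subst_var _
  have := Deriv.eqSubst (IFml.equal (t.relabel Fin.succ) (Term.var 0)) h' (by rwa [key])
  rwa [key] at this

theorem ProvI.func_congr {n : ℕ} (f : L.Functions n) {ts ss : Fin n → L.Term (Fin 0)}
    (h : ∀ i, ProvI T (IFml.equal (ts i) (ss i))) :
    ProvI T (IFml.equal (Term.func f ts) (Term.func f ss)) := by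
  have key : ∀ rs : Fin n → L.Term (Fin 0),
      (IFml.equal ((Term.func f ts).relabel Fin.elim0) (Term.func f Term.var)).subst rs =
        IFml.equal (Term.func f ts) (Term.func f rs) := by
    intro rs
    simp only [IFml.subst, Term.relabel_subst]
    congr 1
    convert Term.subst_var _
  have := Deriv.subst_congr (IFml.equal ((Term.func f ts).relabel Fin.elim0)
    (Term.func f Term.var)) h (by rw [key]; exact .eqRefl _)
  rwa [key] at this

theorem ProvI.rel_congr {n : ℕ} (R : L.Relations n) {ts ss : Fin n → L.Term (Fin 0)}
    (h : ∀ i, ProvI T (IFml.equal (ts i) (ss i))) (hR : ProvI T (IFml.rel R ts)) :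
    ProvI T (IFml.rel R ss) :=
  Deriv.subst_congr (IFml.rel R Term.var) h hR

end Equality

/-! ### Fresh constants and saturated theories. -/

namespace Henkin

variable {L : FirstOrder.Language.{u, v}}

section Fresh

universe x

variable {X : Type x}

/-- All constants occurring in `T` are in `S`. -/
def Supp (S : Set X) (T : Set (ISent L[[X]])) : Prop := ∀ χ ∈ T, χ.consts ⊆ S

/-- Generalization on constants: as `c` occurs neither in the axioms nor in `ψ`, replacing it by a
variable throughout the derivation leaves both intact. -/
theorem provI_all_of_fresh {T : Set (ISent L[[X]])} {S : Set X} (hT : Supp S T)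
    {ψ : IFml L[[X]] 1} (hψ : ψ.consts ⊆ S) {c : X} (hc : c ∉ S)
    (h : ProvI T (ψ.inst (conTerm L c))) : ProvI T ψ.all := by
  classical
  refine Deriv.allI ?_
  let ρ : X → L[[X]].Term (Fin 1) := fun x => if x = c then Term.var 0 else conTerm L x
  have hρ : ∀ x ∈ S, ρ x = conTerm L x := fun x hx => if_neg (by rintro rfl; exact hc hx)
  have := Deriv.tr (T' := T) (L.lhomWithConstants X) S (conTerm L)
    (fun χ hχ m ρ hρ => ⟨χ, hχ, by
      rw [χ.tr_congr (ρ' := conTerm L), IFml.tr_conTerm, IFml.rename]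
      · congr 1
        funext i
        exact i.elim0
      · intro x hx
        rw [hρ x (hT χ hχ hx), conTerm_relabel]⟩) h ρ
    (fun x hx => by rw [hρ x hx, conTerm_relabel]) Fin.elim0
  rw [IFml.inst, IFml.tr_subst, ψ.tr_congr (ρ' := conTerm L), IFml.tr_conTerm] at this
  · have hv : (fun i => trTerm (L.lhomWithConstants X) ρ Fin.elim0
        ((Fin.cons (conTerm L c) Term.var : Fin 1 → L[[X]].Term (Fin 0)) i)) = Term.var := by
      funext i
      refine Fin.cases ?_ (fun i => i.elim0) i
      simp [ρ]
    rw [hv, IFml.subst_var] at this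
    exact this
  · exact fun x hx => hρ x (hψ hx)

/-- The deduction theorem and generalization on `c` turn the derivation into one of ∀x (ψ → φ), and
the elimination rule for ∃ concludes. Thus adding a Henkin witness is conservative. -/
theorem provI_of_fresh_witness {T : Set (ISent L[[X]])} {S : Set X} (hT : Supp S T)
    {ψ : IFml L[[X]] 1} (hψ : ψ.consts ⊆ S) {φ : ISent L[[X]]} (hφ : φ.consts ⊆ S) {c : X}
    (hc : c ∉ S) (hex : ProvI T ψ.ex) (h : ProvI (insert (ψ.inst (conTerm L c)) T) φ) :
    ProvI T φ := by
  have h₁ : ProvI T ((ψ.imp φ.lift).inst (conTerm L c)) := by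
    have := h.imp_of_insert
    rw [IFml.inst, IFml.subst]
    have e : φ.lift.subst (Fin.cons (conTerm L c) Term.var) = φ := φ.lift_inst _
    rwa [e]
  have h₂ := provI_all_of_fresh hT (ψ := ψ.imp φ.lift)
    (Set.union_subset hψ (IFml.consts_subst _ _ hφ fun i => Set.empty_subset _)) hc h₁
  refine Deriv.exE hex ?_
  have h₃ : Deriv False T (ψ :: ([] : List (ISent L[[X]])).map IFml.lift)
      (((ψ.imp φ.lift).subst (IFml.liftSubst fun i : Fin 0 => Term.var i.succ)).inst
        (Term.var 0)) := by
    refine Deriv.allE (φ := (ψ.imp φ.lift).subst _) (Term.var 0) ?_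
    -- All constants are kept; the translation only moves the derivation from the empty context to a
    -- context with one variable.
    have := Deriv.tr (T' := T) (L.lhomWithConstants X) Set.univ (conTerm L)
      (fun χ hχ m ρ hρ => ⟨χ, hχ, by
        rw [χ.tr_congr (ρ' := conTerm L), IFml.tr_conTerm, IFml.rename]
        · congr 1
          funext i
          exact i.elim0
        · intro x hx
          rw [hρ x trivial, conTerm_relabel]⟩) h₂ (conTerm L)
      (fun x hx => by rw [conTerm_relabel]) (fun i : Fin 0 => Term.var (i.succ : Fin 1))
    rw [IFml.tr_conTerm] at this
    exact this.weaken (by simp)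
  rw [IFml.liftSubst_inst] at h₃
  have e : (Fin.cons (Term.var 0) (fun i : Fin 0 => Term.var i.succ) :
      Fin 1 → L[[X]].Term (Fin 1)) = Term.var := by
    funext i
    refine Fin.cases rfl (fun i => i.elim0) i
  rw [e, IFml.subst_var] at h₃
  exact .impE h₃ (.hyp List.mem_cons_self)

/-- Zorn's lemma, with maximality only among theories over the constants in `S`: those outside `S`
must stay fresh for later witnesses. -/
theorem exists_maximal {T : Set (ISent L[[X]])} {S : Set X} (hT : Supp S T) {φ : ISent L[[X]]}
    (h : ¬ ProvI T φ) :
    ∃ Δ, T ⊆ Δ ∧ Supp S Δ ∧ ¬ ProvI Δ φ ∧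
      ∀ χ : ISent L[[X]], χ.consts ⊆ S → χ ∉ Δ → ProvI (insert χ Δ) φ := by
  obtain ⟨Δ, hTΔ, hΔ⟩ := zorn_subset_nonempty {Δ | Supp S Δ ∧ ¬ ProvI Δ φ}
    (fun c hc hch hne => ⟨⋃₀ c, ⟨fun χ ⟨Δ, hΔ, hχ⟩ => (hc hΔ).1 χ hχ, fun hp => by
      obtain ⟨Δ, hΔ, hp⟩ := ProvI.exists_mem_of_directed hch.directedOn hne hp
      exact (hc hΔ).2 hp⟩, fun s hs => Set.subset_sUnion_of_mem hs⟩) T ⟨hT, h⟩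
  refine ⟨Δ, hTΔ, hΔ.prop.1, hΔ.prop.2, fun χ hχ hn => ?_⟩
  by_contra hc
  have := hΔ.le_of_ge (y := insert χ Δ) ⟨fun θ hθ => ?_, hc⟩ (Set.subset_insert _ _)
  · exact hn (this (Set.mem_insert _ _))
  · rcases hθ with rfl | hθ
    exacts [hχ, hΔ.prop.1 θ hθ]

/-- A consistent prime theory over the constants in `S`, closed under provability and with
witnesses for its existential sentences. -/
structure Saturated (S : Set X) (Δ : Set (ISent L[[X]])) : Prop where
  supp : Supp S Δ
  closed : ∀ {χ : ISent L[[X]]}, χ.consts ⊆ S → ProvI Δ χ → χ ∈ Δ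
  consistent : IFml.falsum ∉ Δ
  prime : ∀ {χ ψ : ISent L[[X]]}, χ.or ψ ∈ Δ → χ ∈ Δ ∨ ψ ∈ Δ
  witness : ∀ {ψ : IFml L[[X]] 1}, ψ.ex ∈ Δ → ∃ c ∈ S, ψ.inst (conTerm L c) ∈ Δ

end Fresh

universe x

variable {A : Type x}

/-- The constants of level below `i`, and those of level `i` and stage below `j`. -/
def stageSet (A : Type x) (i j : ℕ) : Set (ℕ × ℕ × A) :=
  {x | x.1 < i ∨ x.1 = i ∧ x.2.1 < j}

theorem stageSet_mono {i j j' : ℕ} (h : j ≤ j') : stageSet A i j ⊆ stageSet A i j' := by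
  rintro x (hx | hx)
  · exact Or.inl hx
  · exact Or.inr ⟨hx.1, hx.2.trans_le h⟩

theorem stageSet_subset_level {i i' j : ℕ} (h : i < i') : stageSet A i j ⊆ stageSet A i' 0 := by
  rintro x (hx | hx)
  · exact Or.inl (hx.trans h)
  · exact Or.inl (hx.1.trans_lt h)

theorem level_mono {i i' : ℕ} (h : i ≤ i') : stageSet A i 0 ⊆ stageSet A i' 0 := by
  rintro x (hx | hx)
  · exact Or.inl (hx.trans_le h)
  · exact absurd hx.2 (Nat.not_lt_zero _)

theorem exists_stage {i : ℕ} {s : Set (ℕ × ℕ × A)} (hs : s.Finite)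
    (h : s ⊆ stageSet A (i + 1) 0) : ∃ j, s ⊆ stageSet A i j := by
  obtain ⟨N, hN⟩ := (hs.image fun x => x.2.1).bddAbove
  refine ⟨N + 1, fun x hx => ?_⟩
  rcases h hx with h | h
  · rcases Nat.lt_succ_iff_lt_or_eq.1 h with h | h
    · exact Or.inl h
    · exact Or.inr ⟨h, Nat.lt_succ_of_le (hN ⟨x, hx, rfl⟩)⟩
  · exact absurd h.2 (Nat.not_lt_zero _)

/-- Only finitely many of the witness axioms are used in a derivation of `φ`. They are removed one
by one, each being conservative over the remaining ones. -/
theorem provI_of_witnesses (e : IFml L[[ℕ × ℕ × A]] 1 ↪ A) {i j : ℕ} {Γ : Set (ISent L[[ℕ × ℕ × A]])}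
    (hΓ : Supp (stageSet A i j) Γ) {φ : ISent L[[ℕ × ℕ × A]]} (hφ : φ.consts ⊆ stageSet A i j)
    (h : ProvI (Γ ∪ {χ | ∃ ψ : IFml L[[ℕ × ℕ × A]] 1, ψ.consts ⊆ stageSet A i j ∧
      ProvI Γ ψ.ex ∧ χ = ψ.inst (conTerm L (i, j, e ψ))}) φ) : ProvI Γ φ := by
  classical
  obtain ⟨Δ, hΔ, d⟩ := ProvI.exists_list h
  have : Nonempty (IFml L[[ℕ × ℕ × A]] 1) := ⟨.falsum⟩
  choose! g hg₁ hg₂ hg₃ using hΔ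
  let B : Finset (IFml L[[ℕ × ℕ × A]] 1) → Set (ISent L[[ℕ × ℕ × A]]) := fun F =>
    Γ ∪ {χ | ∃ ψ ∈ F, χ = ψ.inst (conTerm L (i, j, e ψ))}
  have main : ∀ F : Finset (IFml L[[ℕ × ℕ × A]] 1),
      (∀ ψ ∈ F, ψ.consts ⊆ stageSet A i j ∧ ProvI Γ ψ.ex) → ProvI (B F) φ → ProvI Γ φ := by
    intro F
    induction F using Finset.induction_on with
    | empty =>
      intro _ h
      simpa [B] using h
    | insert ψ F hψ ih =>
      intro hF h
      refine ih (fun θ hθ => hF θ (Finset.mem_insert_of_mem hθ)) ?_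
      have hS : Supp (stageSet A i j ∪ {x | ∃ θ ∈ F, x = (i, j, e θ)}) (B F) := by
        rintro χ (hχ | ⟨θ, hθ, rfl⟩)
        · exact (hΓ χ hχ).trans Set.subset_union_left
        · refine IFml.consts_subst _ _
            ((hF θ (Finset.mem_insert_of_mem hθ)).1.trans Set.subset_union_left) fun k => ?_
          refine Fin.cases ?_ (fun k => k.elim0) k
          rintro x (rfl : x = _)
          exact Or.inr ⟨θ, hθ, rfl⟩
      refine provI_of_fresh_witness hS (c := (i, j, e ψ))
        ((hF ψ (Finset.mem_insert_self _ _)).1.trans Set.subset_union_left)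
        (hφ.trans Set.subset_union_left) ?_
        ((hF ψ (Finset.mem_insert_self _ _)).2.mono Set.subset_union_left) (h.mono ?_)
      -- Freshness of `(i, j, e ψ)`: the set of old constants stops before stage `j` of level `i`,
      -- and `e` is injective, so the other witnesses are different.
      · rintro ((hx | hx) | ⟨θ, hθ, hx⟩)
        · exact lt_irrefl _ hx
        · exact lt_irrefl _ hx.2
        · simp only [Prod.mk.injEq, true_and, EmbeddingLike.apply_eq_iff_eq] at hx
          exact hψ (hx ▸ hθ)
      · rintro χ (hχ | ⟨θ, hθ, rfl⟩)
        · exact Or.inr (Or.inl hχ)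
        · rcases Finset.mem_insert.1 hθ with rfl | hθ
          · exact Or.inl rfl
          · exact Or.inr (Or.inr ⟨θ, hθ, rfl⟩)
  refine main (Δ.map g).toFinset ?_ ?_
  · intro ψ hψ
    obtain ⟨χ, hχ, rfl⟩ := List.mem_map.1 (List.mem_toFinset.1 hψ)
    exact ⟨hg₁ χ hχ, hg₂ χ hχ⟩
  · refine ProvI.of_deriv (d.mono id Set.subset_union_left) fun χ hχ => ProvI.of_mem (Or.inr ?_)
    exact ⟨g χ, List.mem_toFinset.2 (List.mem_map_of_mem hχ), hg₃ χ hχ⟩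

/-- The constants of level `i` are consumed in stages. Stage `j` adds a witness for every
existential sentence provable so far and then extends to a theory that is maximal, over the
constants available, among those not proving `φ`. In the union over all stages, witnesses exist by
construction, while closure and primality follow from the maximality of the stages. -/
theorem exists_saturated (e : IFml L[[ℕ × ℕ × A]] 1 ↪ A) {i : ℕ} {Γ : Set (ISent L[[ℕ × ℕ × A]])}
    (hΓ : Supp (stageSet A i 0) Γ) {φ : ISent L[[ℕ × ℕ × A]]} (hφ : φ.consts ⊆ stageSet A i 0)
    (h : ¬ ProvI Γ φ) :
    ∃ Δ, Γ ⊆ Δ ∧ Saturated (stageSet A (i + 1) 0) Δ ∧ ¬ ProvI Δ φ := by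
  have step : ∀ j (Δ : Set (ISent L[[ℕ × ℕ × A]])), Supp (stageSet A i j) Δ ∧ ¬ ProvI Δ φ →
      ∃ Δ', (Supp (stageSet A i (j + 1)) Δ' ∧ ¬ ProvI Δ' φ) ∧ Δ ⊆ Δ' ∧
        (∀ ψ : IFml L[[ℕ × ℕ × A]] 1, ψ.consts ⊆ stageSet A i j → ProvI Δ ψ.ex →
          ψ.inst (conTerm L (i, j, e ψ)) ∈ Δ') ∧
        ∀ χ : ISent L[[ℕ × ℕ × A]], χ.consts ⊆ stageSet A i (j + 1) → χ ∉ Δ' →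
          ProvI (insert χ Δ') φ := by
    rintro j Δ ⟨hΔ, hn⟩
    have hn' := mt (provI_of_witnesses e hΔ (hφ.trans (stageSet_mono (Nat.zero_le j)))) hn
    obtain ⟨Δ', h₁, h₂, h₃, h₄⟩ := exists_maximal (S := stageSet A i (j + 1)) (by
      rintro χ (hχ | ⟨ψ, hψ, -, rfl⟩)
      · exact (hΔ χ hχ).trans (stageSet_mono (Nat.le_succ j))
      · refine IFml.consts_subst _ _ (hψ.trans (stageSet_mono (Nat.le_succ j))) fun k => ?_
        refine Fin.cases ?_ (fun k => k.elim0) k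
        rintro x (rfl : x = _)
        exact Or.inr ⟨rfl, Nat.lt_succ_self j⟩) hn'
    exact ⟨Δ', ⟨h₂, h₃⟩, Set.subset_union_left.trans h₁,
      fun ψ hψ hp => h₁ (Or.inr ⟨ψ, hψ, hp, rfl⟩), h₄⟩
  choose! next hnext₁ hnext₂ hnext₃ hnext₄ using step
  let D : ℕ → Set (ISent L[[ℕ × ℕ × A]]) := fun j => Nat.rec Γ (fun j Δ => next j Δ) j
  have hD : ∀ j, Supp (stageSet A i j) (D j) ∧ ¬ ProvI (D j) φ := by
    intro j
    induction j with
    | zero => exact ⟨hΓ, h⟩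
    | succ j ih => exact hnext₁ j _ ih
  have hmono : Monotone D := monotone_nat_of_le_succ fun j => hnext₂ j _ (hD j)
  have hdir : ∀ {χ : ISent L[[ℕ × ℕ × A]]}, ProvI (⋃₀ Set.range D) χ → ∃ j, ProvI (D j) χ := by
    intro χ hχ
    obtain ⟨_, ⟨j, rfl⟩, h⟩ := ProvI.exists_mem_of_directed
      (directedOn_range.2 hmono.directed_le) (Set.range_nonempty D) hχ
    exact ⟨j, h⟩
  have hclosed : ∀ {χ : ISent L[[ℕ × ℕ × A]]}, χ.consts ⊆ stageSet A (i + 1) 0 →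
      ProvI (⋃₀ Set.range D) χ → ∃ j, χ.consts ⊆ stageSet A i j ∧ χ ∈ D j := by
    intro χ hχ hp
    obtain ⟨j₁, h₁⟩ := exists_stage χ.consts_finite hχ
    obtain ⟨j₂, h₂⟩ := hdir hp
    have hc : χ.consts ⊆ stageSet A i (max j₁ j₂ + 1) :=
      h₁.trans (stageSet_mono ((le_max_left _ _).trans (Nat.le_succ _)))
    refine ⟨max j₁ j₂ + 1, hc, ?_⟩
    -- Were `χ` missing from a maximal stage, adding it would prove `φ`; but that stage proves `χ`
    -- already, so it would prove `φ` by itself.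
    by_contra hn
    refine (hD (max j₁ j₂ + 1)).2 ((hnext₄ _ _ (hD (max j₁ j₂)) χ hc hn).cut ?_)
    rintro θ (rfl | hθ)
    · exact h₂.mono (hmono ((le_max_right _ _).trans (Nat.le_succ _)))
    · exact ProvI.of_mem hθ
  have hnot : ¬ ProvI (⋃₀ Set.range D) φ := fun hp => by
    obtain ⟨j, h⟩ := hdir hp
    exact (hD j).2 h
  have hsupp : Supp (stageSet A (i + 1) 0) (⋃₀ Set.range D) := by
    rintro χ ⟨_, ⟨j, rfl⟩, hχ⟩
    exact ((hD j).1 χ hχ).trans (stageSet_subset_level (Nat.lt_succ_self i))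
  refine ⟨⋃₀ Set.range D, Set.subset_sUnion_of_mem ⟨0, rfl⟩, ⟨hsupp, ?_, ?_, ?_, ?_⟩, hnot⟩
  · intro χ hχ hp
    obtain ⟨j, -, hj⟩ := hclosed hχ hp
    exact ⟨_, ⟨j, rfl⟩, hj⟩
  · exact fun hf => hnot (Deriv.falsumE (ProvI.of_mem hf))
  · intro χ ψ hχψ
    have hs := Set.union_subset_iff.1 (hsupp _ hχψ)
    by_contra hcon
    rw [not_or] at hcon
    obtain ⟨j, hj, hm⟩ := hclosed (hsupp _ hχψ) (ProvI.of_mem hχψ)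
    have hj' := Set.union_subset_iff.1 (hj.trans (stageSet_mono (Nat.le_succ j)))
    have hm' : χ.or ψ ∈ D (j + 1) := hmono (Nat.le_succ j) hm
    have h₁ := hnext₄ j _ (hD j) χ hj'.1 fun hh => hcon.1 ⟨_, ⟨j + 1, rfl⟩, hh⟩
    have h₂ := hnext₄ j _ (hD j) ψ hj'.2 fun hh => hcon.2 ⟨_, ⟨j + 1, rfl⟩, hh⟩
    -- If neither disjunct belonged to the union, each of them would prove `φ` over the maximal
    -- stage, and so would the disjunction.
    refine (hD (j + 1)).2 (Deriv.orE (ProvI.of_mem hm')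
      (Deriv.impE (h₁.imp_of_insert.weaken (by simp)) (.hyp List.mem_cons_self))
      (Deriv.impE (h₂.imp_of_insert.weaken (by simp)) (.hyp List.mem_cons_self)))
  · intro ψ hψ
    obtain ⟨j, hj, hm⟩ := hclosed (hsupp _ hψ) (ProvI.of_mem hψ)
    exact ⟨(i, j, e ψ), Or.inl (Nat.lt_succ_self i), _, ⟨j + 1, rfl⟩,
      hnext₃ j _ (hD j) ψ hj (ProvI.of_mem hm)⟩

end Henkin

/-! ### The canonical model and its truth lemma. -/

namespace Henkin

universe x

variable {L : FirstOrder.Language.{u, 0}}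

theorem Saturated.provI_iff {X : Type x} {S : Set X} {Δ : Set (ISent L[[X]])}
    (h : Saturated S Δ) {χ : ISent L[[X]]} (hχ : χ.consts ⊆ S) : ProvI Δ χ ↔ χ ∈ Δ :=
  ⟨h.closed hχ, ProvI.of_mem⟩

/-- The closed terms with constants in `S`. -/
abbrev ClosedTerm (L : FirstOrder.Language.{u, 0}) {X : Type x} (S : Set X) :=
  {t : L[[X]].Term (Fin 0) // termConsts t ⊆ S}

theorem Saturated.equal_mem_iff {X : Type x} {S : Set X} {Δ : Set (ISent L[[X]])}
    (h : Saturated S Δ) (t s : ClosedTerm L S) :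
    IFml.equal t.1 s.1 ∈ Δ ↔ ProvI Δ (IFml.equal t.1 s.1) :=
  (h.provI_iff (χ := IFml.equal t.1 s.1) (Set.union_subset t.2 s.2)).symm

/-- Provable equality. -/
def Saturated.setoid {X : Type x} {S : Set X} {Δ : Set (ISent L[[X]])} (h : Saturated S Δ) :
    Setoid (ClosedTerm L S) where
  r t s := IFml.equal t.1 s.1 ∈ Δ
  iseqv := by
    refine ⟨fun t => ?_, fun {t s} h₁ => ?_, fun {t s r} h₁ h₂ => ?_⟩
    · exact (h.equal_mem_iff t t).2 (.eqRefl _)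
    · exact (h.equal_mem_iff s t).2 (((h.equal_mem_iff t s).1 h₁).eqSymm)
    · exact (h.equal_mem_iff t r).2
        (((h.equal_mem_iff t s).1 h₁).eqTrans ((h.equal_mem_iff s r).1 h₂))

variable (T : Set (ISent L)) (A : Type x)

/-- The nodes of the canonical model: a level `i` with a saturated theory extending `T` over the
constants of level below `i`. -/
def CanonicalNode : Type (max u x) :=
  {p : ℕ × Set (ISent L[[ℕ × ℕ × A]]) // Saturated (stageSet A p.1 0) p.2 ∧
    IFml.onLang (L.lhomWithConstants _) '' T ⊆ p.2}

variable {T A}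

theorem CanonicalNode.sat (p : CanonicalNode T A) : Saturated (stageSet A p.1.1 0) p.1.2 := p.2.1

def CanonicalNode.Dom (p : CanonicalNode T A) : Type (max u x) := Quotient p.sat.setoid

def CanonicalNode.mk (p : CanonicalNode T A) (t : ClosedTerm L (stageSet A p.1.1 0)) : p.Dom :=
  Quotient.mk p.sat.setoid t

def closedFunc {X : Type*} {S : Set X} {n : ℕ} (f : L.Functions n) (ts : Fin n → ClosedTerm L S) :
    ClosedTerm L S :=
  ⟨.func (Sum.inl f) fun i => (ts i).1, Set.iUnion_subset fun i => (ts i).2⟩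

noncomputable def CanonicalNode.out (p : CanonicalNode T A) (d : p.Dom) :
    ClosedTerm L (stageSet A p.1.1 0) := Quotient.out (s := p.sat.setoid) d

theorem CanonicalNode.mk_out (p : CanonicalNode T A) (d : p.Dom) : p.mk (p.out d) = d :=
  Quotient.out_eq (s := p.sat.setoid) d

theorem CanonicalNode.mk_eq_iff (p : CanonicalNode T A) (t s : ClosedTerm L (stageSet A p.1.1 0)) :
    p.mk t = p.mk s ↔ IFml.equal t.1 s.1 ∈ p.1.2 :=
  ⟨fun h => Quotient.exact (s := p.sat.setoid) h, fun h => Quotient.sound (s := p.sat.setoid) h⟩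

noncomputable instance CanonicalNode.str (p : CanonicalNode T A) : L.Structure p.Dom where
  funMap f a := p.mk (closedFunc f fun i => p.out (a i))
  RelMap R a := IFml.rel (L := L[[ℕ × ℕ × A]]) (Sum.inl R) (fun i => (p.out (a i)).1) ∈ p.1.2

theorem CanonicalNode.out_mk (p : CanonicalNode T A) (t : ClosedTerm L (stageSet A p.1.1 0)) :
    ProvI p.1.2 (IFml.equal (p.out (p.mk t)).1 t.1) :=
  ProvI.of_mem ((p.mk_eq_iff _ _).1 (p.mk_out (p.mk t)))

theorem CanonicalNode.funMap_mk (p : CanonicalNode T A) {n : ℕ} (f : L.Functions n)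
    (ts : Fin n → ClosedTerm L (stageSet A p.1.1 0)) :
    Structure.funMap f (fun i => p.mk (ts i)) = p.mk (closedFunc f ts) :=
  (p.mk_eq_iff _ _).2 ((p.sat.equal_mem_iff _ _).2 (ProvI.func_congr _ fun i => p.out_mk (ts i)))

theorem CanonicalNode.relMap_mk (p : CanonicalNode T A) {n : ℕ} (R : L.Relations n)
    (ts : Fin n → ClosedTerm L (stageSet A p.1.1 0)) :
    Structure.RelMap R (fun i => p.mk (ts i)) ↔
      IFml.rel (L := L[[ℕ × ℕ × A]]) (Sum.inl R) (fun i => (ts i).1) ∈ p.1.2 := by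
  have h₁ : ∀ ts : Fin n → ClosedTerm L (stageSet A p.1.1 0),
      (IFml.rel (L := L[[ℕ × ℕ × A]]) (Sum.inl R) (fun i => (ts i).1)).consts ⊆
        stageSet A p.1.1 0 := fun ts => Set.iUnion_subset fun i => (ts i).2
  refine ⟨fun h => ?_, fun h => ?_⟩
  · exact p.sat.closed (h₁ _) (ProvI.rel_congr _ (fun i => p.out_mk (ts i)) (ProvI.of_mem h))
  · exact p.sat.closed (h₁ _)
      (ProvI.rel_congr _ (fun i => (p.out_mk (ts i)).eqSymm) (ProvI.of_mem h))

theorem CanonicalNode.exists_mk (p : CanonicalNode T A) {n : ℕ} (a : Fin n → p.Dom) :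
    ∃ ts : Fin n → ClosedTerm L (stageSet A p.1.1 0), a = fun i => p.mk (ts i) :=
  ⟨fun i => p.out (a i), funext fun _ => (p.mk_out _).symm⟩

def ClosedTerm.incl {X : Type*} {S S' : Set X} (h : S ⊆ S') (t : ClosedTerm L S) :
    ClosedTerm L S' := ⟨t.1, t.2.trans h⟩

variable (T A)

/-- The canonical Kripke model of `T`. -/
noncomputable def canonical : KripkeData.{u, 0, max u x} L where
  Node := CanonicalNode T A
  le p q := p.1.1 ≤ q.1.1 ∧ p.1.2 ⊆ q.1.2
  Dom p := p.Dom
  str p := p.str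
  map {p q} h := Quotient.map' (s₁ := p.sat.setoid) (s₂ := q.sat.setoid)
    (ClosedTerm.incl (level_mono h.1)) fun _ _ hts => h.2 hts

variable {T A}

theorem canonical_isPreModel : (canonical T A).IsPreModel where
  refl p := ⟨le_rfl, subset_rfl⟩
  trans h h' := ⟨h.1.trans h'.1, h.2.trans h'.2⟩
  map_self {p} h d := by
    obtain ⟨t, rfl⟩ : ∃ t, d = CanonicalNode.mk p t := ⟨_, (CanonicalNode.mk_out p d).symm⟩
    rfl
  map_map {p q r} h₁ h₂ h₃ d := by
    obtain ⟨t, rfl⟩ : ∃ t, d = CanonicalNode.mk p t := ⟨_, (CanonicalNode.mk_out p d).symm⟩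
    rfl
  map_fun {p q} h n f a := by
    obtain ⟨ts, rfl⟩ := CanonicalNode.exists_mk p a
    exact (congrArg ((canonical T A).map h) (CanonicalNode.funMap_mk p f ts)).trans
      (CanonicalNode.funMap_mk q f fun i => (ts i).incl (level_mono h.1)).symm
  map_rel {p q} h n R a hR := by
    obtain ⟨ts, rfl⟩ := CanonicalNode.exists_mk p a
    exact (CanonicalNode.relMap_mk q R fun i => (ts i).incl (level_mono h.1)).2
      (h.2 ((CanonicalNode.relMap_mk p R ts).1 hR))

theorem consts_onLang_subst {X : Type*} {S : Set X} {n : ℕ} (φ : IFml L n)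
    (τ : Fin n → ClosedTerm L S) :
    ((φ.onLang (L.lhomWithConstants X)).subst fun i => (τ i).1).consts ⊆ S :=
  IFml.consts_subst _ _ (by simp [IFml.consts_onLang]) fun i => (τ i).2

theorem canonical_realize (p : CanonicalNode T A) {n : ℕ} (t : L.Term (Fin n))
    (τ : Fin n → ClosedTerm L (stageSet A p.1.1 0)) :
    t.realize (fun i => p.mk (τ i)) =
      p.mk ⟨((L.lhomWithConstants _).onTerm t).subst fun i => (τ i).1,
        termConsts_subst _ _ (by simp [termConsts_onTerm]) fun i => (τ i).2⟩ := by
  induction t with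
  | var => rfl
  | func f ts ih =>
    simp only [Term.realize, ih, p.funMap_mk]
    rfl

theorem canonical_cons (p : CanonicalNode T A) {n : ℕ} (t : ClosedTerm L (stageSet A p.1.1 0))
    (τ : Fin n → ClosedTerm L (stageSet A p.1.1 0)) :
    (Fin.cons (p.mk t) fun i => p.mk (τ i) : Fin (n + 1) → p.Dom) =
      fun i => p.mk ((Fin.cons t τ : Fin (n + 1) → ClosedTerm L (stageSet A p.1.1 0)) i) := by
  funext i
  refine Fin.cases ?_ (fun i => ?_) i <;> rfl

theorem onLang_liftSubst_inst {X : Type*} {S : Set X} {n : ℕ} (φ : IFml L (n + 1))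
    (t : ClosedTerm L S) (τ : Fin n → ClosedTerm L S) :
    ((φ.onLang (L.lhomWithConstants X)).subst (IFml.liftSubst fun i => (τ i).1)).inst t.1 =
      (φ.onLang (L.lhomWithConstants X)).subst
        fun i => ((Fin.cons t τ : Fin (n + 1) → ClosedTerm L S) i).1 := by
  rw [IFml.liftSubst_inst]
  congr 1
  funext i
  refine Fin.cases ?_ (fun i => ?_) i <;> rfl

/-- The truth lemma. Primality handles ∨ and the witnesses handle ∃. If an implication or a
universal sentence is missing from the theory of a node, saturating a suitable extension that still
avoids the conclusion, or an instance at a fresh constant, produces a later node that refutes it. -/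
theorem canonical_forces_iff (e : IFml L[[ℕ × ℕ × A]] 1 ↪ A) {n : ℕ} (φ : IFml L n)
    (p : CanonicalNode T A) (τ : Fin n → ClosedTerm L (stageSet A p.1.1 0)) :
    (canonical T A).Forces φ p (fun i => p.mk (τ i)) ↔
      (φ.onLang (L.lhomWithConstants _)).subst (fun i => (τ i).1) ∈ p.1.2 := by
  induction φ generalizing p with
  | falsum => exact ⟨False.elim, p.sat.consistent⟩
  | equal t s =>
    have h₁ := canonical_realize p t τ
    have h₂ := canonical_realize p s τ
    change t.realize (fun i => p.mk (τ i)) = s.realize (fun i => p.mk (τ i)) ↔ _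
    rw [h₁, h₂, p.mk_eq_iff]
    rfl
  | rel R ts =>
    change Structure.RelMap R (fun j => (ts j).realize fun i => p.mk (τ i)) ↔ _
    simp only [canonical_realize]
    exact p.relMap_mk R _
  | and φ ψ h₁ h₂ =>
    have hφ := consts_onLang_subst φ τ
    have hψ := consts_onLang_subst ψ τ
    simp only [KripkeData.Forces, h₁, h₂]
    rw [← p.sat.provI_iff hφ, ← p.sat.provI_iff hψ, ← p.sat.provI_iff
      (consts_onLang_subst (φ.and ψ) τ)]
    exact ⟨fun h => .andI h.1 h.2, fun h => ⟨.andE₁ h, .andE₂ h⟩⟩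
  | or φ ψ h₁ h₂ =>
    have hφ := consts_onLang_subst φ τ
    have hψ := consts_onLang_subst ψ τ
    simp only [KripkeData.Forces, h₁, h₂]
    refine ⟨fun h => ?_, fun h => p.sat.prime h⟩
    refine p.sat.closed (consts_onLang_subst (φ.or ψ) τ) ?_
    rcases h with h | h
    exacts [.orI₁ (ProvI.of_mem h), .orI₂ (ProvI.of_mem h)]
  | imp φ ψ h₁ h₂ =>
    have hφ := consts_onLang_subst φ τ
    have hψ := consts_onLang_subst ψ τ
    refine ⟨fun h => ?_, fun h q hpq hq => ?_⟩
    · by_contra hn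
      have hn' : ¬ ProvI (insert ((φ.onLang (L.lhomWithConstants _)).subst fun i => (τ i).1) p.1.2)
          ((ψ.onLang (L.lhomWithConstants _)).subst fun i => (τ i).1) := fun hp =>
        hn (p.sat.closed (consts_onLang_subst (φ.imp ψ) τ) hp.imp_of_insert)
      obtain ⟨Δ, hΔ₁, hΔ₂, hΔ₃⟩ := exists_saturated e (by
        rintro χ (rfl | hχ)
        exacts [hφ, p.sat.supp χ hχ]) hψ hn'
      let q : CanonicalNode T A := ⟨(p.1.1 + 1, Δ), hΔ₂,
        p.2.2.trans ((Set.subset_insert _ _).trans hΔ₁)⟩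
      have hpq : (canonical T A).le p q := ⟨Nat.le_succ _, (Set.subset_insert _ _).trans hΔ₁⟩
      have := h q hpq ((h₁ q fun i => (τ i).incl (level_mono hpq.1)).2
        (hΔ₁ (Set.mem_insert _ _)))
      exact hΔ₃ (ProvI.of_mem ((h₂ q fun i => (τ i).incl (level_mono hpq.1)).1 this))
    · refine (h₂ q fun i => (τ i).incl (level_mono hpq.1)).2 ?_
      have hq' := (h₁ q fun i => (τ i).incl (level_mono hpq.1)).1 hq
      exact q.sat.closed (hψ.trans (level_mono hpq.1))
        (.impE (ProvI.of_mem (hpq.2 h)) (ProvI.of_mem hq'))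
  | all φ ih =>
    refine ⟨fun h => ?_, fun h q hpq d => ?_⟩
    · by_contra hn
      let ψ : IFml L[[ℕ × ℕ × A]] 1 :=
        (φ.onLang (L.lhomWithConstants _)).subst (IFml.liftSubst fun i => (τ i).1)
      have hψ : ψ.consts ⊆ stageSet A p.1.1 0 := consts_onLang_subst φ.all τ
      -- Constants of level `p.1.1` do not occur at `p`; the stage and the name are arbitrary.
      -- Admitting `c` raises the level by one and the saturation raises it once more, hence the
      -- level `p.1.1 + 1 + 1` of `q`.
      let c : ℕ × ℕ × A := (p.1.1, 0, e IFml.falsum)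
      have hc : c ∉ stageSet A p.1.1 0 := by
        rintro (h | h)
        exacts [lt_irrefl _ h, lt_irrefl _ h.2]
      have hc' : c ∈ stageSet A (p.1.1 + 1) 0 := Or.inl (Nat.lt_succ_self _)
      have hn' : ¬ ProvI p.1.2 (ψ.inst (conTerm L c)) := fun hp =>
        hn (p.sat.closed hψ (provI_all_of_fresh p.sat.supp hψ hc hp))
      have hl : stageSet A p.1.1 0 ⊆ stageSet A (p.1.1 + 1) 0 := level_mono (Nat.le_succ _)
      have hct : termConsts (conTerm L c : L[[ℕ × ℕ × A]].Term (Fin 0)) ⊆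
          stageSet A (p.1.1 + 1) 0 := by
        rintro x (rfl : x = c)
        exact hc'
      obtain ⟨Δ, hΔ₁, hΔ₂, hΔ₃⟩ := exists_saturated e (i := p.1.1 + 1)
        (fun χ hχ => (p.sat.supp χ hχ).trans hl)
        (IFml.consts_subst _ _ (hψ.trans hl) (by
          intro k
          refine Fin.cases ?_ (fun k => k.elim0) k
          exact hct)) hn'
      let q : CanonicalNode T A := ⟨(p.1.1 + 1 + 1, Δ), hΔ₂, p.2.2.trans hΔ₁⟩
      have hpq : (canonical T A).le p q := ⟨(Nat.le_succ _).trans (Nat.le_succ _), hΔ₁⟩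
      have := h q hpq (q.mk ⟨conTerm L c, hct.trans (level_mono (Nat.le_succ _))⟩)
      have e₁ := canonical_cons q ⟨conTerm L c, hct.trans (level_mono (Nat.le_succ _))⟩
        fun i => (τ i).incl (level_mono hpq.1)
      have h' := (ih q _).1 ((congrArg ((canonical T A).Forces φ q) e₁).mp this)
      rw [← onLang_liftSubst_inst] at h'
      exact hΔ₃ (ProvI.of_mem h')
    · obtain ⟨t, rfl⟩ : ∃ t, d = CanonicalNode.mk q t := ⟨_, (CanonicalNode.mk_out q d).symm⟩
      have e₁ := canonical_cons q t fun i => (τ i).incl (level_mono hpq.1)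
      refine (congrArg ((canonical T A).Forces φ q) e₁).mpr ((ih q _).2 ?_)
      refine q.sat.closed (consts_onLang_subst _ _) ?_
      rw [← onLang_liftSubst_inst]
      exact .allE t.1 (ProvI.of_mem (hpq.2 h))
  | ex φ ih =>
    refine ⟨fun ⟨d, hd⟩ => ?_, fun h => ?_⟩
    · obtain ⟨t, rfl⟩ : ∃ t, d = CanonicalNode.mk p t := ⟨_, (CanonicalNode.mk_out p d).symm⟩
      have e₁ := canonical_cons p t τ
      have h' := (ih p _).1 ((congrArg ((canonical T A).Forces φ p) e₁).mp hd)
      rw [← onLang_liftSubst_inst] at h'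
      exact p.sat.closed (consts_onLang_subst φ.ex τ) (.exI t.1 (ProvI.of_mem h'))
    · obtain ⟨c, hc, hw⟩ := p.sat.witness h
      have hct : termConsts (conTerm L c : L[[ℕ × ℕ × A]].Term (Fin 0)) ⊆
          stageSet A p.1.1 0 := by
        rintro x (rfl : x = c)
        exact hc
      refine ⟨p.mk ⟨conTerm L c, hct⟩, ?_⟩
      have e₁ := canonical_cons p ⟨conTerm L c, hct⟩ τ
      refine (congrArg ((canonical T A).Forces φ p) e₁).mpr ((ih p _).2 ?_)
      rw [← onLang_liftSubst_inst]
      exact hw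

end Henkin

/-- Completeness: an unprovable sentence of a language with a closed term fails in a Kripke
model, whose transition maps need not be injective. -/
theorem exists_preModel_of_not_provI {L : FirstOrder.Language.{u, 0}} (t₀ : L.Term (Fin 0))
    {T : Set (ISent L)} {φ : ISent L} (h : ¬ ProvI T φ) :
    ∃ K : KripkeData.{u, 0, max u w} L, K.IsPreModel ∧ Nonempty K.Node ∧
      (∀ {k₁ k₂}, K.le k₁ k₂ → K.le k₂ k₁ → k₁ = k₂) ∧ (∀ θ ∈ T, K.Models θ) ∧ ¬ K.Models φ := by
  obtain ⟨A, ⟨e⟩⟩ := exists_henkin_names.{u, 0, w} L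
  have hsub : ∀ (φ : ISent L) {S : Set (ℕ × ℕ × A)} (τ : Fin 0 → Henkin.ClosedTerm L S),
      (φ.onLang (L.lhomWithConstants (ℕ × ℕ × A))).subst (fun i => (τ i).1) =
        φ.onLang (L.lhomWithConstants (ℕ × ℕ × A)) := by
    intro φ S τ
    convert IFml.subst_var _
  have h' : ¬ ProvI (IFml.onLang (L.lhomWithConstants (ℕ × ℕ × A)) '' T)
      (φ.onLang (L.lhomWithConstants _)) := by
    intro hp
    have htr : ∀ (χ : ISent L) {m : ℕ} (ρ : ℕ × ℕ × A → L.Term (Fin m)) (f),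
        (χ.onLang (L.lhomWithConstants (ℕ × ℕ × A))).tr (LHom.id L) ρ f =
          χ.rename Fin.elim0 := by
      intro χ m ρ f
      rw [IFml.tr_onLang, IFml.onLang_id, IFml.rename]
      congr 1
      funext i
      exact i.elim0
    -- The Henkin constants do not occur in `T` or `φ`, so a derivation that uses them is pulled
    -- back by replacing all of them by the closed term `t₀`.
    have := Deriv.tr (T' := T) (LHom.id L) ∅ (fun _ => t₀)
      (by
        rintro _ ⟨χ, hχ, rfl⟩ m ρ -
        exact ⟨χ, hχ, htr χ ρ _⟩) hp (fun _ => t₀) (by simp) Fin.elim0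
    rw [htr, IFml.rename_elim0_self] at this
    exact h this
  obtain ⟨Δ, hΔ₁, hΔ₂, hΔ₃⟩ := Henkin.exists_saturated e (i := 0)
    (by
      rintro _ ⟨χ, -, rfl⟩
      simp [IFml.consts_onLang]) (by simp [IFml.consts_onLang]) h'
  let p : Henkin.CanonicalNode T A := ⟨(1, Δ), hΔ₂, hΔ₁⟩
  refine ⟨Henkin.canonical T A, Henkin.canonical_isPreModel, ⟨p⟩, ?_, ?_, ?_⟩
  · intro k₁ k₂ h₁ h₂
    exact Subtype.ext (Prod.ext (le_antisymm h₁.1 h₂.1) (subset_antisymm h₁.2 h₂.2))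
  · intro θ hθ q
    exact KripkeData.forces_sentence ((Henkin.canonical_forces_iff e θ q Fin.elim0).2
      (by rw [hsub]; exact q.2.2 ⟨θ, hθ, rfl⟩))
  · intro hm
    have := (Henkin.canonical_forces_iff e φ p Fin.elim0).1 (KripkeData.forces_sentence (hm p))
    rw [hsub] at this
    exact hΔ₃ (ProvI.of_mem this)

/-! ### Structures satisfying primitive recursive arithmetic -/

namespace PRSym

/-- The interpretation of a function symbol. -/
def ev {D : Type*} [LPR.Structure D] {n : ℕ} (f : PRSym n) (a : Fin n → D) : D :=
  Structure.funMap (L := LPR) f a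

end PRSym

theorem realize_fn {D : Type*} [LPR.Structure D] {n k : ℕ} (f : PRSym k)
    (ts : Fin k → LPR.Term (Fin n)) (a : Fin n → D) :
    (fn f ts).realize a = f.ev fun i => (ts i).realize a := rfl

theorem realize_vr {D : Type*} [LPR.Structure D] {n : ℕ} (i : Fin n) (a : Fin n → D) :
    (vr i).realize a = a i := rfl

section Pra

variable {D : Type*} [LPR.Structure D]

instance (priority := 10) praZero : Zero D := ⟨PRSym.zero.ev ![]⟩

/-- The successor function. -/
def suc (x : D) : D := PRSym.succ.ev ![x]

theorem ev_zero (a : Fin 0 → D) : PRSym.zero.ev a = 0 := by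
  rw [Subsingleton.elim a ![] ]
  rfl

theorem ev_succ (a : Fin 1 → D) : PRSym.succ.ev a = suc (a 0) := by
  have : a = ![a 0] := by
    funext i
    rw [Subsingleton.elim i 0]
    rfl
  rw [this]
  rfl

theorem realize_tZero {n : ℕ} (a : Fin n → D) : (tZero : LPR.Term (Fin n)).realize a = 0 :=
  ev_zero _

theorem realize_tSucc {n : ℕ} (t : LPR.Term (Fin n)) (a : Fin n → D) :
    (tSucc t).realize a = suc (t.realize a) := ev_succ _

/-- The functions given by terms with parameters. -/
inductive OpenFun : (D → D) → Prop
  | id : OpenFun fun x => x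
  | const (c : D) : OpenFun fun _ => c
  | ev {n : ℕ} (f : PRSym n) (g : Fin n → D → D) (h : ∀ i, OpenFun (g i)) :
      OpenFun fun x => f.ev fun i => g i x

/-- The predicates given by quantifier-free formulas with parameters. -/
inductive OpenPred : (D → Prop) → Prop
  | eq {f g : D → D} (hf : OpenFun f) (hg : OpenFun g) : OpenPred fun x => f x = g x
  | not {P : D → Prop} (hP : OpenPred P) : OpenPred fun x => ¬ P x
  | and {P Q : D → Prop} (hP : OpenPred P) (hQ : OpenPred Q) : OpenPred fun x => P x ∧ Q x
  | or {P Q : D → Prop} (hP : OpenPred P) (hQ : OpenPred Q) : OpenPred fun x => P x ∨ Q x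
  | imp {P Q : D → Prop} (hP : OpenPred P) (hQ : OpenPred Q) : OpenPred fun x => P x → Q x

/-- The term is obtained for every tuple of parameters that contains a given finite set, so that the
parameters of several subterms can be put into one common tuple. -/
theorem OpenFun.exists_term {f : D → D} (hf : OpenFun f) :
    ∃ s : Set D, s.Finite ∧ ∀ (n : ℕ) (a : Fin n → D), s ⊆ Set.range a →
      ∃ t : LPR.Term (Fin (n + 1)), ∀ x, f x = t.realize (Fin.cons x a : Fin (n + 1) → D) := by
  induction hf with
  | id => exact ⟨∅, Set.finite_empty, fun n a _ => ⟨vr 0, fun x => rfl⟩⟩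
  | const c =>
    refine ⟨{c}, Set.finite_singleton c, fun n a h => ?_⟩
    obtain ⟨i, rfl⟩ := h rfl
    exact ⟨vr i.succ, fun x => rfl⟩
  | @ev m f g _ ih =>
    choose s hs h using ih
    refine ⟨⋃ i, s i, Set.finite_iUnion hs, fun n a ha => ?_⟩
    choose t ht using fun i => h i n a ((Set.subset_iUnion s i).trans ha)
    exact ⟨fn f t, fun x => congrArg f.ev (funext fun i => ht i x)⟩

theorem OpenPred.exists_formula {P : D → Prop} (hP : OpenPred P) :
    ∃ s : Set D, s.Finite ∧ ∀ (n : ℕ) (a : Fin n → D), s ⊆ Set.range a →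
      ∃ φ : IFml LPR (n + 1), φ.IsQF ∧
        ∀ x, P x ↔ φ.Realize (Fin.cons x a : Fin (n + 1) → D) := by
  have bin : ∀ {P Q R : D → Prop} (c : ∀ {n : ℕ}, IFml LPR n → IFml LPR n → IFml LPR n),
      (∀ {n : ℕ} {φ ψ : IFml LPR n}, φ.IsQF → ψ.IsQF → (c φ ψ).IsQF) →
      (∀ {n : ℕ} {φ ψ : IFml LPR (n + 1)} {x : D} {a : Fin n → D},
        (P x ↔ φ.Realize (Fin.cons x a : Fin (n + 1) → D)) →
        (Q x ↔ ψ.Realize (Fin.cons x a : Fin (n + 1) → D)) →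
        (R x ↔ (c φ ψ).Realize (Fin.cons x a : Fin (n + 1) → D))) →
      (∃ s : Set D, s.Finite ∧ ∀ (n : ℕ) (a : Fin n → D), s ⊆ Set.range a →
        ∃ φ : IFml LPR (n + 1), φ.IsQF ∧
          ∀ x, P x ↔ φ.Realize (Fin.cons x a : Fin (n + 1) → D)) →
      (∃ s : Set D, s.Finite ∧ ∀ (n : ℕ) (a : Fin n → D), s ⊆ Set.range a →
        ∃ φ : IFml LPR (n + 1), φ.IsQF ∧
          ∀ x, Q x ↔ φ.Realize (Fin.cons x a : Fin (n + 1) → D)) →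
      ∃ s : Set D, s.Finite ∧ ∀ (n : ℕ) (a : Fin n → D), s ⊆ Set.range a →
        ∃ φ : IFml LPR (n + 1), φ.IsQF ∧
          ∀ x, R x ↔ φ.Realize (Fin.cons x a : Fin (n + 1) → D) := by
    rintro P Q R c hc hR ⟨s, hs, h⟩ ⟨s', hs', h'⟩
    refine ⟨s ∪ s', hs.union hs', fun n a ha => ?_⟩
    obtain ⟨φ, hφ, h⟩ := h n a (Set.subset_union_left.trans ha)
    obtain ⟨ψ, hψ, h'⟩ := h' n a (Set.subset_union_right.trans ha)
    exact ⟨c φ ψ, hc hφ hψ, fun x => hR (h x) (h' x)⟩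
  induction hP with
  | eq hf hg =>
    obtain ⟨s, hs, h⟩ := hf.exists_term
    obtain ⟨s', hs', h'⟩ := hg.exists_term
    refine ⟨s ∪ s', hs.union hs', fun n a ha => ?_⟩
    obtain ⟨t, ht⟩ := h n a (Set.subset_union_left.trans ha)
    obtain ⟨t', ht'⟩ := h' n a (Set.subset_union_right.trans ha)
    exact ⟨IFml.equal t t', trivial, fun x => by simp only [ht, ht']; rfl⟩
  | not _ ih =>
    obtain ⟨s, hs, h⟩ := ih
    refine ⟨s, hs, fun n a ha => ?_⟩
    obtain ⟨φ, hφ, h⟩ := h n a ha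
    exact ⟨φ.neg, ⟨hφ, trivial⟩, fun x => not_congr (h x)⟩
  | and _ _ ih₁ ih₂ => exact bin .and (fun h h' => ⟨h, h'⟩) (fun h h' => and_congr h h') ih₁ ih₂
  | or _ _ ih₁ ih₂ => exact bin .or (fun h h' => ⟨h, h'⟩) (fun h h' => or_congr h h') ih₁ ih₂
  | imp _ _ ih₁ ih₂ => exact bin .imp (fun h h' => ⟨h, h'⟩) (fun h h' => imp_congr h h') ih₁ ih₂

/-- The structure satisfies primitive recursive arithmetic, with induction for quantifier-free
formulas with parameters. -/
class IsPRA (D : Type*) [LPR.Structure D] : Prop where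
  suc_ne_zero (x : D) : suc x ≠ 0
  suc_inj {x y : D} : suc x = suc y → x = y
  ev_proj {n : ℕ} (i : Fin n) (a : Fin n → D) : (PRSym.proj i).ev a = a i
  ev_comp {m n : ℕ} (f : PRSym m) (g : Fin m → PRSym n) (a : Fin n → D) :
    (PRSym.comp f g).ev a = f.ev fun i => (g i).ev a
  ev_prec_zero {n : ℕ} (f : PRSym n) (g : PRSym (n + 2)) (a : Fin n → D) :
    (PRSym.prec f g).ev (Fin.cons 0 a) = f.ev a
  ev_prec_suc {n : ℕ} (f : PRSym n) (g : PRSym (n + 2)) (x : D) (a : Fin n → D) :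
    (PRSym.prec f g).ev (Fin.cons (suc x) a) =
      g.ev (Fin.cons x (Fin.cons ((PRSym.prec f g).ev (Fin.cons x a)) a))
  ind {P : D → Prop} : OpenPred P → P 0 → (∀ x, P x → P (suc x)) → ∀ x, P x

end Pra

/-! ### Kripke models of Heyting arithmetic -/

namespace KripkeData

/-- A Kripke model of `HA`, where the injectivity of the transition maps is not demanded: it
follows. -/
structure IsHAModel (K : KripkeData.{0, 0, w} LPR) : Prop extends K.IsPreModel where
  models_HA : ∀ θ ∈ HA, K.Models θ

variable {K : KripkeData.{0, 0, w} LPR}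

namespace IsHAModel

theorem map_ev (hK : K.IsHAModel) {k k' : K.Node} (h : K.le k k') {n : ℕ} (f : PRSym n)
    (a : Fin n → K.Dom k) : K.map h (f.ev a) = f.ev (K.map h ∘ a) := hK.map_fun h _ _

theorem map_zero (hK : K.IsHAModel) {k k' : K.Node} (h : K.le k k') :
    K.map h (0 : K.Dom k) = 0 :=
  (hK.map_ev h PRSym.zero ![]).trans (ev_zero _)

theorem map_suc (hK : K.IsHAModel) {k k' : K.Node} (h : K.le k k') (x : K.Dom k) :
    K.map h (suc x) = suc (K.map h x) :=
  (hK.map_ev h PRSym.succ ![x]).trans (ev_succ _)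

theorem forces_of_arithAx (hK : K.IsHAModel) {n : ℕ} {φ : IFml LPR n} (h : ArithAx φ.closeAll)
    (k : K.Node) (a : Fin n → K.Dom k) : K.Forces φ k a :=
  (hK.models_closeAll φ).1 (hK.models_HA _ h) k a

/-- Since a forced implication looks at later nodes, the induction step is required at all of them.
-/
theorem forces_ind (hK : K.IsHAModel) {n : ℕ} (φ : IFml LPR (n + 1)) (k : K.Node)
    (a : Fin n → K.Dom k) (h₀ : K.Forces φ k (Fin.cons 0 a : Fin (n + 1) → K.Dom k))
    (hs : ∀ (k' : K.Node) (h : K.le k k') (x : K.Dom k'),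
      K.Forces φ k' (Fin.cons x (K.map h ∘ a) : Fin (n + 1) → K.Dom k') →
      K.Forces φ k' (Fin.cons (suc x) (K.map h ∘ a) : Fin (n + 1) → K.Dom k')) (x : K.Dom k) :
    K.Forces φ k (Fin.cons x a : Fin (n + 1) → K.Dom k) := by
  have h := hK.forces_of_arithAx (ArithAx.ind φ) k a
  refine hK.forces_all (hK.forces_imp h ⟨?_, ?_⟩) x
  · rw [hK.forces_inst]
    have e : (tZero : LPR.Term (Fin n)).realize a = 0 := ev_zero _
    rwa [e]
  · intro k' h' y k'' h'' hy
    rw [hK.forces_subst]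
    rw [map_cons, hK.map_comp_map h' h'' (hK.trans h' h'')] at hy ⊢
    convert hs k'' _ _ hy using 1
    funext i
    refine Fin.cases ?_ (fun i => ?_) i
    · exact ev_succ _
    · rfl

theorem suc_ne_zero (hK : K.IsHAModel) {k : K.Node} (x : K.Dom k) : suc x ≠ 0 := by
  intro e
  refine hK.forces_imp (hK.forces_of_arithAx ArithAx.succ_ne_zero k ![x]) ?_
  change Term.realize _ _ = Term.realize _ _
  rw [tSucc, tZero, realize_fn, realize_fn, ev_succ, ev_zero]
  exact e

theorem suc_inj (hK : K.IsHAModel) {k : K.Node} {x y : K.Dom k} (e : suc x = suc y) : x = y := by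
  refine hK.forces_imp (hK.forces_of_arithAx ArithAx.succ_inj k ![x, y]) ?_
  change Term.realize _ _ = Term.realize _ _
  rw [tSucc, tSucc, realize_fn, realize_fn, ev_succ, ev_succ]
  exact e

/-- Proved by induction: the axiom of Q only yields a predecessor from a forced negation of x = 0,
and the decidability of equality is not available yet; its proof uses this lemma. -/
theorem eq_zero_or_suc (hK : K.IsHAModel) {k : K.Node} (x : K.Dom k) :
    x = 0 ∨ ∃ y, x = suc y := by
  have := hK.forces_ind (n := 0)
    ((IFml.equal (vr 0) tZero).or (IFml.equal (vr 1) (tSucc (vr 0))).ex) k ![]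
    (by left; exact (ev_zero _).symm) (by
      intro k' h x _
      refine Or.inr ⟨x, ?_⟩
      change Term.realize _ _ = Term.realize _ _
      rw [realize_tSucc]
      rfl) x
  rcases this with h | ⟨y, h⟩
  · left
    exact (show x = _ from h).trans (ev_zero _)
  · right
    exact ⟨y, (show x = _ from h).trans (ev_succ _)⟩

/-- HA decides equality: induction on x for the formula ∀y (x = y ∨ ¬ x = y), with a case
distinction on y. Elements that are distinct at one node therefore stay distinct, which makes the
transition maps injective. -/
theorem forces_eq_or_ne (hK : K.IsHAModel) {k : K.Node} (x y : K.Dom k) :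
    x = y ∨ ∀ (k' : K.Node) (h : K.le k k'), K.map h x ≠ K.map h y := by
  have := hK.forces_ind (n := 0)
    ((IFml.equal (vr 1) (vr 0)).or (IFml.equal (vr 1) (vr 0)).neg).all k ![]
    (by
      intro k' h y
      rcases hK.eq_zero_or_suc y with rfl | ⟨z, rfl⟩
      · left
        exact hK.map_zero h
      · right
        intro k'' h' (e : K.map h' (K.map h 0) = K.map h' (suc z))
        rw [hK.map_zero, hK.map_zero, hK.map_suc] at e
        exact hK.suc_ne_zero _ e.symm)
    (by
      intro k' h x hx k'' h' y
      rcases hK.eq_zero_or_suc y with rfl | ⟨z, rfl⟩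
      · right
        intro k₃ h₃ (e : K.map h₃ (K.map h' (suc x)) = K.map h₃ 0)
        rw [hK.map_zero, hK.map_suc, hK.map_suc] at e
        exact hK.suc_ne_zero _ e
      · rcases hx k'' h' z with h₁ | h₁
        · left
          have h₁ : K.map h' x = z := h₁
          exact (hK.map_suc h' x).trans (congrArg suc h₁)
        · right
          intro k₃ h₃ (e : K.map h₃ (K.map h' (suc x)) = K.map h₃ (suc z))
          rw [hK.map_suc, hK.map_suc, hK.map_suc] at e
          exact h₁ k₃ h₃ (hK.suc_inj e)) x
  rcases hK.forces_all this y with h | h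
  · exact Or.inl h
  · exact Or.inr fun k' h' e => h k' h' e

theorem map_injective (hK : K.IsHAModel) {k k' : K.Node} (h : K.le k k') :
    Function.Injective (K.map h) := fun x y e =>
  (hK.forces_eq_or_ne x y).resolve_right fun hn => hn k' h e

theorem realize_map_iff (hK : K.IsHAModel) {n : ℕ} {φ : IFml LPR n} (hφ : φ.IsQF)
    {k k' : K.Node} (h : K.le k k') (a : Fin n → K.Dom k) :
    φ.Realize (K.map h ∘ a) ↔ φ.Realize a := by
  induction φ with
  | falsum => rfl
  | equal t s =>
    simp only [IFml.Realize, hK.realize_map]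
    exact (hK.map_injective h).eq_iff
  | rel R ts => exact R.elim
  | and φ ψ h₁ h₂ => exact and_congr (h₁ hφ.1 a) (h₂ hφ.2 a)
  | or φ ψ h₁ h₂ => exact or_congr (h₁ hφ.1 a) (h₂ hφ.2 a)
  | imp φ ψ h₁ h₂ => exact imp_congr (h₁ hφ.1 a) (h₂ hφ.2 a)
  | all φ _ => exact hφ.elim
  | ex φ _ => exact hφ.elim

/-- Forcing of quantifier-free formulas is truth. -/
theorem forces_iff_realize (hK : K.IsHAModel) {n : ℕ} {φ : IFml LPR n} (hφ : φ.IsQF)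
    {k : K.Node} (a : Fin n → K.Dom k) : K.Forces φ k a ↔ φ.Realize a := by
  induction φ generalizing k with
  | falsum => rfl
  | equal t s => rfl
  | rel R ts => exact R.elim
  | and φ ψ h₁ h₂ => exact and_congr (h₁ hφ.1 a) (h₂ hφ.2 a)
  | or φ ψ h₁ h₂ => exact or_congr (h₁ hφ.1 a) (h₂ hφ.2 a)
  | imp φ ψ h₁ h₂ =>
    refine ⟨fun h h' => (h₂ hφ.2 a).1 (hK.forces_imp h ((h₁ hφ.1 a).2 h')), fun h k' hk h' => ?_⟩
    rw [h₂ hφ.2, hK.realize_map_iff hφ.2]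
    rw [h₁ hφ.1, hK.realize_map_iff hφ.1] at h'
    exact h h'
  | all φ _ => exact hφ.elim
  | ex φ _ => exact hφ.elim

theorem forces_neg_iff (hK : K.IsHAModel) {n : ℕ} {φ : IFml LPR n} (hφ : φ.IsQF)
    {k : K.Node} (a : Fin n → K.Dom k) : K.Forces φ.neg k a ↔ ¬ K.Forces φ k a := by
  rw [hK.forces_iff_realize hφ, hK.forces_iff_realize (φ := φ.neg) ⟨hφ, trivial⟩]
  rfl

/-- The step hypothesis is known only at the node `k`, whereas `forces_ind` asks for it at all later
nodes. The remedy is to apply induction to a formula whose induction step holds everywhere. -/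
theorem open_ind (hK : K.IsHAModel) {k : K.Node} {P : K.Dom k → Prop} (hP : OpenPred P)
    (h₀ : P 0) (hs : ∀ x, P x → P (suc x)) (x : K.Dom k) : P x := by
  obtain ⟨s, hfin, h⟩ := hP.exists_formula
  obtain ⟨n, a, ha⟩ := Set.Finite.fin_param hfin
  obtain ⟨φ, hφ, h⟩ := h n a ha.2.symm.subset
  have hF : ∀ x, P x ↔ K.Forces φ k (Fin.cons x a : Fin (n + 1) → K.Dom k) := fun x => by
    rw [h, hK.forces_iff_realize hφ]
  let ψ : IFml LPR (n + 2) := φ.rename (Fin.cons 0 fun i => i.succ.succ)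
  let χ : IFml LPR (n + 2) := φ.subst (Fin.cons (tSucc (vr 0)) fun i => vr i.succ.succ)
  have hψ : ∀ {k' : K.Node} (y x : K.Dom k') (a : Fin n → K.Dom k'),
      K.Forces ψ k' (Fin.cons y (Fin.cons x a : Fin (n + 1) → K.Dom k') :
        Fin (n + 2) → K.Dom k') ↔ K.Forces φ k' (Fin.cons y a : Fin (n + 1) → K.Dom k') := by
    intro k' y x a
    rw [hK.forces_rename]
    have e : (Fin.cons y (Fin.cons x a : Fin (n + 1) → K.Dom k') : Fin (n + 2) → K.Dom k') ∘
        (Fin.cons 0 fun i => i.succ.succ : Fin (n + 1) → Fin (n + 2)) = Fin.cons y a := by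
      funext i
      refine Fin.cases ?_ (fun i => ?_) i <;> rfl
    rw [e]
  have hχ : ∀ {k' : K.Node} (y x : K.Dom k') (a : Fin n → K.Dom k'),
      K.Forces χ k' (Fin.cons y (Fin.cons x a : Fin (n + 1) → K.Dom k') :
        Fin (n + 2) → K.Dom k') ↔
        K.Forces φ k' (Fin.cons (suc y) a : Fin (n + 1) → K.Dom k') := by
    intro k' y x a
    rw [hK.forces_subst]
    have e : (fun i => ((Fin.cons (tSucc (vr 0)) fun i => vr i.succ.succ :
        Fin (n + 1) → LPR.Term (Fin (n + 2))) i).realize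
        (Fin.cons y (Fin.cons x a : Fin (n + 1) → K.Dom k') : Fin (n + 2) → K.Dom k')) =
        Fin.cons (suc y) a := by
      funext i
      refine Fin.cases ?_ (fun i => ?_) i
      · exact ev_succ _
      · rfl
    rw [e]
  have hdec : ∀ {k' : K.Node} (b : Fin (n + 1) → K.Dom k'),
      K.Forces φ k' b ∨ K.Forces φ.neg k' b := fun b => by
    rw [hK.forces_neg_iff hφ]
    exact em _
  have hneg : ∀ {k' : K.Node} (y x : K.Dom k') (a : Fin n → K.Dom k'),
      K.Forces φ.neg k' (Fin.cons (suc y) a : Fin (n + 1) → K.Dom k') →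
      K.Forces χ.neg k' (Fin.cons y (Fin.cons x a : Fin (n + 1) → K.Dom k') :
        Fin (n + 2) → K.Dom k') := by
    intro k' y x a hn k'' hk hc
    rw [map_cons, map_cons, hχ] at hc
    have := hn k'' hk
    rw [map_cons, hK.map_suc] at this
    exact this hc
  -- The induction formula is φ(x) ∨ ∃y (φ(y) ∧ ¬φ(y + 1)): either φ holds at x or it has broken
  -- down somewhere. Its step needs only the decidability of φ. The second alternative at `k`
  -- contradicts `hs`.
  have key := hK.forces_ind (φ.or (ψ.and χ.neg).ex) k a (Or.inl ((hF 0).1 h₀))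
    (fun k' hk y hy => by
      rcases hy with hy | ⟨z, hz⟩
      · rcases hdec (Fin.cons (suc y) (K.map hk ∘ a) : Fin (n + 1) → K.Dom k') with h | h
        · exact Or.inl h
        · exact Or.inr ⟨y, (hψ _ _ _).2 hy, hneg _ _ _ h⟩
      · refine Or.inr ⟨z, (hψ _ _ _).2 ((hψ _ _ _).1 hz.1), hneg _ _ _ ?_⟩
        rw [hK.forces_neg_iff hφ]
        intro hc
        exact hK.forces_imp hz.2 ((hχ _ _ _).2 hc)) x
  rcases key with h | ⟨y, hy, hn⟩
  · exact (hF x).2 h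
  · have := hs y ((hF y).2 ((hψ _ _ _).1 hy))
    exact (hK.forces_imp hn ((hχ _ _ _).2 ((hF _).1 this))).elim

/-- Quantifier-free formulas are forced iff they are true, so the structure at each node can be
treated classically as a model of primitive recursive arithmetic. -/
theorem isPRA (hK : K.IsHAModel) (k : K.Node) : IsPRA (K.Dom k) where
  suc_ne_zero := hK.suc_ne_zero
  suc_inj := hK.suc_inj
  ev_proj i a := hK.forces_of_arithAx (ArithAx.proj i) k a
  ev_comp f g a := hK.forces_of_arithAx (ArithAx.comp f g) k a
  ev_prec_zero {n} f g a := by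
    have h : PRSym.ev _ _ = PRSym.ev _ _ := hK.forces_of_arithAx (ArithAx.prec_zero f g) k a
    refine Eq.trans (congrArg _ ?_) h
    funext i
    refine Fin.cases ?_ (fun i => ?_) i
    · exact (ev_zero _).symm
    · rfl
  ev_prec_suc {n} f g x a := by
    have h : PRSym.ev _ _ = PRSym.ev _ _ := hK.forces_of_arithAx (ArithAx.prec_succ f g) k
      (Fin.cons x a : Fin (n + 1) → K.Dom k)
    refine Eq.trans (congrArg _ ?_) (h.trans (congrArg _ ?_))
    · funext i
      refine Fin.cases ?_ (fun i => ?_) i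
      · exact (realize_tSucc (vr 0) (Fin.cons x a : Fin (n + 1) → K.Dom k)).symm
      · rfl
    · funext i
      refine Fin.cases ?_ (fun i => Fin.cases ?_ (fun i => ?_) i) i <;> rfl
  ind := hK.open_ind

end IsHAModel

end KripkeData

/-! ### Arithmetic in structures satisfying primitive recursive arithmetic -/

section Arithmetic

variable {D : Type*} [LPR.Structure D]

instance (priority := 10) praAdd : Add D := ⟨fun x y => PRSym.addS.ev ![x, y]⟩

instance (priority := 10) praMul : Mul D := ⟨fun x y => PRSym.mulS.ev ![x, y]⟩

instance (priority := 10) praSub : Sub D := ⟨fun x y => PRSym.subS.ev ![x, y]⟩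

/-- The predecessor function. -/
def prd (x : D) : D := PRSym.predS.ev ![x]

/-- The numerals. -/
def nm : ℕ → D
  | 0 => 0
  | k + 1 => suc (nm k)

theorem OpenFun.ev₁ {f : D → D} (hf : OpenFun f) (F : PRSym 1) :
    OpenFun fun x => F.ev ![f x] := by
  have := OpenFun.ev F ![f] (by intro i; fin_cases i; exact hf)
  convert this using 3 with x
  funext i
  fin_cases i
  rfl

theorem OpenFun.ev₂ {f g : D → D} (hf : OpenFun f) (hg : OpenFun g) (F : PRSym 2) :
    OpenFun fun x => F.ev ![f x, g x] := by
  have := OpenFun.ev F ![f, g] (by intro i; fin_cases i; exacts [hf, hg])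
  convert this using 3 with x
  funext i
  fin_cases i <;> rfl

theorem OpenFun.suc {f : D → D} (hf : OpenFun f) : OpenFun fun x => suc (f x) := hf.ev₁ _

theorem OpenFun.prd {f : D → D} (hf : OpenFun f) : OpenFun fun x => prd (f x) := hf.ev₁ _

theorem OpenFun.add {f g : D → D} (hf : OpenFun f) (hg : OpenFun g) :
    OpenFun fun x => f x + g x := hf.ev₂ hg _

theorem OpenFun.mul {f g : D → D} (hf : OpenFun f) (hg : OpenFun g) :
    OpenFun fun x => f x * g x := hf.ev₂ hg _

theorem OpenFun.sub {f g : D → D} (hf : OpenFun f) (hg : OpenFun g) :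
    OpenFun fun x => f x - g x := hf.ev₂ hg _

variable [IsPRA D]

open IsPRA

@[simp] theorem ev_proj_apply {n : ℕ} (i : Fin n) (a : Fin n → D) : (PRSym.proj i).ev a = a i :=
  ev_proj i a

theorem ev_comp₁ {n : ℕ} (f : PRSym 1) (g : PRSym n) (a : Fin n → D) :
    (PRSym.comp f ![g]).ev a = f.ev ![g.ev a] := by
  rw [ev_comp]
  congr 1
  funext i
  fin_cases i
  rfl

theorem ev_app₁ {n : ℕ} (f : PRSym 1) (g : PRSym n) (a : Fin n → D) :
    (PRSym.app₁ f g).ev a = f.ev ![g.ev a] := ev_comp₁ f g a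

theorem ev_app₂ {n : ℕ} (f : PRSym 2) (g h : PRSym n) (a : Fin n → D) :
    (PRSym.app₂ f g h).ev a = f.ev ![g.ev a, h.ev a] := by
  rw [PRSym.app₂, ev_comp]
  congr 1
  funext i
  fin_cases i <;> rfl

@[simp] theorem ev_app₁_succ {n : ℕ} (g : PRSym n) (a : Fin n → D) :
    (PRSym.app₁ .succ g).ev a = suc (g.ev a) := ev_app₁ _ g a

@[simp] theorem ev_app₁_predS {n : ℕ} (g : PRSym n) (a : Fin n → D) :
    (PRSym.app₁ PRSym.predS g).ev a = prd (g.ev a) := ev_app₁ _ g a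

@[simp] theorem ev_add {n : ℕ} (g h : PRSym n) (a : Fin n → D) :
    (g + h).ev a = g.ev a + h.ev a := ev_app₂ _ g h a

@[simp] theorem ev_mul {n : ℕ} (g h : PRSym n) (a : Fin n → D) :
    (g * h).ev a = g.ev a * h.ev a := ev_app₂ _ g h a

@[simp] theorem ev_sub {n : ℕ} (g h : PRSym n) (a : Fin n → D) :
    (g - h).ev a = g.ev a - h.ev a := ev_app₂ _ g h a

@[simp] theorem ev_num {n : ℕ} (k : ℕ) (a : Fin n → D) : (PRSym.num k).ev a = nm k := by
  induction k with
  | zero => rw [PRSym.num, ev_comp, ev_zero, nm]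
  | succ k ih => rw [PRSym.num, ev_app₁_succ, ih, nm]

theorem ev_recR_zero (f : PRSym 1) (g : PRSym 3) (x : D) :
    (PRSym.recR f g).ev ![x, 0] = f.ev ![x] := by
  rw [PRSym.recR, ev_app₂, ev_proj_apply, ev_proj_apply]
  exact ev_prec_zero f g ![x]

theorem ev_recR_suc (f : PRSym 1) (g : PRSym 3) (x y : D) :
    (PRSym.recR f g).ev ![x, suc y] = g.ev ![y, (PRSym.recR f g).ev ![x, y], x] := by
  simp only [PRSym.recR, ev_app₂, ev_proj_apply]
  exact ev_prec_suc f g y ![x]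

theorem pra_add_zero (x : D) : x + 0 = x :=
  (ev_recR_zero _ _ _).trans (ev_proj_apply _ _)

theorem add_suc (x y : D) : x + suc y = suc (x + y) :=
  (ev_recR_suc _ _ _ _).trans (ev_app₁_succ _ _ |>.trans (by rw [ev_proj_apply]; rfl))

theorem prd_zero : prd (0 : D) = 0 := (ev_prec_zero _ _ ![]).trans (ev_zero _)

theorem prd_suc (x : D) : prd (suc x) = x := (ev_prec_suc _ _ x ![]).trans (ev_proj_apply _ _)

theorem pra_mul_zero (x : D) : x * 0 = 0 :=
  (ev_recR_zero _ _ _).trans (ev_num 0 _)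

theorem mul_suc (x y : D) : x * suc y = x * y + x := by
  refine (ev_recR_suc _ _ _ _).trans ?_
  rw [ev_app₂, ev_proj_apply, ev_proj_apply]
  rfl

theorem sub_zero' (x : D) : x - 0 = x := (ev_recR_zero _ _ _).trans (ev_proj_apply _ _)

theorem sub_suc (x y : D) : x - suc y = prd (x - y) :=
  (ev_recR_suc _ _ _ _).trans (ev_app₁_predS _ _ |>.trans (by rw [ev_proj_apply]; rfl))

theorem zero_or_suc (x : D) : x = 0 ∨ ∃ y, x = suc y := by
  have : x = 0 ∨ x = suc (prd x) := by
    refine ind (P := fun x => x = 0 ∨ x = suc (prd x)) (.or (.eq .id (.const _))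
      (.eq .id (.suc (.prd .id)))) (Or.inl rfl) (fun x _ => Or.inr ?_) x
    rw [prd_suc]
  exact this.imp id fun h => ⟨_, h⟩

theorem pra_zero_add (x : D) : 0 + x = x := by
  refine ind (P := fun x : D => (0 : D) + x = x) (.eq (.add (.const _) .id) .id) (pra_add_zero _)
    (fun x h => ?_) x
  rw [add_suc, h]

theorem suc_add (x y : D) : suc x + y = suc (x + y) := by
  refine ind (P := fun y => suc x + y = suc (x + y)) (.eq (.add (.const _) .id)
    (.suc (.add (.const _) .id))) (by rw [pra_add_zero, pra_add_zero]) (fun y h => ?_) y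
  rw [add_suc, h, add_suc]

theorem pra_add_comm (x y : D) : x + y = y + x := by
  refine ind (P := fun y => x + y = y + x) (.eq (.add (.const _) .id) (.add .id (.const _)))
    (by rw [pra_add_zero, pra_zero_add]) (fun y h => ?_) y
  rw [add_suc, h, suc_add]

theorem pra_add_assoc (x y z : D) : x + y + z = x + (y + z) := by
  refine ind (P := fun z => x + y + z = x + (y + z)) (.eq (.add (.const _) .id)
    (.add (.const _) (.add (.const _) .id))) (by rw [pra_add_zero, pra_add_zero])
    (fun y h => ?_) z
  rw [add_suc, h, add_suc, add_suc]

theorem pra_add_right_cancel (x y z : D) : x + z = y + z → x = y := by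
  refine ind (P := fun z => x + z = y + z → x = y) (.imp (.eq (.add (.const _) .id)
    (.add (.const _) .id)) (.eq (.const _) (.const _))) (by rw [pra_add_zero, pra_add_zero]; exact id)
    (fun z h h' => ?_) z
  rw [add_suc, add_suc] at h'
  exact h (suc_inj h')

/-- Together with the order and subtraction instances below, this makes the general theory of
canonically ordered cancellative monoids with truncated subtraction available at every node. -/
instance (priority := 10) praAddCancelCommMonoid : AddCancelCommMonoid D where
  add := (· + ·)
  zero := 0
  add_assoc := pra_add_assoc
  zero_add := pra_zero_add
  add_zero := pra_add_zero
  add_comm := pra_add_comm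
  nsmul := nsmulRec
  add_left_cancel x y z h := by
    refine pra_add_right_cancel y z x ?_
    rw [pra_add_comm y, pra_add_comm z]
    exact h

theorem suc_eq_add (x : D) : suc x = x + suc 0 := by rw [add_suc, pra_add_zero]

theorem pra_add_eq_zero {x y : D} : x + y = 0 ↔ x = 0 ∧ y = 0 := by
  refine ⟨fun h => ?_, fun h => by rw [h.1, h.2, pra_add_zero]⟩
  rcases zero_or_suc y with rfl | ⟨y, rfl⟩
  · exact ⟨by rwa [pra_add_zero] at h, rfl⟩
  · rw [add_suc] at h
    exact (suc_ne_zero _ h).elim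

theorem pra_mul_eq_zero {x y : D} : x * y = 0 ↔ x = 0 ∨ y = 0 := by
  rcases zero_or_suc y with rfl | ⟨y, rfl⟩
  · simp [pra_mul_zero]
  · rw [mul_suc, pra_add_eq_zero]
    refine ⟨fun h => Or.inl h.2, fun h => ?_⟩
    rcases h with rfl | h
    · refine ⟨?_, rfl⟩
      refine ind (P := fun y => (0 : D) * y = 0) (.eq (.mul (.const _) .id) (.const _))
        (pra_mul_zero _) (fun y h => ?_) y
      rw [mul_suc, h, pra_add_zero]
    · exact (suc_ne_zero _ h).elim

theorem suc_sub_suc (x y : D) : suc x - suc y = x - y := by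
  refine ind (P := fun y => suc x - suc y = x - y) (.eq (.sub (.const _) (.suc .id))
    (.sub (.const _) .id)) (by rw [sub_suc, sub_zero', prd_suc, sub_zero']) (fun y h => ?_) y
  rw [sub_suc, h, sub_suc]

theorem zero_sub' (x : D) : 0 - x = 0 := by
  refine ind (P := fun x => 0 - x = 0) (.eq (.sub (.const _) .id) (.const _)) (sub_zero' _)
    (fun x h => ?_) x
  rw [sub_suc, h, prd_zero]

theorem pra_add_sub_cancel (x y : D) : x + y - y = x := by
  refine ind (P := fun y => x + y - y = x) (.eq (.sub (.add (.const _) .id) .id) (.const _))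
    (by rw [sub_zero', pra_add_zero]) (fun y h => ?_) y
  rw [add_suc, suc_sub_suc, h]

theorem sub_add_self (x y : D) : x - (y + x) = 0 := by
  refine ind (P := fun x => x - (y + x) = 0) (.eq (.sub .id (.add (.const _) .id)) (.const _))
    (zero_sub' _) (fun x h => ?_) x
  rw [add_suc, suc_sub_suc, h]

/-- Comparability by open induction: truncated subtraction supplies the difference in one direction
or the other. The linear order is built on this. -/
theorem add_sub_or (x y : D) : x + (y - x) = y ∨ y + (x - y) = x ∧ y - x = 0 := by
  refine ind (P := fun y => x + (y - x) = y ∨ y + (x - y) = x ∧ y - x = 0)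
    (.or (.eq (.add (.const _) (.sub .id (.const _))) .id) (.and (.eq (.add .id (.sub (.const _) .id))
      (.const _)) (.eq (.sub .id (.const _)) (.const _)))) (Or.inr ⟨by rw [sub_zero', pra_zero_add], zero_sub' _⟩)
    (fun y h => ?_) y
  rcases h with h | ⟨h, h'⟩
  · left
    have : y = y - x + x := by rw [pra_add_comm, h]
    have h₂ : suc y = suc (y - x) + x := by rw [suc_add, ← this]
    rw [h₂, pra_add_sub_cancel, pra_add_comm]
  · rcases zero_or_suc (x - y) with h₀ | ⟨z, hz⟩
    · rw [h₀, pra_add_zero] at h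
      left
      rw [h, suc_eq_add, pra_add_comm x (suc 0), pra_add_sub_cancel, pra_add_comm]
    · right
      rw [hz, add_suc] at h
      rw [sub_suc, hz, prd_suc, suc_add]
      refine ⟨h, ?_⟩
      rw [← h, pra_add_comm, ← add_suc]
      exact sub_add_self (suc y) z

theorem exists_add_of_sub_eq_zero {x y : D} (h : x - y = 0) : ∃ z, x + z = y := by
  rcases add_sub_or x y with h' | ⟨h', -⟩
  · exact ⟨_, h'⟩
  · rw [h, pra_add_zero] at h'
    exact ⟨0, by rw [pra_add_zero, h']⟩

noncomputable instance (priority := 10) praLinearOrder : LinearOrder D where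
  le x y := ∃ z, x + z = y
  le_refl x := ⟨0, pra_add_zero x⟩
  le_trans := by
    rintro x _ _ ⟨z, rfl⟩ ⟨z', rfl⟩
    exact ⟨z + z', (pra_add_assoc _ _ _).symm⟩
  le_antisymm := by
    rintro x _ ⟨z, rfl⟩ ⟨z', h⟩
    rw [pra_add_assoc] at h
    have h₂ : z + z' = 0 := by
      apply pra_add_right_cancel _ _ x
      rw [pra_add_comm, h, pra_zero_add]
    rw [(pra_add_eq_zero.1 h₂).1, pra_add_zero]
  le_total x y := by
    rcases add_sub_or x y with h | h
    · exact Or.inl ⟨_, h⟩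
    · exact Or.inr ⟨_, h.1⟩
  toDecidableLE := Classical.decRel _

theorem sub_eq_zero_iff {x y : D} : x - y = 0 ↔ x ≤ y :=
  ⟨exists_add_of_sub_eq_zero, fun ⟨z, hz⟩ => by rw [← hz, pra_add_comm, sub_add_self]⟩

instance (priority := 10) praIsOrderedAddMonoid : IsOrderedAddMonoid D where
  add_le_add_left := by
    rintro x _ ⟨z, rfl⟩ y
    exact ⟨z, by abel⟩

instance (priority := 10) praCanonicallyOrderedAdd : CanonicallyOrderedAdd D where
  exists_add_of_le := by
    rintro x _ ⟨z, rfl⟩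
    exact ⟨z, rfl⟩
  le_self_add x y := ⟨y, rfl⟩
  le_add_self x y := ⟨y, pra_add_comm _ _⟩

instance (priority := 10) praOrderedSub : OrderedSub D where
  tsub_le_iff_right x y z := by
    rcases le_total y x with ⟨w, rfl⟩ | h
    · rw [pra_add_comm y, pra_add_sub_cancel]
      exact (add_le_add_iff_right y).symm
    · rw [sub_eq_zero_iff.2 h]
      exact ⟨fun _ => h.trans ⟨z, pra_add_comm _ _⟩, fun _ => ⟨z, pra_zero_add z⟩⟩

theorem OpenPred.le {f g : D → D} (hf : OpenFun f) (hg : OpenFun g) :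
    OpenPred fun x => f x ≤ g x := by
  have := OpenPred.eq (hf.sub hg) (.const 0)
  simpa only [sub_eq_zero_iff] using this

theorem OpenPred.lt {f g : D → D} (hf : OpenFun f) (hg : OpenFun g) :
    OpenPred fun x => f x < g x := by
  have := OpenPred.not (OpenPred.le hg hf)
  simpa only [not_le] using this

theorem lt_suc_self (x : D) : x < suc x := by
  refine lt_of_le_of_ne ⟨suc 0, (suc_eq_add x).symm⟩ fun h => ?_
  have : x + 0 = x + suc 0 := by rw [← suc_eq_add, pra_add_zero]; exact h
  exact suc_ne_zero _ (add_left_cancel this).symm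

theorem suc_le_iff {x y : D} : suc x ≤ y ↔ x < y := by
  refine ⟨fun h => (lt_suc_self x).trans_le h, fun h => ?_⟩
  obtain ⟨z, rfl⟩ := h.le
  rcases zero_or_suc z with rfl | ⟨z, rfl⟩
  · rw [pra_add_zero] at h
    exact (lt_irrefl _ h).elim
  · exact ⟨z, by rw [suc_add, add_suc]⟩

theorem lt_suc_iff {x y : D} : x < suc y ↔ x ≤ y := by
  rw [← suc_le_iff]
  refine ⟨fun ⟨z, hz⟩ => ⟨z, ?_⟩, fun ⟨z, hz⟩ => ⟨z, ?_⟩⟩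
  · rw [suc_add] at hz
    exact suc_inj hz
  · rw [suc_add, hz]

theorem eqn_eq_zero {x y : D} : x - y + (y - x) = 0 ↔ x = y := by
  rw [pra_add_eq_zero, sub_eq_zero_iff, sub_eq_zero_iff]
  exact ⟨fun h => le_antisymm h.1 h.2, fun h => ⟨h.le, h.ge⟩⟩

theorem ev_eqn {n : ℕ} (g h : PRSym n) (a : Fin n → D) :
    (PRSym.eqn g h).ev a = g.ev a - h.ev a + (h.ev a - g.ev a) := by
  simp [PRSym.eqn]

theorem nm_injective : Function.Injective (nm : ℕ → D) := by
  intro i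
  induction i with
  | zero =>
    rintro (_ | j) h
    · rfl
    · exact (suc_ne_zero _ h.symm).elim
  | succ i ih =>
    rintro (_ | j) h
    · exact (suc_ne_zero _ h).elim
    · rw [ih (suc_inj h)]

/-! ### Pairing -/

/-- The triangular numbers. -/
def tri (x : D) : D := PRSym.triS.ev ![x]

theorem tri_zero : tri (0 : D) = 0 := (ev_prec_zero _ _ ![]).trans (ev_zero _)

theorem tri_suc (x : D) : tri (suc x) = tri x + suc x := by
  refine (ev_prec_suc _ _ x ![]).trans ?_
  simp
  rfl

/-- The index of the diagonal. -/
def dia (x : D) : D := PRSym.diagS.ev ![x]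

theorem dia_zero : dia (0 : D) = 0 := (ev_prec_zero _ _ ![]).trans (ev_zero _)

theorem dia_suc (x : D) : dia (suc x) = dia x +
    (nm 1 - (tri (suc (dia x)) - suc x + (suc x - tri (suc (dia x))))) := by
  refine (ev_prec_suc _ _ x ![]).trans ?_
  simp [ev_eqn, ev_app₁]
  rfl

theorem le_tri (x : D) : x ≤ tri x := by
  refine ind (P := fun x => x ≤ tri x) (.le .id (.ev₁ .id _)) (by rw [tri_zero]) (fun x _ => ?_) x
  rw [tri_suc]
  exact le_add_self

theorem tri_mono {x y : D} (h : x ≤ y) : tri x ≤ tri y := by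
  obtain ⟨z, rfl⟩ := h
  refine ind (P := fun z => tri x ≤ tri (x + z)) (.le (.const _) (.ev₁ (.add (.const _) .id) _))
    (by rw [pra_add_zero]) (fun z h => ?_) z
  rw [add_suc, tri_suc]
  exact h.trans le_self_add

/-- Each number lies on exactly one diagonal, that is, between two consecutive triangular numbers.
Both projections of the pairing are computed from the index of that diagonal. -/
theorem dia_spec (x : D) : tri (dia x) ≤ x ∧ x < tri (suc (dia x)) := by
  refine ind (P := fun x => tri (dia x) ≤ x ∧ x < tri (suc (dia x)))
    (.and (.le (.ev₁ (.ev₁ .id _) _) .id) (.lt .id (.ev₁ (.suc (.ev₁ .id _)) _)))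
    ⟨by rw [dia_zero, tri_zero], ?_⟩ (fun x h => ?_) x
  · rw [dia_zero, tri_suc, tri_zero, pra_zero_add]
    exact lt_suc_self 0
  -- The index increases exactly when `suc x` is the first number of the next diagonal; the factor
  -- `1 ∸ eqn` in `diagS` tests this.
  · by_cases e : tri (suc (dia x)) = suc x
    · have : dia (suc x) = suc (dia x) := by
        rw [dia_suc, eqn_eq_zero.2 e, sub_zero', nm, nm, ← suc_eq_add]
      rw [this, tri_suc (suc _), e]
      refine ⟨le_rfl, ?_⟩
      rw [add_suc]
      exact lt_suc_iff.2 le_self_add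
    · have : dia (suc x) = dia x := by
        rw [dia_suc]
        rcases zero_or_suc (tri (suc (dia x)) - suc x + (suc x - tri (suc (dia x)))) with h | ⟨z, h⟩
        · exact (e (eqn_eq_zero.1 h)).elim
        · rw [h, nm, nm, suc_sub_suc, zero_sub', pra_add_zero]
      rw [this]
      exact ⟨h.1.trans (lt_suc_self x).le, lt_of_le_of_ne (suc_le_iff.2 h.2) (Ne.symm e)⟩

theorem dia_unique {x y : D} (h₁ : tri y ≤ x) (h₂ : x < tri (suc y)) : dia x = y := by
  obtain ⟨h₃, h₄⟩ := dia_spec x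
  rcases lt_trichotomy (dia x) y with h | h | h
  · exact (lt_irrefl _ ((h₄.trans_le (tri_mono (suc_le_iff.2 h))).trans_le h₁)).elim
  · exact h
  · exact (lt_irrefl _ ((h₂.trans_le (tri_mono (suc_le_iff.2 h))).trans_le h₃)).elim

/-- Cantor's pairing function. -/
def pr (x y : D) : D := tri (x + y) + y

def p1 (x : D) : D := PRSym.fstS.ev ![x]

def p2 (x : D) : D := PRSym.sndS.ev ![x]

theorem p2_eq (x : D) : p2 x = x - tri (dia x) := by
  simp [p2, PRSym.sndS, ev_app₁, tri, dia]

theorem p1_eq (x : D) : p1 x = dia x - p2 x := by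
  simp [p1, p2, PRSym.fstS, dia]

@[simp] theorem ev_pair {n : ℕ} (g h : PRSym n) (a : Fin n → D) :
    (PRSym.pair g h).ev a = pr (g.ev a) (h.ev a) := by
  simp [PRSym.pair, ev_app₁, pr, tri]

@[simp] theorem ev_fst {n : ℕ} (g : PRSym n) (a : Fin n → D) :
    (PRSym.fst g).ev a = p1 (g.ev a) := by
  rw [PRSym.fst, ev_app₁, p1]

@[simp] theorem ev_snd {n : ℕ} (g : PRSym n) (a : Fin n → D) :
    (PRSym.snd g).ev a = p2 (g.ev a) := by
  rw [PRSym.snd, ev_app₁, p2]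

theorem dia_pr (x y : D) : dia (pr x y) = x + y := by
  refine dia_unique le_self_add ?_
  rw [tri_suc, pr]
  refine (add_lt_add_iff_left _).2 (lt_suc_iff.2 le_add_self)

@[simp] theorem p2_pr (x y : D) : p2 (pr x y) = y := by
  rw [p2_eq, dia_pr, pr, add_tsub_cancel_left]

@[simp] theorem p1_pr (x y : D) : p1 (pr x y) = x := by
  rw [p1_eq, dia_pr, p2_pr, add_tsub_cancel_right]

@[simp] theorem pr_p1_p2 (x : D) : pr (p1 x) (p2 x) = x := by
  obtain ⟨h₁, h₂⟩ := dia_spec x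
  have h₃ : p2 x ≤ dia x := by
    rw [p2_eq, tsub_le_iff_left, ← lt_suc_iff, ← add_suc, ← tri_suc]
    exact h₂
  have h₄ : p1 x + p2 x = dia x := by rw [p1_eq, tsub_add_cancel_of_le h₃]
  rw [pr, h₄, p2_eq, add_tsub_cancel_of_le h₁]

theorem p2_le (x : D) : p2 x ≤ x := by
  rw [p2_eq]
  exact tsub_le_self

theorem p1_le (x : D) : p1 x ≤ x := by
  rw [p1_eq]
  exact tsub_le_self.trans ((le_tri _).trans (dia_spec x).1)

end Arithmetic

/-! ### Computations -/

section Computation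

variable {D : Type*} [LPR.Structure D] [IsPRA D]

open IsPRA

theorem p2_zero : p2 (0 : D) = 0 := le_antisymm (p2_le 0) zero_le

/-- The list of the values `c(n - 1), …, c(0)` of a course-of-values recursion. -/
def tab (F : PRSym 2) (x : D) : D := (PRSym.table F).ev ![x]

theorem tab_zero (F : PRSym 2) : tab F (0 : D) = 0 := (ev_prec_zero _ _ ![]).trans (ev_zero _)

theorem tab_suc (F : PRSym 2) (x : D) :
    tab F (suc x) = suc (pr (F.ev ![x, tab F x]) (tab F x)) := by
  refine (ev_prec_suc _ _ x ![]).trans ?_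
  simp [ev_app₂]
  rfl

/-- Each drop removes the latest value. Dropping more entries than there are is harmless, since the
empty list is `0` and its tail is again `0`, in accordance with truncated subtraction. -/
theorem drop_tab (F : PRSym 2) (j x : D) : PRSym.dropS.ev ![j, tab F x] = tab F (x - j) := by
  refine ind (P := fun j => PRSym.dropS.ev ![j, tab F x] = tab F (x - j))
    (.eq (.ev₂ .id (.const _) _) (.ev₁ (.sub (.const _) .id) _)) ?_ (fun j h => ?_) j
  · rw [sub_zero']
    exact (ev_prec_zero _ _ ![_]).trans (ev_proj_apply _ _)
  · refine (ev_prec_suc _ _ j ![_]).trans ?_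
    have h' : (PRSym.prec (PRSym.proj 0) (PRSym.snd (PRSym.app₁ PRSym.predS (PRSym.proj 1)))).ev
      (Fin.cons j ![tab F x]) = tab F (x - j) := h
    simp only [ev_snd, ev_app₁_predS, ev_proj_apply]
    change p2 (prd ((PRSym.prec (PRSym.proj 0) (PRSym.snd (PRSym.app₁ PRSym.predS
      (PRSym.proj 1)))).ev (Fin.cons j ![tab F x]))) = _
    rw [h', sub_suc]
    rcases zero_or_suc (x - j) with h₀ | ⟨z, hz⟩
    · rw [h₀, prd_zero, tab_zero, prd_zero, p2_zero]
    · rw [hz, prd_suc, tab_suc, prd_suc, p2_pr]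

/-- The list is in decreasing order, so the value at k < n stands behind n ∸ 1 ∸ k entries; dropping
these leaves the table of length k + 1, headed by the value at k. -/
theorem ev_look_tab {m : ℕ} (F : PRSym 2) (n l k : PRSym m) (a : Fin m → D)
    (hl : l.ev a = tab F (n.ev a)) (hk : k.ev a < n.ev a) :
    (PRSym.look n l k).ev a = F.ev ![k.ev a, tab F (k.ev a)] := by
  simp only [PRSym.look, ev_fst, ev_app₁_predS, ev_app₂, ev_sub, ev_num, hl, drop_tab]
  obtain ⟨z, hz⟩ := suc_le_iff.2 hk
  have h₁ : n.ev a - nm 1 - k.ev a = z := by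
    rw [← hz, suc_add, nm, nm, suc_sub_suc, sub_zero', add_tsub_cancel_left]
  rw [h₁, ← hz, add_tsub_cancel_right, tab_suc, prd_suc, p1_pr]

/-- The number `u` codes a valid computation tree. -/
def Valid (u : D) : Prop := PRSym.validS.ev ![u] = 0

theorem validS_ev (x : D) :
    PRSym.validS.ev ![x] = PRSym.validBody.ev ![x, tab PRSym.validBody x] := by
  rw [PRSym.validS, PRSym.courseOfValues, ev_app₂, ev_proj_apply]
  rfl

/-- The program at the root of a tree. -/
def tidx (w : D) : D := p1 (prd w)

/-- The input at the root of a tree. -/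
def tinp (w : D) : D := p1 (p2 (prd w))

/-- The output at the root of a tree. -/
def tout (w : D) : D := p1 (p2 (p2 (prd w)))

/-- The tree `w` is a computation of the program `e` at the input `x`. -/
def IsComp (e x w : D) : Prop := Valid w ∧ tidx w = e ∧ tinp w = x

/-- The tree with the given root and immediate subtrees. -/
def node (e x y l r : D) : D := suc (pr e (pr x (pr y (pr l r))))

@[simp] theorem tidx_node (e x y l r : D) : tidx (node e x y l r) = e := by
  simp [tidx, node, prd_suc]

@[simp] theorem tinp_node (e x y l r : D) : tinp (node e x y l r) = x := by
  simp [tinp, node, prd_suc]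

@[simp] theorem tout_node (e x y l r : D) : tout (node e x y l r) = y := by
  simp [tout, node, prd_suc]

theorem exists_node {u : D} (h : u ≠ 0) : ∃ l r, u = node (tidx u) (tinp u) (tout u) l r := by
  rcases zero_or_suc u with rfl | ⟨u, rfl⟩
  · exact (h rfl).elim
  · refine ⟨p1 (p2 (p2 (p2 u))), p2 (p2 (p2 (p2 u))), ?_⟩
    simp [tidx, tinp, tout, node, prd_suc]

theorem left_lt_node (e x y l r : D) : l < node e x y l r := by
  rw [node, lt_suc_iff]
  calc l = p1 (p2 (p2 (p2 (pr e (pr x (pr y (pr l r))))))) := by simp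
    _ ≤ _ := (p1_le _).trans ((p2_le _).trans ((p2_le _).trans (p2_le _)))

theorem right_lt_node (e x y l r : D) : r < node e x y l r := by
  rw [node, lt_suc_iff]
  calc r = p2 (p2 (p2 (p2 (pr e (pr x (pr y (pr l r))))))) := by simp
    _ ≤ _ := (p2_le _).trans ((p2_le _).trans ((p2_le _).trans (p2_le _)))

theorem ev_eqn_eq_zero {n : ℕ} (f g : PRSym n) (a : Fin n → D) :
    (PRSym.eqn f g).ev a = 0 ↔ f.ev a = g.ev a := by
  rw [ev_eqn, eqn_eq_zero]

theorem ev_subOK (w e x : PRSym 2) (u : D) (hw : w.ev ![u, tab PRSym.validBody u] < u) :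
    (PRSym.subOK w e x).ev ![u, tab PRSym.validBody u] = 0 ↔
      IsComp (e.ev ![u, tab PRSym.validBody u]) (x.ev ![u, tab PRSym.validBody u])
        (w.ev ![u, tab PRSym.validBody u]) := by
  simp only [PRSym.subOK, ev_add, pra_add_eq_zero, ev_eqn_eq_zero]
  rw [ev_look_tab PRSym.validBody _ _ _ _ (by rw [ev_proj_apply, ev_proj_apply]; rfl)
    (by rw [ev_proj_apply]; exact hw), IsComp, Valid, validS_ev]
  simp only [PRSym.idx, PRSym.inp, ev_fst, ev_snd, ev_app₁_predS, tidx, tinp, and_assoc]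

theorem not_valid_zero : ¬ Valid (0 : D) := by
  intro h
  rw [Valid, validS_ev, PRSym.validBody] at h
  simp only [ev_add, ev_sub, ev_num, ev_proj_apply] at h
  have := (pra_add_eq_zero.1 h).1
  rw [Matrix.cons_val_zero, sub_zero', nm, nm] at this
  exact suc_ne_zero _ this

/-- The arithmetized clauses are unfolded: a sum is zero iff all summands are, a product iff some
factor is, and `1 ∸ z` iff z is not. The subtrees are smaller than the tree, so the table of the
course-of-values recursion already contains their validity. -/
theorem valid_node_iff (e x y l r : D) : Valid (node e x y l r) ↔
    (p1 e = nm 0 ∧ y = 0 ∧ l = 0 ∧ r = 0) ∨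
    (p1 e = nm 1 ∧ y = suc x ∧ l = 0 ∧ r = 0) ∨
    (p1 e = nm 2 ∧ y = p1 x ∧ l = 0 ∧ r = 0) ∨
    (p1 e = nm 3 ∧ y = p2 x ∧ l = 0 ∧ r = 0) ∨
    (p1 e = nm 4 ∧ IsComp (p1 (p2 e)) x l ∧ IsComp (p2 (p2 e)) x r ∧ y = pr (tout l) (tout r)) ∨
    (p1 e = nm 5 ∧ IsComp (p2 (p2 e)) x l ∧ IsComp (p1 (p2 e)) (tout l) r ∧ y = tout r) ∨
    (p1 e = nm 6 ∧ ((p2 x = 0 ∧ IsComp (p1 (p2 e)) (p1 x) l ∧ y = tout l ∧ r = 0) ∨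
      (p2 x ≠ 0 ∧ IsComp e (pr (p1 x) (prd (p2 x))) l ∧
        IsComp (p2 (p2 e)) (pr (p1 x) (pr (prd (p2 x)) (tout l))) r ∧ y = tout r))) ∨
    (p1 e = nm 7 ∧ IsComp (p1 (p2 e)) x l ∧ ((tout l = 0 ∧ y = p2 x ∧ r = 0) ∨
      (tout l ≠ 0 ∧ IsComp e (pr (p1 x) (suc (p2 x))) r ∧ y = tout r))) := by
  set u := node e x y l r with hu
  set h := tab PRSym.validBody u with hh
  have one_sub : ∀ z : D, nm 1 - z = 0 ↔ z ≠ 0 := by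
    intro z
    rcases zero_or_suc z with rfl | ⟨z, rfl⟩
    · simp only [sub_zero', nm, suc_ne_zero, ne_eq, not_true]
    · simp only [nm, suc_sub_suc, zero_sub', suc_ne_zero, ne_eq, not_false_eq_true]
  have sub_one : ∀ z : D, z - nm 1 = prd z := by
    intro z
    rw [nm, nm, sub_suc, sub_zero']
  have add_one : ∀ z : D, z + nm 1 = suc z := by
    intro z
    rw [nm, nm, ← suc_eq_add]
  have hv : (PRSym.proj 0 : PRSym 2).ev ![u, h] = u := ev_proj_apply _ _
  have he : (PRSym.idx (PRSym.proj 0) : PRSym 2).ev ![u, h] = e := by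
    simp [PRSym.idx, hu, node, prd_suc]
  have hx : (PRSym.inp (PRSym.proj 0) : PRSym 2).ev ![u, h] = x := by
    simp [PRSym.inp, hu, node, prd_suc]
  have hy : (PRSym.out (PRSym.proj 0) : PRSym 2).ev ![u, h] = y := by
    simp [PRSym.out, hu, node, prd_suc]
  have hl : (PRSym.lft (PRSym.proj 0) : PRSym 2).ev ![u, h] = l := by
    simp [PRSym.lft, hu, node, prd_suc]
  have hr : (PRSym.rgt (PRSym.proj 0) : PRSym 2).ev ![u, h] = r := by
    simp [PRSym.rgt, hu, node, prd_suc]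
  have ho : ∀ g : PRSym 2, (PRSym.out g).ev ![u, h] = tout (g.ev ![u, h]) := by
    intro g
    simp [PRSym.out, tout]
  have hu0 : u ≠ 0 := suc_ne_zero _
  have sl : ∀ f g : PRSym 2, (PRSym.subOK (PRSym.lft (PRSym.proj 0)) f g).ev ![u, h] = 0 ↔
      IsComp (f.ev ![u, h]) (g.ev ![u, h]) l := by
    intro f g
    rw [hh, ev_subOK _ _ _ _ (by rw [← hh, hl]; exact left_lt_node _ _ _ _ _), ← hh, hl]
  have sr : ∀ f g : PRSym 2, (PRSym.subOK (PRSym.rgt (PRSym.proj 0)) f g).ev ![u, h] = 0 ↔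
      IsComp (f.ev ![u, h]) (g.ev ![u, h]) r := by
    intro f g
    rw [hh, ev_subOK _ _ _ _ (by rw [← hh, hr]; exact right_lt_node _ _ _ _ _), ← hh, hr]
  rw [Valid, validS_ev, ← hh, PRSym.validBody]
  simp only [ev_add, ev_mul, pra_mul_eq_zero, pra_add_eq_zero, ev_sub, ev_num, one_sub, sl, sr, he,
    hx, hy, hl, hr, hv, ho, ev_fst, ev_snd, ev_pair, ev_eqn_eq_zero, sub_one, add_one,
    and_assoc, or_assoc]
  simp only [ne_eq, hu0, not_false_eq_true, true_and]

/-- `{e}(x) = y`. -/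
def App (e x y : D) : Prop := ∃ u, IsComp e x u ∧ tout u = y

theorem ev_kleeneT (e x u : D) : PRSym.kleeneT.ev ![e, x, u] = 0 ↔ IsComp e x u := by
  simp only [PRSym.kleeneT, ev_add, ev_eqn_eq_zero, ev_app₁, ev_proj_apply, pra_add_eq_zero,
     PRSym.idx, PRSym.inp, ev_fst, ev_snd, IsComp, Valid,
    and_assoc]
  rfl

theorem ev_kleeneU (u : D) : PRSym.kleeneU.ev ![u] = tout u := by
  simp [PRSym.kleeneU, PRSym.out, tout]

/-! #### Program constructors -/

def cZero : D := pr (nm 0) (pr 0 0)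
def cSucc : D := pr (nm 1) (pr 0 0)
def cFst : D := pr (nm 2) (pr 0 0)
def cSnd : D := pr (nm 3) (pr 0 0)
def cPair (f g : D) : D := pr (nm 4) (pr f g)
def cComp (f g : D) : D := pr (nm 5) (pr f g)
def cRec (f g : D) : D := pr (nm 6) (pr f g)
def cMu (f : D) : D := pr (nm 7) (pr f 0)

theorem isComp_node {e x y l r : D} : IsComp e x (node e x y l r) ↔ Valid (node e x y l r) := by
  simp [IsComp]

theorem App.zero (x : D) : App cZero x 0 := by
  refine ⟨node cZero x 0 0 0, ?_, tout_node _ _ _ _ _⟩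
  rw [isComp_node, valid_node_iff]
  simp [cZero]

theorem App.succ (x : D) : App cSucc x (suc x) := by
  refine ⟨node cSucc x (suc x) 0 0, ?_, tout_node _ _ _ _ _⟩
  rw [isComp_node, valid_node_iff]
  simp [cSucc]

theorem App.fst (x : D) : App cFst x (p1 x) := by
  refine ⟨node cFst x (p1 x) 0 0, ?_, tout_node _ _ _ _ _⟩
  rw [isComp_node, valid_node_iff]
  simp [cFst]

theorem App.snd (x : D) : App cSnd x (p2 x) := by
  refine ⟨node cSnd x (p2 x) 0 0, ?_, tout_node _ _ _ _ _⟩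
  rw [isComp_node, valid_node_iff]
  simp [cSnd]

theorem App.pair {f g x y z : D} (hf : App f x y) (hg : App g x z) :
    App (cPair f g) x (pr y z) := by
  obtain ⟨l, hl, rfl⟩ := hf
  obtain ⟨r, hr, rfl⟩ := hg
  refine ⟨node (cPair f g) x (pr (tout l) (tout r)) l r, ?_, tout_node _ _ _ _ _⟩
  rw [isComp_node, valid_node_iff]
  simp [cPair, hl, hr]

theorem App.comp {f g x y z : D} (hg : App g x y) (hf : App f y z) : App (cComp f g) x z := by
  obtain ⟨l, hl, rfl⟩ := hg
  obtain ⟨r, hr, rfl⟩ := hf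
  refine ⟨node (cComp f g) x (tout r) l r, ?_, tout_node _ _ _ _ _⟩
  rw [isComp_node, valid_node_iff]
  simp [cComp, hl, hr]

theorem App.rec_zero {f g a y : D} (hf : App f a y) : App (cRec f g) (pr a 0) y := by
  obtain ⟨l, hl, rfl⟩ := hf
  refine ⟨node (cRec f g) (pr a 0) (tout l) l 0, ?_, tout_node _ _ _ _ _⟩
  rw [isComp_node, valid_node_iff]
  simp [cRec, hl]

theorem App.rec_suc {f g a m y z : D} (hr : App (cRec f g) (pr a m) y)
    (hg : App g (pr a (pr m y)) z) : App (cRec f g) (pr a (suc m)) z := by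
  obtain ⟨l, hl, rfl⟩ := hr
  obtain ⟨r, hr, rfl⟩ := hg
  refine ⟨node (cRec f g) (pr a (suc m)) (tout r) l r, ?_, tout_node _ _ _ _ _⟩
  rw [isComp_node, valid_node_iff]
  rw [cRec] at hl
  simp [cRec, hl, hr, prd_suc, suc_ne_zero]

theorem App.mu_zero {f a m : D} (hf : App f (pr a m) 0) : App (cMu f) (pr a m) m := by
  obtain ⟨l, hl, h₀⟩ := hf
  refine ⟨node (cMu f) (pr a m) m l 0, ?_, tout_node _ _ _ _ _⟩
  rw [isComp_node, valid_node_iff]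
  simp [cMu, hl, h₀]

theorem App.mu_suc {f a m y z : D} (hf : App f (pr a m) y) (hy : y ≠ 0)
    (hz : App (cMu f) (pr a (suc m)) z) : App (cMu f) (pr a m) z := by
  obtain ⟨l, hl, rfl⟩ := hf
  obtain ⟨r, hr, rfl⟩ := hz
  refine ⟨node (cMu f) (pr a m) (tout r) l r, ?_, tout_node _ _ _ _ _⟩
  rw [isComp_node, valid_node_iff]
  rw [cMu] at hr
  simp [cMu, hl, hr, hy]

/-- The inductive step of the determinism of computations. -/
theorem isComp_unique_step {e x u u' : D} (hu : IsComp e x u) (hu' : IsComp e x u')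
    (ih : ∀ w w' e' x' : D, w < u → IsComp e' x' w → IsComp e' x' w' → tout w = tout w') :
    tout u = tout u' := by
  obtain ⟨hv, he, hx⟩ := hu
  obtain ⟨hv', he', hx'⟩ := hu'
  have h₀ : u ≠ 0 := fun h => not_valid_zero (h ▸ hv)
  have h₀' : u' ≠ 0 := fun h => not_valid_zero (h ▸ hv')
  obtain ⟨l, r, hn⟩ := exists_node h₀
  obtain ⟨l', r', hn'⟩ := exists_node h₀'
  have hl : l < u := by rw [hn]; exact left_lt_node _ _ _ _ _
  have hr : r < u := by rw [hn]; exact right_lt_node _ _ _ _ _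
  rw [he, hx] at hn
  rw [he', hx'] at hn'
  generalize tout u = y at *
  generalize tout u' = y' at *
  rw [hn, valid_node_iff] at hv
  rw [hn', valid_node_iff] at hv'
  -- The two roots carry the same program, and distinct numerals denote distinct elements, so its
  -- tag forces both trees to use the same clause.
  rcases hv with h | h | h | h | h | h | h | h <;> obtain ⟨ht, h⟩ := h <;>
    simp only [ht, nm_injective.eq_iff, false_and, true_and, or_false, false_or,
      OfNat.ofNat_ne_zero, OfNat.zero_ne_ofNat, OfNat.ofNat_ne_one, OfNat.one_ne_ofNat,
      one_ne_zero, zero_ne_one, Nat.reduceEqDiff] at hv'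
  · rw [h.1, hv'.1]
  · rw [h.1, hv'.1]
  · rw [h.1, hv'.1]
  · rw [h.1, hv'.1]
  · rw [h.2.2, hv'.2.2, ih _ _ _ _ hl h.1 hv'.1, ih _ _ _ _ hr h.2.1 hv'.2.1]
  -- In a composition the right subtrees have the same input only after the outputs of the left ones
  -- have been identified.
  · have := ih _ _ _ _ hl h.1 hv'.1
    rw [← this] at hv'
    rw [h.2.2, hv'.2.2, ih _ _ _ _ hr h.2.1 hv'.2.1]
  · rcases h with h | h <;> rcases hv' with h' | h'
    · rw [h.2.2.1, h'.2.2.1, ih _ _ _ _ hl h.2.1 h'.2.1]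
    · exact (h'.1 h.1).elim
    · exact (h.1 h'.1).elim
    · have := ih _ _ _ _ hl h.2.1 h'.2.1
      rw [← this] at h'
      rw [h.2.2.2, h'.2.2.2, ih _ _ _ _ hr h.2.2.1 h'.2.2.1]
  · have := ih _ _ _ _ hl h.1 hv'.1
    rw [← this] at hv'
    rcases h.2 with h | h <;> rcases hv'.2 with h' | h'
    · rw [h.2.1, h'.2.1]
    · exact (h'.1 h.1).elim
    · exact (h.1 h'.1).elim
    · rw [h.2.2, h'.2.2, ih _ _ _ _ hr h.2.1 h'.2.1]

end Computation

/-! ### Programs -/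

/-- Programs, built by the clauses in the definition of Kleene's `T`-predicate. -/
inductive Prog : Type
  | zero : Prog
  | succ : Prog
  | fst : Prog
  | snd : Prog
  | pair (f g : Prog) : Prog
  | comp (f g : Prog) : Prog
  | recur (f g : Prog) : Prog
  | mu (f : Prog) : Prog

namespace Prog

/-- The code of a program as a constant function symbol. -/
def sym {n : ℕ} : Prog → PRSym n
  | zero => .pair (.num 0) (.pair (.num 0) (.num 0))
  | succ => .pair (.num 1) (.pair (.num 0) (.num 0))
  | fst => .pair (.num 2) (.pair (.num 0) (.num 0))
  | snd => .pair (.num 3) (.pair (.num 0) (.num 0))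
  | pair f g => .pair (.num 4) (.pair f.sym g.sym)
  | comp f g => .pair (.num 5) (.pair f.sym g.sym)
  | recur f g => .pair (.num 6) (.pair f.sym g.sym)
  | mu f => .pair (.num 7) (.pair f.sym (.num 0))

section

variable {D : Type*} [LPR.Structure D]

/-- The code of a program in a structure. -/
def code (p : Prog) : D := (p.sym : PRSym 0).ev ![]

variable [IsPRA D]

theorem ev_sym {n : ℕ} (p : Prog) (a : Fin n → D) : p.sym.ev a = p.code := by
  induction p <;> simp_all [code, sym]

/-- The program `p` maps `x` to `y`. -/
def Run (p : Prog) (x y : D) : Prop := App p.code x y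

theorem run_zero (x : D) : zero.Run x 0 := by
  have := App.zero x
  simpa [Run, code, sym, cZero, nm] using this

theorem run_succ (x : D) : succ.Run x (suc x) := by
  have := App.succ x
  simpa [Run, code, sym, cSucc, nm] using this

theorem run_fst (x : D) : fst.Run x (p1 x) := by
  have := App.fst x
  simpa [Run, code, sym, cFst, nm] using this

theorem run_snd (x : D) : snd.Run x (p2 x) := by
  have := App.snd x
  simpa [Run, code, sym, cSnd, nm] using this

theorem Run.pair {f g : Prog} {x y z : D} (hf : f.Run x y) (hg : g.Run x z) :
    (f.pair g).Run x (pr y z) := by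
  have := App.pair hf hg
  simpa [Run, code, sym, cPair, nm] using this

theorem Run.comp {f g : Prog} {x y z : D} (hf : f.Run y z) (hg : g.Run x y) :
    (f.comp g).Run x z := by
  have := App.comp hg hf
  simpa [Run, code, sym, cComp, nm] using this

theorem Run.recur_zero {f g : Prog} {a y : D} (hf : f.Run a y) :
    (recur f g).Run (pr a 0) y := by
  have := App.rec_zero (g := g.code) hf
  simpa [Run, code, sym, cRec, nm] using this

theorem Run.recur_suc {f g : Prog} {a m y z : D} (hr : (recur f g).Run (pr a m) y)
    (hg : g.Run (pr a (pr m y)) z) : (recur f g).Run (pr a (suc m)) z := by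
  have := App.rec_suc (f := f.code) (by simpa [Run, code, sym, cRec, nm] using hr) hg
  simpa [Run, code, sym, cRec, nm] using this

theorem Run.mu_zero {f : Prog} {a m : D} (hf : f.Run (pr a m) 0) : (mu f).Run (pr a m) m := by
  have := App.mu_zero hf
  simpa [Run, code, sym, cMu, nm] using this

theorem Run.mu_suc {f : Prog} {a m y z : D} (hf : f.Run (pr a m) y) (hy : y ≠ 0)
    (hz : (mu f).Run (pr a (suc m)) z) : (mu f).Run (pr a m) z := by
  have := App.mu_suc hf hy (by simpa [Run, code, sym, cMu, nm] using hz)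
  simpa [Run, code, sym, cMu, nm] using this

/-- The identity. -/
def ident : Prog := pair fst snd

theorem run_ident (x : D) : ident.Run x x := by
  have := (run_fst x).pair (run_snd x)
  rw [pr_p1_p2] at this
  exact this

end

end Prog

/-- Tuples as iterated pairs. -/
def tup {D : Type*} [LPR.Structure D] [IsPRA D] : {n : ℕ} → (Fin n → D) → D
  | 0, _ => 0
  | _ + 1, a => pr (a 0) (tup (Fin.tail a))

namespace PRSym

/-- The tuple of the values of some function symbols. -/
def tupS {m : ℕ} : {n : ℕ} → (Fin n → PRSym m) → PRSym m
  | 0, _ => num 0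
  | _ + 1, g => pair (g 0) (tupS (Fin.tail g))

end PRSym

section

variable {D : Type*} [LPR.Structure D] [IsPRA D]

theorem tup_cons {n : ℕ} (d : D) (a : Fin n → D) :
    tup (Fin.cons d a : Fin (n + 1) → D) = pr d (tup a) := rfl

theorem ev_tupS {n m : ℕ} (g : Fin n → PRSym m) (a : Fin m → D) :
    (PRSym.tupS g).ev a = tup fun i => (g i).ev a := by
  induction n with
  | zero => exact ev_num 0 a
  | succ n ih => rw [PRSym.tupS, ev_pair, ih]; rfl

theorem ev_comp_cons {n m : ℕ} (f : PRSym (n + 1)) (g₀ : PRSym m) (g : Fin n → PRSym m)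
    (a : Fin m → D) : (PRSym.comp f (Fin.cons g₀ g)).ev a =
      f.ev (Fin.cons (g₀.ev a) fun i => (g i).ev a) := by
  rw [IsPRA.ev_comp]
  congr 1
  funext i
  refine Fin.cases ?_ (fun i => ?_) i <;> rfl

theorem ev_comp₃ {m : ℕ} (f : PRSym 3) (g₁ g₂ g₃ : PRSym m) (a : Fin m → D) :
    (PRSym.comp f ![g₁, g₂, g₃]).ev a = f.ev ![g₁.ev a, g₂.ev a, g₃.ev a] := by
  rw [IsPRA.ev_comp]
  congr 1
  funext i
  fin_cases i <;> rfl

theorem ev_comp_proj {n m : ℕ} (f : PRSym n) (g : Fin n → Fin m) (a : Fin m → D) :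
    (PRSym.comp f fun i => .proj (g i)).ev a = f.ev (a ∘ g) := by
  rw [IsPRA.ev_comp]
  congr 1
  funext i
  exact IsPRA.ev_proj _ _

end

/-! ### Induction about computations in Kripke models, and their uniqueness. -/

namespace KripkeData

variable {K : KripkeData.{0, 0, w} LPR} [hK : Fact K.IsHAModel]

instance (k : K.Node) : IsPRA (K.Dom k) := hK.out.isPRA k

theorem map_pr {k k' : K.Node} (h : K.le k k') (x y : K.Dom k) :
    K.map h (pr x y) = pr (K.map h x) (K.map h y) := by
  have h₁ : ∀ (k : K.Node) (x y : K.Dom k),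
      (PRSym.pair (.proj 0) (.proj 1) : PRSym 2).ev ![x, y] = pr x y := by
    intro k x y
    simp
  rw [← h₁, ← h₁, hK.out.map_ev]
  congr 1
  funext i
  fin_cases i <;> rfl

theorem map_tup {k k' : K.Node} (h : K.le k k') {n : ℕ} (a : Fin n → K.Dom k) :
    K.map h (tup a) = tup (K.map h ∘ a) := by
  induction n with
  | zero => exact hK.out.map_zero h
  | succ n ih => exact (map_pr h _ _).trans (congrArg (pr _) (ih _))

/-- Induction for `Π₁`-statements. -/
theorem forall_ind (f : PRSym 3) (h₀ : ∀ (k : K.Node) (x y : K.Dom k), f.ev ![x, y, 0] = 0)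
    (hs : ∀ (k : K.Node) (z : K.Dom k), (∀ x y : K.Dom k, f.ev ![x, y, z] = 0) →
      ∀ x y : K.Dom k, f.ev ![x, y, suc z] = 0) {k : K.Node} (x y z : K.Dom k) :
    f.ev ![x, y, z] = 0 := by
  have key : ∀ (k : K.Node) (z : K.Dom k),
      K.Forces ((IFml.equal (fn f vr) tZero).all.all : IFml LPR 1) k ![z] ↔
        ∀ (k' : K.Node) (h : K.le k k') (x y : K.Dom k'), f.ev ![x, y, K.map h z] = 0 := by
    intro k z
    have e : ∀ (k' : K.Node) (h : K.le k k') (x y : K.Dom k'),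
        (Fin.cons x (Fin.cons y (K.map h ∘ ![z]) : Fin 2 → K.Dom k') : Fin 3 → K.Dom k') =
          ![x, y, K.map h z] := by
      intro k' h x y
      funext i
      fin_cases i <;> rfl
    constructor
    · intro H k' h x y
      have := hK.out.forces_all (H k' h y) x
      rw [e] at this
      exact (show f.ev _ = Term.realize _ _ from this).trans (ev_zero _)
    · intro H k' h y k'' h' x
      rw [map_cons, hK.out.map_comp_map h h' (hK.out.trans h h'), e]
      change f.ev _ = Term.realize _ _
      rw [realize_tZero]
      exact H _ _ _ _
  have e₁ : ∀ (k : K.Node) (z : K.Dom k) (a : Fin 0 → K.Dom k),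
      (Fin.cons z a : Fin 1 → K.Dom k) = ![z] := by
    intro k z a
    funext i
    fin_cases i
    rfl
  have := hK.out.forces_ind ((IFml.equal (fn f vr) tZero).all.all : IFml LPR 1) k ![]
    (by
      rw [e₁, key]
      intro k' h x y
      rw [hK.out.map_zero]
      exact h₀ _ _ _)
    (by
      intro k' h z hz
      rw [e₁, key] at hz ⊢
      intro k'' h' x y
      rw [hK.out.map_suc]
      exact hs _ _ (hz k'' h') x y) z
  rw [e₁, key] at this
  have := this k (hK.out.refl k) x y
  rwa [hK.out.map_self] at this

/-- Computations are deterministic. -/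
theorem app_unique {k : K.Node} {e x y y' : K.Dom k} (h : App e x y) (h' : App e x y') :
    y = y' := by
  -- The vanishing of `f` says that trees u < z and u' for the same program and input have the same
  -- output. Only u is bounded by z while u' ranges over everything, so Π₁-induction on z is used.
  let f : PRSym 3 := (.num 1 - ((.app₁ .succ (.proj 0) - .proj 2) +
    .comp .kleeneT ![.idx (.proj 0), .inp (.proj 0), .proj 0] +
    .comp .kleeneT ![.idx (.proj 0), .inp (.proj 0), .proj 1])) *
    .eqn (.out (.proj 0)) (.out (.proj 1))
  have one_sub : ∀ {k : K.Node} (z : K.Dom k), nm 1 - z = 0 ↔ z ≠ 0 := by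
    intro k z
    rcases zero_or_suc z with rfl | ⟨z, rfl⟩
    · simp only [sub_zero', nm, IsPRA.suc_ne_zero, ne_eq, not_true]
    · simp only [nm, suc_sub_suc, zero_sub', IsPRA.suc_ne_zero, ne_eq, not_false_eq_true]
  have hf : ∀ {k : K.Node} (u u' z : K.Dom k), f.ev ![u, u', z] = 0 ↔
      (u < z → IsComp (tidx u) (tinp u) u → IsComp (tidx u) (tinp u) u' → tout u = tout u') := by
    intro k u u' z
    simp only [f, ev_mul, ev_sub, ev_num, pra_mul_eq_zero, one_sub, ev_add, pra_add_eq_zero,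
      ev_comp₃, ev_kleeneT, sub_eq_zero_iff, ev_app₁_succ, suc_le_iff, ev_eqn_eq_zero, PRSym.idx,
      PRSym.inp, PRSym.out, ev_fst, ev_snd, ev_app₁_predS, ev_proj_apply, ne_eq, ← imp_iff_not_or,
      and_imp]
    rfl
  obtain ⟨u, hu, rfl⟩ := h
  obtain ⟨u', hu', rfl⟩ := h'
  have := (hf _ _ _).1 (forall_ind f
    (fun k x y => by
      rw [hf]
      intro h
      exact (not_lt_of_ge zero_le h).elim)
    (fun k z hz u u' => by
      rw [hf]
      intro hlt h h'
      refine isComp_unique_step h h' fun w w' e x hw hc hc' => ?_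
      have := (hf _ _ _).1 (hz w w') (hw.trans_le (lt_suc_iff.1 hlt))
      rw [hc.2.1, hc.2.2] at this
      exact this hc hc') u u' (suc u)) (lt_suc_self u)
  rw [hu.2.1, hu.2.2] at this
  exact this hu hu'

/-- Induction for the statement that a computation terminates with a certain kind of value. -/
theorem app_ind {n : ℕ} (e d : PRSym (n + 1)) (g : PRSym (n + 2)) (k : K.Node)
    (a : Fin n → K.Dom k)
    (h₀ : ∃ y, App (e.ev (Fin.cons 0 a)) (d.ev (Fin.cons 0 a)) y ∧
      g.ev (Fin.cons y (Fin.cons 0 a)) = 0)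
    (hs : ∀ (k' : K.Node) (h : K.le k k') (x : K.Dom k'),
      (∃ y, App (e.ev (Fin.cons x (K.map h ∘ a))) (d.ev (Fin.cons x (K.map h ∘ a))) y ∧
        g.ev (Fin.cons y (Fin.cons x (K.map h ∘ a))) = 0) →
      ∃ y, App (e.ev (Fin.cons (suc x) (K.map h ∘ a))) (d.ev (Fin.cons (suc x) (K.map h ∘ a))) y ∧
        g.ev (Fin.cons y (Fin.cons (suc x) (K.map h ∘ a))) = 0) (x : K.Dom k) :
    ∃ y, App (e.ev (Fin.cons x a)) (d.ev (Fin.cons x a)) y ∧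
      g.ev (Fin.cons y (Fin.cons x a)) = 0 := by
  -- The variable `0` stands for the computation tree, so that the statement becomes the Σ₁-formula
  -- ∃u f(u, x, a) = 0.
  let f : PRSym (n + 2) := .comp .kleeneT ![.comp e fun i => .proj i.succ,
    .comp d fun i => .proj i.succ, .proj 0] +
    .comp g (Fin.cons (.app₁ .kleeneU (.proj 0)) fun i => .proj i.succ)
  have hf : ∀ {k : K.Node} (x : K.Dom k) (a : Fin n → K.Dom k),
      K.Forces (IFml.equal (fn f vr) tZero).ex k (Fin.cons x a : Fin (n + 1) → K.Dom k) ↔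
        ∃ y, App (e.ev (Fin.cons x a)) (d.ev (Fin.cons x a)) y ∧
          g.ev (Fin.cons y (Fin.cons x a)) = 0 := by
    intro k x a
    have : ∀ u : K.Dom k, K.Forces (IFml.equal (fn f vr) tZero) k
        (Fin.cons u (Fin.cons x a : Fin (n + 1) → K.Dom k) : Fin (n + 2) → K.Dom k) ↔
        IsComp (e.ev (Fin.cons x a)) (d.ev (Fin.cons x a)) u ∧
          g.ev (Fin.cons (tout u) (Fin.cons x a)) = 0 := by
      intro u
      change f.ev _ = Term.realize _ _ ↔ _
      rw [realize_tZero]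
      simp only [f, ev_add, pra_add_eq_zero, ev_comp₃, ev_kleeneT, ev_comp_cons, ev_comp_proj,
        ev_app₁, ev_kleeneU, ev_proj_apply]
      rfl
    constructor
    · rintro ⟨u, hu⟩
      rw [this] at hu
      exact ⟨_, ⟨u, hu.1, rfl⟩, hu.2⟩
    · rintro ⟨_, ⟨u, hu, rfl⟩, h⟩
      exact ⟨u, (this u).2 ⟨hu, h⟩⟩
  rw [← hf]
  exact hK.out.forces_ind _ k a ((hf _ _).2 h₀) (fun k' h x hx => (hf _ _).2 (hs k' h x ((hf _ _).1 hx)))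
    x

end KripkeData

/-! ### Programs for primitive recursive functions -/

namespace Prog

/-- The projections of tuples. -/
def proj : {n : ℕ} → Fin n → Prog
  | _ + 1, i => Fin.cases fst (fun i => (proj i).comp snd) i

theorem run_proj {D : Type*} [LPR.Structure D] [IsPRA D] {n : ℕ} (i : Fin n) (a : Fin n → D) :
    (proj i).Run (tup a) (a i) := by
  induction n with
  | zero => exact i.elim0
  | succ n ih =>
    refine Fin.cases ?_ (fun i => ?_) i
    · have := run_fst (tup a)
      rwa [tup, p1_pr] at this
    · have := run_snd (tup a)
      rw [tup, p2_pr] at this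
      exact (ih i _).comp this

/-- The tuple of the values of some programs. -/
def tuple : {n : ℕ} → (Fin n → Prog) → Prog
  | 0, _ => zero
  | _ + 1, p => pair (p 0) (tuple (Fin.tail p))

theorem run_tuple {D : Type*} [LPR.Structure D] [IsPRA D] {n : ℕ} {p : Fin n → Prog} {x : D}
    {a : Fin n → D} (h : ∀ i, (p i).Run x (a i)) : (tuple p).Run x (tup a) := by
  induction n with
  | zero => exact run_zero x
  | succ n ih => exact (h 0).pair (ih fun i => h i.succ)

/-- The program of a primitive recursive function, which takes its arguments as a tuple. -/
def ofPR : {n : ℕ} → PRSym n → Prog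
  | _, .zero => zero
  | _, .succ => comp succ fst
  | _, .proj i => proj i
  | _, .comp f g => (ofPR f).comp (tuple fun i => ofPR (g i))
  -- The program clause for recursion has the parameters first, the symbol `prec` has the recursion
  -- variable first. The inner rearrangement maps ⟨a, ⟨m, y⟩⟩ to ⟨m, ⟨y, a⟩⟩ and the outer one swaps
  -- the two arguments.
  | _, .prec f g => (recur (ofPR f) ((ofPR g).comp
      ((fst.comp snd).pair ((snd.comp snd).pair fst)))).comp (snd.pair fst)

open KripkeData

variable {K : KripkeData.{0, 0, w} LPR} [hK : Fact K.IsHAModel]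

/-- The recursion may have nonstandard length, so its termination with the right value is proved by
Σ₁-induction inside the model; the other clauses just combine computations. -/
theorem run_ofPR {n : ℕ} (f : PRSym n) {k : K.Node} (a : Fin n → K.Dom k) :
    (ofPR f).Run (tup a) (f.ev a) := by
  induction f generalizing k with
  | zero =>
    rw [ev_zero]
    exact run_zero _
  | succ =>
    rw [ev_succ]
    exact (run_succ _).comp (run_proj 0 a)
  | proj i =>
    rw [ev_proj_apply]
    exact run_proj i a
  | comp f g hf hg =>
    rw [IsPRA.ev_comp]
    exact (hf _).comp (run_tuple fun i => hg i a)
  | @prec n f g hf hg =>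
    set q := recur (ofPR f) ((ofPR g).comp ((fst.comp snd).pair ((snd.comp snd).pair fst))) with hq
    have key : ∀ {k : K.Node} (a : Fin n → K.Dom k) (x : K.Dom k),
        q.Run (pr (tup a) x) ((PRSym.prec f g).ev (Fin.cons x a)) := by
      intro k a x
      have hd : ∀ {k : K.Node} (x : K.Dom k) (a : Fin n → K.Dom k),
          (PRSym.pair (.tupS fun i => .proj i.succ) (.proj 0) : PRSym (n + 1)).ev (Fin.cons x a) =
            pr (tup a) x := by
        intro k x a
        simp [ev_tupS]
      have he : ∀ {k : K.Node} (y x : K.Dom k) (a : Fin n → K.Dom k),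
          (PRSym.eqn (.proj 0) (.comp (.prec f g) fun i => .proj i.succ) : PRSym (n + 2)).ev
            (Fin.cons y (Fin.cons x a)) = 0 ↔ y = (PRSym.prec f g).ev (Fin.cons x a) := by
        intro k y x a
        rw [ev_eqn_eq_zero, ev_comp_proj, ev_proj_apply]
        rfl
      have := app_ind q.sym (.pair (.tupS fun i => .proj i.succ) (.proj 0))
        (.eqn (.proj 0) (.comp (.prec f g) fun i => .proj i.succ)) k a
        (by
          refine ⟨f.ev a, ?_, ?_⟩
          · rw [ev_sym, hd]
            exact (hf a).recur_zero
          · rw [he, IsPRA.ev_prec_zero])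
        (by
          rintro k' h x ⟨y, hy, hy'⟩
          rw [he] at hy'
          rw [ev_sym, hd, hy'] at hy
          refine ⟨(PRSym.prec f g).ev (Fin.cons (suc x) (K.map h ∘ a)), ?_, ?_⟩
          · rw [ev_sym, hd]
            refine Run.recur_suc hy ?_
            rw [IsPRA.ev_prec_suc]
            refine (hg _).comp ?_
            have := ((run_fst _).comp (run_snd (pr (tup (K.map h ∘ a)) (pr x
              ((PRSym.prec f g).ev (Fin.cons x (K.map h ∘ a))))))).pair
              (((run_snd _).comp (run_snd _)).pair (run_fst _))
            simpa only [p1_pr, p2_pr, tup_cons] using this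
          · rw [he]) x
      obtain ⟨y, hy, hy'⟩ := this
      rw [he] at hy'
      rwa [ev_sym, hd, hy'] at hy
    have h₁ := (run_snd (tup a)).pair (run_fst (tup a))
    have h₂ := key (Fin.tail a) (a 0)
    rw [Fin.cons_self_tail] at h₂
    rw [show tup a = pr (a 0) (tup (Fin.tail a)) from rfl, p1_pr, p2_pr] at h₁
    exact h₂.comp h₁

/-- The search for a zero of a primitive recursive function. -/
def search {n : ℕ} (h : PRSym (n + 1)) : Prog :=
  (mu ((ofPR h).comp (snd.pair fst))).comp (ident.pair zero)

/-- Backwards from the known zero m: by Σ₁-induction on j, the search started at m ∸ j ends at some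
zero. It either stops at once or continues as the search started one step later. The case j = m is
the search from `0`. -/
theorem run_search {n : ℕ} (h : PRSym (n + 1)) {k : K.Node} (m : K.Dom k) (a : Fin n → K.Dom k)
    (hm : h.ev (Fin.cons m a) = 0) :
    ∃ m', (search h).Run (tup a) m' ∧ h.ev (Fin.cons m' a) = 0 := by
  set q := (ofPR h).comp (snd.pair fst) with hq
  have hrun : ∀ {k : K.Node} (m : K.Dom k) (a : Fin n → K.Dom k),
      q.Run (pr (tup a) m) (h.ev (Fin.cons m a)) := by
    intro k m a
    refine (run_ofPR h _).comp ?_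
    simpa only [p1_pr, p2_pr, tup_cons] using (run_snd (pr (tup a) m)).pair (run_fst _)
  have hd : ∀ {k : K.Node} (j m : K.Dom k) (a : Fin n → K.Dom k),
      (PRSym.pair (.tupS fun i => .proj i.succ.succ) (.proj 1 - .proj 0) : PRSym (n + 2)).ev
        (Fin.cons j (Fin.cons m a)) = pr (tup a) (m - j) := by
    intro k j m a
    have : ((Fin.cons j (Fin.cons m a : Fin (n + 1) → K.Dom k) : Fin (n + 2) → K.Dom k) 1) = m := rfl
    simp [ev_tupS, this]
  have he : ∀ {k : K.Node} (y j m : K.Dom k) (a : Fin n → K.Dom k),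
      (PRSym.comp h (Fin.cons (.proj 0) fun i => .proj i.succ.succ.succ) : PRSym (n + 3)).ev
        (Fin.cons y (Fin.cons j (Fin.cons m a))) = h.ev (Fin.cons y a) := by
    intro k y j m a
    simp only [ev_comp_cons, ev_proj_apply]
    rfl
  have := app_ind (n := n + 1) (mu q).sym
    (.pair (.tupS fun i => .proj i.succ.succ) (.proj 1 - .proj 0))
    (.comp h (Fin.cons (.proj 0) fun i => .proj i.succ.succ.succ)) k (Fin.cons m a)
    (by
      refine ⟨m, ?_, ?_⟩
      · rw [ev_sym, hd, sub_zero']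
        refine Run.mu_zero ?_
        have := hrun m a
        rwa [hm] at this
      · rw [he, hm])
    (by
      intro k' hk j
      rw [map_cons]
      rintro ⟨y, hy, hy'⟩
      rw [he] at hy'
      rw [ev_sym, hd] at hy
      by_cases h₀ : h.ev (Fin.cons (K.map hk m - suc j) (K.map hk ∘ a)) = 0
      · refine ⟨K.map hk m - suc j, ?_, ?_⟩
        · rw [ev_sym, hd]
          refine Run.mu_zero ?_
          have := hrun (K.map hk m - suc j) (K.map hk ∘ a)
          rwa [h₀] at this
        · rw [he, h₀]
      · refine ⟨y, ?_, ?_⟩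
        · rw [ev_sym, hd]
          rcases zero_or_suc (K.map hk m - j) with hz | ⟨z, hz⟩
          · rwa [sub_suc, hz, prd_zero, ← hz]
          · refine Run.mu_suc (hrun _ _) h₀ ?_
            rwa [sub_suc, hz, prd_suc, ← hz]
        · rw [he, hy']) m
  obtain ⟨y, hy, hy'⟩ := this
  rw [he] at hy'
  rw [ev_sym, hd, tsub_self] at hy
  exact ⟨y, Run.comp hy ((run_ident _).pair (run_zero _)), hy'⟩

/-- The program that maps `⟨e, x⟩` to the computation of `e` at `x`. -/
def trace : Prog :=
  (search (.comp .kleeneT ![.proj 1, .proj 2, .proj 0] : PRSym 3)).comp (fst.pair (snd.pair zero))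

theorem run_trace {k : K.Node} {e x y : K.Dom k} (h : App e x y) :
    ∃ u, trace.Run (pr e x) u ∧ IsComp e x u := by
  obtain ⟨u, hu, rfl⟩ := h
  have key : ∀ u : K.Dom k, (PRSym.comp .kleeneT ![.proj 1, .proj 2, .proj 0] : PRSym 3).ev
      (Fin.cons u ![e, x]) = 0 ↔ IsComp e x u := by
    intro u
    rw [ev_comp₃, ← ev_kleeneT]
    simp only [ev_proj_apply]
    rfl
  obtain ⟨u', h₁, h₂⟩ := run_search _ u ![e, x] ((key u).2 hu)
  rw [key] at h₂
  refine ⟨u', h₁.comp ?_, h₂⟩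
  have := (run_fst (pr e x)).pair ((run_snd (pr e x)).pair (run_zero _))
  rwa [p1_pr, p2_pr] at this

/-- The universal program, which maps `⟨e, x⟩` to the value of `e` at `x`. -/
def univ : Prog := (ofPR .kleeneU).comp (trace.pair zero)

/-- The computation found by the search need not be the given one, but both have the same output by
determinism. -/
theorem run_univ {k : K.Node} {e x y : K.Dom k} (h : App e x y) : univ.Run (pr e x) y := by
  obtain ⟨u, h₁, h₂⟩ := run_trace h
  have h₃ := run_ofPR .kleeneU ![u]
  rw [ev_kleeneU, app_unique ⟨u, h₂, rfl⟩ h] at h₃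
  exact h₃.comp (h₁.pair (run_zero _))

/-- Application of the value of one program to that of another. -/
def ap (p q : Prog) : Prog := univ.comp (p.pair q)

theorem Run.ap {k : K.Node} {p q : Prog} {x e d y : K.Dom k} (hp : p.Run x e) (hq : q.Run x d)
    (h : App e d y) : (p.ap q).Run x y :=
  (run_univ h).comp (hp.pair hq)

/-- The program of the constant function with value the code of `p`. -/
def quote (p : Prog) : Prog := (ofPR (p.sym : PRSym 0)).comp zero

theorem run_quote (p : Prog) {k : K.Node} (x : K.Dom k) : p.quote.Run x p.code :=
  (run_ofPR _ ![]).comp (run_zero x)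

/-- The function that maps `a` to a program for the constant function with value `a`. -/
def constS : PRSym 1 :=
  .prec zero.sym (.pair (.num 5) (.pair succ.sym (.proj 1)))

/-- The program is a chain of `a` successors applied to the zero program. As `a` may be nonstandard,
its value is found by Σ₁-induction. -/
theorem app_constS {k : K.Node} (a x : K.Dom k) : App (constS.ev ![a]) x a := by
  have hz : ∀ {k : K.Node}, constS.ev ![(0 : K.Dom k)] = zero.code := by
    intro k
    exact (IsPRA.ev_prec_zero _ _ ![]).trans (ev_sym _ _)
  have hs : ∀ {k : K.Node} (a : K.Dom k), constS.ev ![suc a] = cComp succ.code (constS.ev ![a]) := by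
    intro k a
    refine (IsPRA.ev_prec_suc _ _ a ![]).trans ?_
    simp only [ev_pair, ev_num, ev_sym, ev_proj_apply]
    rfl
  have he : ∀ {k : K.Node} (a x : K.Dom k),
      (PRSym.app₁ constS (.proj 0) : PRSym 2).ev (Fin.cons a ![x]) = constS.ev ![a] := by
    intro k a x
    rw [ev_app₁, ev_proj_apply]
    rfl
  have hd : ∀ {k : K.Node} (a x : K.Dom k),
      (PRSym.proj 1 : PRSym 2).ev (Fin.cons a ![x]) = x := by
    intro k a x
    rw [ev_proj_apply]
    rfl
  have hg : ∀ {k : K.Node} (y a x : K.Dom k),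
      (PRSym.eqn (.proj 0) (.proj 1) : PRSym 3).ev (Fin.cons y (Fin.cons a ![x])) = 0 ↔ y = a := by
    intro k y a x
    rw [ev_eqn_eq_zero, ev_proj_apply, ev_proj_apply]
    rfl
  have hm : ∀ {k k' : K.Node} (h : K.le k k') (x : K.Dom k), K.map h ∘ ![x] = ![K.map h x] := by
    intro k k' h x
    funext i
    fin_cases i
    rfl
  have := app_ind (.app₁ constS (.proj 0)) (.proj 1) (.eqn (.proj 0) (.proj 1)) k ![x]
    (by
      refine ⟨0, ?_, (hg _ _ _).2 rfl⟩
      rw [he, hd, hz]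
      exact run_zero x)
    (by
      rintro k' h a ⟨y, hy, hy'⟩
      rw [hm] at hy hy' ⊢
      obtain rfl := (hg _ _ _).1 hy'
      rw [he, hd] at hy
      refine ⟨suc y, ?_, (hg _ _ _).2 rfl⟩
      rw [he, hd, hs]
      exact App.comp hy (run_succ y)) a
  obtain ⟨y, hy, hy'⟩ := this
  obtain rfl := (hg _ _ _).1 hy'
  rwa [he, hd] at hy

/-- The function that maps `a` to a program for the function `x ↦ p(⟨a, x⟩)`. -/
def curryS (p : Prog) : PRSym 1 :=
  -- Tags `5` and `4` are composition and pairing: this codes p composed with the pair of the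
  -- constant a and the identity.
  .pair (.num 5) (.pair p.sym (.pair (.num 4) (.pair constS ident.sym)))

/-- A program for the function `x ↦ p(⟨a, x⟩)`. -/
def curry {D : Type*} [LPR.Structure D] (p : Prog) (a : D) : D := p.curryS.ev ![a]

theorem app_curry {p : Prog} {k : K.Node} {a x y : K.Dom k} (h : p.Run (pr a x) y) :
    App (p.curry a) x y := by
  have : p.curry a = cComp p.code (cPair (constS.ev ![a]) ident.code) := by
    simp only [curry, curryS, ev_pair, ev_num, ev_sym, cComp, cPair]
  rw [this]
  exact App.comp (App.pair (app_constS a x) (run_ident x)) h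

theorem map_curry (p : Prog) {k k' : K.Node} (h : K.le k k') (a : K.Dom k) :
    K.map h (p.curry a) = p.curry (K.map h a) := by
  rw [curry, hK.out.map_ev, curry]
  congr 1
  funext i
  fin_cases i
  rfl

/-- The program that maps `a` to a program for the function `x ↦ p(⟨a, x⟩)`. -/
def lam (p : Prog) : Prog := (ofPR p.curryS).comp (ident.pair zero)

theorem run_lam (p : Prog) {k : K.Node} (a : K.Dom k) : p.lam.Run a (p.curry a) :=
  (run_ofPR p.curryS ![a]).comp ((run_ident a).pair (run_zero a))

end Prog

/-! ### Realizability -/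

namespace IFml

/-- The formula `T(x₂, x₁, x₀) ∧ φ(U(x₀), …)`. -/
def kleene {n : ℕ} (φ : IFml LPR (n + 3)) : IFml LPR (n + 3) :=
  (equal (fn PRSym.kleeneT ![vr 2, vr 1, vr 0]) tZero).and φ

/-- `rz b φ` is the formula that says that the variable `0` realizes `φ`: number realizability if
`b` is false, and realizability combined with truth if `b` is true. -/
def rz (b : Bool) : {n : ℕ} → IFml LPR n → IFml LPR (n + 1)
  | _, falsum => falsum
  | _, equal t s => (equal t s).lift
  | _, rel R _ => R.elim
  | _, and φ ψ =>
    ((φ.rz b).subst (Fin.cons (fn PRSym.fstS ![vr 0]) fun i => vr i.succ)).and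
      ((ψ.rz b).subst (Fin.cons (fn PRSym.sndS ![vr 0]) fun i => vr i.succ))
  | _, or φ ψ =>
    ((equal (fn PRSym.fstS ![vr 0]) tZero).and
      ((φ.rz b).subst (Fin.cons (fn PRSym.sndS ![vr 0]) fun i => vr i.succ))).or
    ((equal (fn PRSym.fstS ![vr 0]) (tSucc tZero)).and
      ((ψ.rz b).subst (Fin.cons (fn PRSym.sndS ![vr 0]) fun i => vr i.succ)))
  | _, imp φ ψ =>
    -- Truth has to be added only to implications. In all other clauses it is inherited from the
    -- components, see `R.forces`.
    ((if b then φ.imp ψ else falsum.imp falsum).lift).and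
      (((φ.rz b).rename (Fin.cons 0 fun i => i.succ.succ)).imp
        (kleene ((ψ.rz b).subst (Fin.cons (fn PRSym.kleeneU ![vr 0])
          fun i => vr i.succ.succ.succ))).ex).all
  | _, all φ =>
    (kleene ((φ.rz b).subst (Fin.cons (fn PRSym.kleeneU ![vr 0])
      (Fin.cons (vr 1) fun i => vr i.succ.succ.succ)))).ex.all
  | _, ex φ =>
    (φ.rz b).subst (Fin.cons (fn PRSym.sndS ![vr 0])
      (Fin.cons (fn PRSym.fstS ![vr 0]) fun i => vr i.succ))

end IFml

section

variable {D : Type*} [LPR.Structure D]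

theorem realize_cons {n m : ℕ} (t : LPR.Term (Fin m)) (σ : Fin n → LPR.Term (Fin m))
    (a : Fin m → D) :
    (fun i => ((Fin.cons t σ : Fin (n + 1) → LPR.Term (Fin m)) i).realize a) =
      (Fin.cons (t.realize a) fun i => (σ i).realize a : Fin (n + 1) → D) := by
  funext i
  refine Fin.cases ?_ (fun i => ?_) i <;> rfl

theorem realize_fn₁ {m : ℕ} (f : PRSym 1) (t : LPR.Term (Fin m)) (a : Fin m → D) :
    (fn f ![t]).realize a = f.ev ![t.realize a] := by
  rw [realize_fn]
  congr 1
  funext i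
  fin_cases i
  rfl

theorem realize_fn₃ {m : ℕ} (f : PRSym 3) (t₁ t₂ t₃ : LPR.Term (Fin m)) (a : Fin m → D) :
    (fn f ![t₁, t₂, t₃]).realize a = f.ev ![t₁.realize a, t₂.realize a, t₃.realize a] := by
  rw [realize_fn]
  congr 1
  funext i
  fin_cases i <;> rfl

end

namespace KripkeData

variable (K : KripkeData.{0, 0, w} LPR)

/-- The number `z` realizes `φ(a)` at the node `k`. -/
def R (b : Bool) {n : ℕ} (φ : IFml LPR n) (k : K.Node) (z : K.Dom k) (a : Fin n → K.Dom k) : Prop :=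
  K.Forces (φ.rz b) k (Fin.cons z a : Fin (n + 1) → K.Dom k)

variable {K} [hK : Fact K.IsHAModel] {b : Bool} {n : ℕ} {k : K.Node}

theorem forces_kleene {φ : IFml LPR (n + 3)} {u x e : K.Dom k} {a : Fin n → K.Dom k} :
    K.Forces φ.kleene k (Fin.cons u (Fin.cons x (Fin.cons e a : Fin (n + 1) → K.Dom k) :
        Fin (n + 2) → K.Dom k) : Fin (n + 3) → K.Dom k) ↔
      IsComp e x u ∧ K.Forces φ k (Fin.cons u (Fin.cons x (Fin.cons e a : Fin (n + 1) → K.Dom k) :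
        Fin (n + 2) → K.Dom k) : Fin (n + 3) → K.Dom k) := by
  refine and_congr ?_ Iff.rfl
  change Term.realize _ _ = Term.realize _ _ ↔ _
  rw [realize_fn₃, realize_tZero, ← ev_kleeneT]
  rfl

theorem r_equal {t s : LPR.Term (Fin n)} {z : K.Dom k} {a : Fin n → K.Dom k} :
    K.R b (.equal t s) k z a ↔ t.realize a = s.realize a :=
  hK.out.forces_lift (IFml.equal t s) z a

theorem r_and {φ ψ : IFml LPR n} {z : K.Dom k} {a : Fin n → K.Dom k} :
    K.R b (φ.and ψ) k z a ↔ K.R b φ k (p1 z) a ∧ K.R b ψ k (p2 z) a := by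
  refine and_congr ?_ ?_ <;> rw [hK.out.forces_subst, realize_cons, realize_fn₁] <;> rfl

theorem r_or {φ ψ : IFml LPR n} {z : K.Dom k} {a : Fin n → K.Dom k} :
    K.R b (φ.or ψ) k z a ↔
      p1 z = 0 ∧ K.R b φ k (p2 z) a ∨ p1 z = nm 1 ∧ K.R b ψ k (p2 z) a := by
  refine or_congr (and_congr ?_ ?_) (and_congr ?_ ?_)
  · change Term.realize _ _ = Term.realize _ _ ↔ _
    rw [realize_fn₁, realize_tZero]
    rfl
  · rw [hK.out.forces_subst, realize_cons, realize_fn₁]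
    rfl
  · change Term.realize _ _ = Term.realize _ _ ↔ _
    rw [realize_fn₁, realize_tSucc, realize_tZero]
    rfl
  · rw [hK.out.forces_subst, realize_cons, realize_fn₁]
    rfl

theorem r_ex {φ : IFml LPR (n + 1)} {z : K.Dom k} {a : Fin n → K.Dom k} :
    K.R b φ.ex k z a ↔ K.R b φ k (p2 z) (Fin.cons (p1 z) a) := by
  change K.Forces ((φ.rz b).subst _) k _ ↔ _
  rw [hK.out.forces_subst, realize_cons, realize_cons, realize_fn₁, realize_fn₁]
  rfl

theorem R.mono {φ : IFml LPR n} {k' : K.Node} (h : K.le k k') {z : K.Dom k} {a : Fin n → K.Dom k}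
    (hr : K.R b φ k z a) : K.R b φ k' (K.map h z) (K.map h ∘ a) := by
  have := hK.out.forces_mono _ h hr
  rwa [map_cons] at this

theorem r_all {φ : IFml LPR (n + 1)} {z : K.Dom k} {a : Fin n → K.Dom k} :
    K.R b φ.all k z a ↔ ∀ (k' : K.Node) (h : K.le k k') (y : K.Dom k'),
      ∃ w, App (K.map h z) y w ∧ K.R b φ k' w (Fin.cons y (K.map h ∘ a)) := by
  refine forall_congr' fun k' => forall_congr' fun h => forall_congr' fun y => ?_
  rw [map_cons]
  have key : ∀ u : K.Dom k', K.Forces (φ.rz b |>.subst (Fin.cons (fn PRSym.kleeneU ![vr 0])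
      (Fin.cons (vr 1) fun i => vr i.succ.succ.succ))) k'
      (Fin.cons u (Fin.cons y (Fin.cons (K.map h z) (K.map h ∘ a) : Fin (n + 1) → K.Dom k') :
        Fin (n + 2) → K.Dom k') : Fin (n + 3) → K.Dom k') ↔
      K.R b φ k' (tout u) (Fin.cons y (K.map h ∘ a)) := by
    intro u
    rw [hK.out.forces_subst, realize_cons, realize_cons, realize_fn₁, realize_vr, ev_kleeneU]
    rfl
  constructor
  · rintro ⟨u, hu⟩
    rw [forces_kleene, key] at hu
    exact ⟨_, ⟨u, hu.1, rfl⟩, hu.2⟩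
  · rintro ⟨_, ⟨u, hu, rfl⟩, h⟩
    refine ⟨u, ?_⟩
    rw [forces_kleene, key]
    exact ⟨hu, h⟩

/-- The universal quantifier over realizers and the implication each pass to a later node; by
transitivity the two passages merge into one. -/
theorem r_imp {φ ψ : IFml LPR n} {z : K.Dom k} {a : Fin n → K.Dom k} :
    K.R b (φ.imp ψ) k z a ↔ (b = true → K.Forces (φ.imp ψ) k a) ∧
      ∀ (k' : K.Node) (h : K.le k k') (y : K.Dom k'), K.R b φ k' y (K.map h ∘ a) →
        ∃ w, App (K.map h z) y w ∧ K.R b ψ k' w (K.map h ∘ a) := by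
  refine and_congr ?_ ?_
  · rw [hK.out.forces_lift]
    cases b
    · exact ⟨fun _ h => (Bool.false_ne_true h).elim, fun _ _ _ h => h⟩
    · exact ⟨fun h _ => h, fun h => h rfl⟩
  · have hφ : ∀ (k' : K.Node) (y z : K.Dom k') (a : Fin n → K.Dom k'),
        K.Forces ((φ.rz b).rename (Fin.cons 0 fun i => i.succ.succ)) k'
          (Fin.cons y (Fin.cons z a : Fin (n + 1) → K.Dom k') : Fin (n + 2) → K.Dom k') ↔
        K.R b φ k' y a := by
      intro k' y z a
      rw [IFml.rename, hK.out.forces_subst]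
      have : (fun i : Fin (n + 1) => (Term.var ((Fin.cons 0 fun i : Fin n => i.succ.succ :
          Fin (n + 1) → Fin (n + 2)) i) : LPR.Term (Fin (n + 2))).realize
            (Fin.cons y (Fin.cons z a : Fin (n + 1) → K.Dom k') : Fin (n + 2) → K.Dom k')) =
          Fin.cons y a := by
        funext i
        refine Fin.cases ?_ (fun i => ?_) i <;> rfl
      rw [this]
      rfl
    have hψ : ∀ (k' : K.Node) (y z : K.Dom k') (a : Fin n → K.Dom k'),
        K.Forces (IFml.kleene ((ψ.rz b).subst (Fin.cons (fn PRSym.kleeneU ![vr 0])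
          fun i => vr i.succ.succ.succ))).ex k'
          (Fin.cons y (Fin.cons z a : Fin (n + 1) → K.Dom k') : Fin (n + 2) → K.Dom k') ↔
        ∃ w, App z y w ∧ K.R b ψ k' w a := by
      intro k' y z a
      have key : ∀ u : K.Dom k', K.Forces (ψ.rz b |>.subst (Fin.cons (fn PRSym.kleeneU ![vr 0])
          fun i => vr i.succ.succ.succ)) k'
          (Fin.cons u (Fin.cons y (Fin.cons z a : Fin (n + 1) → K.Dom k') :
            Fin (n + 2) → K.Dom k') : Fin (n + 3) → K.Dom k') ↔ K.R b ψ k' (tout u) a := by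
        intro u
        rw [hK.out.forces_subst, realize_cons, realize_fn₁, realize_vr, ev_kleeneU]
        rfl
      constructor
      · rintro ⟨u, hu⟩
        rw [forces_kleene, key] at hu
        exact ⟨_, ⟨u, hu.1, rfl⟩, hu.2⟩
      · rintro ⟨_, ⟨u, hu, rfl⟩, h⟩
        refine ⟨u, ?_⟩
        rw [forces_kleene, key]
        exact ⟨hu, h⟩
    constructor
    · intro H k' h y hy
      have := H k' h y k' (hK.out.refl k')
      rw [map_cons, map_cons, map_cons, hK.out.map_self, hK.out.map_self, hK.out.map_comp_self, hφ, hψ] at this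
      exact this hy
    · intro H k' h y k'' h'
      rw [map_cons, map_cons, map_cons, hφ, hψ, hK.out.map_map h h' (hK.out.trans h h'),
        hK.out.map_comp_map h h' (hK.out.trans h h')]
      exact H k'' _ _

theorem r_all_self {φ : IFml LPR (n + 1)} {z : K.Dom k} {a : Fin n → K.Dom k}
    (h : K.R b φ.all k z a) (y : K.Dom k) : ∃ w, App z y w ∧ K.R b φ k w (Fin.cons y a) := by
  have := r_all.1 h k (hK.out.refl k) y
  rwa [hK.out.map_self, hK.out.map_comp_self] at this

theorem r_imp_self {φ ψ : IFml LPR n} {z : K.Dom k} {a : Fin n → K.Dom k}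
    (h : K.R b (φ.imp ψ) k z a) {y : K.Dom k} (hy : K.R b φ k y a) :
    ∃ w, App z y w ∧ K.R b ψ k w a := by
  have := (r_imp.1 h).2 k (hK.out.refl k) y
  rw [hK.out.map_self, hK.out.map_comp_self] at this
  exact this hy

/-- Realizability combined with truth implies truth. -/
theorem R.forces {φ : IFml LPR n} {z : K.Dom k} {a : Fin n → K.Dom k} (h : K.R true φ k z a) :
    K.Forces φ k a := by
  induction φ generalizing k with
  | falsum => exact h
  | equal t s => exact r_equal.1 h
  | rel R => exact R.elim
  | and φ ψ h₁ h₂ => exact ⟨h₁ (r_and.1 h).1, h₂ (r_and.1 h).2⟩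
  | or φ ψ h₁ h₂ => exact (r_or.1 h).imp (fun h => h₁ h.2) fun h => h₂ h.2
  | imp φ ψ h₁ h₂ => exact (r_imp.1 h).1 rfl
  | all φ ih =>
    intro k' hk y
    obtain ⟨w, -, hw⟩ := r_all.1 h k' hk y
    exact ih hw
  | ex φ ih => exact ⟨_, ih (r_ex.1 h)⟩

theorem r_subst {m : ℕ} {φ : IFml LPR n} {σ : Fin n → LPR.Term (Fin m)} {z : K.Dom k}
    {a : Fin m → K.Dom k} :
    K.R b (φ.subst σ) k z a ↔ K.R b φ k z fun i => (σ i).realize a := by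
  have key : ∀ {n m : ℕ} (σ : Fin n → LPR.Term (Fin m)) {k k' : K.Node} (h : K.le k k')
      (a : Fin m → K.Dom k), (fun i => (σ i).realize (K.map h ∘ a)) =
        K.map h ∘ fun i => (σ i).realize a := by
    intro n m σ k k' h a
    funext i
    exact hK.out.realize_map h _ _
  induction φ generalizing m k with
  | falsum => exact Iff.rfl
  | equal t s =>
    rw [r_equal, IFml.subst, r_equal]
    simp only [Term.realize_subst]
  | rel R => exact R.elim
  | and φ ψ h₁ h₂ => simp only [IFml.subst, r_and, h₁, h₂]
  | or φ ψ h₁ h₂ => simp only [IFml.subst, r_or, h₁, h₂]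
  | imp φ ψ h₁ h₂ =>
    have := hK.out.forces_subst (φ.imp ψ) σ a
    rw [IFml.subst] at this
    rw [IFml.subst, r_imp, r_imp, this]
    simp only [h₁, h₂, key]
  | all φ ih =>
    rw [IFml.subst, r_all, r_all]
    simp only [ih, IsPreModel.realize_liftSubst, key]
  | ex φ ih =>
    simp only [IFml.subst, r_ex, ih, IsPreModel.realize_liftSubst]

theorem r_inst {φ : IFml LPR (n + 1)} {t : LPR.Term (Fin n)} {z : K.Dom k} {a : Fin n → K.Dom k} :
    K.R b (φ.inst t) k z a ↔ K.R b φ k z (Fin.cons (t.realize a) a) := by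
  rw [IFml.inst, r_subst, realize_cons]
  rfl

theorem r_lift {φ : IFml LPR n} {d z : K.Dom k} {a : Fin n → K.Dom k} :
    K.R b φ.lift k z (Fin.cons d a) ↔ K.R b φ k z a := r_subst

end KripkeData

/-! ### Realizability of almost negative formulas -/

namespace Prog

variable {D : Type*} [LPR.Structure D] [IsPRA D]

theorem run_fst_pr (x y : D) : fst.Run (pr x y) x := by
  simpa only [p1_pr] using run_fst (pr x y)

theorem run_snd_pr (x y : D) : snd.Run (pr x y) y := by
  simpa only [p2_pr] using run_snd (pr x y)

end Prog

/-- The function symbol of a term. -/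
def termS {n : ℕ} : LPR.Term (Fin n) → PRSym n
  | .var i => .proj i
  | .func f ts => PRSym.comp f fun i => termS (ts i)

theorem ev_termS {D : Type*} [LPR.Structure D] [IsPRA D] {n : ℕ} (t : LPR.Term (Fin n))
    (a : Fin n → D) : (termS t).ev a = t.realize a := by
  induction t with
  | var i => exact ev_proj_apply _ _
  | func f ts ih =>
    refine (IsPRA.ev_comp _ _ _).trans ?_
    simp only [ih]
    rfl

open KripkeData Prog

/-- True almost negative formulas have uniform realizers, and realizability implies truth for
them. -/
theorem IFml.IsAlmostNeg.exists_prog {n : ℕ} {φ : IFml LPR n} (hφ : φ.IsAlmostNeg) :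
    ∃ p : Prog, ∀ (b : Bool) (K : KripkeData.{0, 0, w} LPR) [Fact K.IsHAModel] (k : K.Node)
      (a : Fin n → K.Dom k),
      (K.Forces φ k a → ∃ z, p.Run (tup a) z ∧ K.R b φ k z a) ∧
      ∀ z, K.R b φ k z a → K.Forces φ k a := by
  induction φ with
  | falsum => exact ⟨.zero, fun b K _ k a => ⟨False.elim, fun _ h => h⟩⟩
  | equal t s =>
    exact ⟨.zero, fun b K _ k a => ⟨fun h => ⟨0, run_zero _, r_equal.2 h⟩, fun _ h => r_equal.1 h⟩⟩
  | rel R => exact R.elim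
  | and φ ψ h₁ h₂ =>
    obtain ⟨p, hp⟩ := h₁ hφ.1
    obtain ⟨q, hq⟩ := h₂ hφ.2
    refine ⟨p.pair q, fun b K _ k a => ⟨fun h => ?_, fun z hz => ?_⟩⟩
    · obtain ⟨y, hy, hy'⟩ := (hp b K k a).1 h.1
      obtain ⟨z, hz, hz'⟩ := (hq b K k a).1 h.2
      refine ⟨_, hy.pair hz, ?_⟩
      rw [r_and, p1_pr, p2_pr]
      exact ⟨hy', hz'⟩
    · rw [r_and] at hz
      exact ⟨(hp b K k a).2 _ hz.1, (hq b K k a).2 _ hz.2⟩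
  | or φ ψ => exact hφ.elim
  | imp φ ψ h₁ h₂ =>
    obtain ⟨p, hp⟩ := h₁ hφ.1
    obtain ⟨q, hq⟩ := h₂ hφ.2
    -- The realizer of the premise is discarded: it only witnesses that the premise is true, so that
    -- the uniform realizer of the conclusion exists.
    refine ⟨(q.comp .fst).lam, fun b K _ k a => ⟨fun h => ?_, fun z hz k' hk h => ?_⟩⟩
    · refine ⟨_, run_lam _ _, r_imp.2 ⟨fun _ => h, fun k' hk y hy => ?_⟩⟩
      obtain ⟨w, hw, hw'⟩ := (hq b K k' _).1 (h k' hk ((hp b K k' _).2 y hy))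
      refine ⟨w, ?_, hw'⟩
      rw [map_curry, map_tup]
      exact app_curry (hw.comp (run_fst_pr _ _))
    · obtain ⟨y, -, hy⟩ := (hp b K k' _).1 h
      obtain ⟨w, -, hw⟩ := (r_imp.1 hz).2 k' hk y hy
      exact (hq b K k' _).2 w hw
  | all φ ih =>
    obtain ⟨p, hp⟩ := ih hφ
    refine ⟨(p.comp (.pair .snd .fst)).lam, fun b K _ k a => ⟨fun h => ?_, fun z hz k' hk y => ?_⟩⟩
    · refine ⟨_, run_lam _ _, r_all.2 fun k' hk y => ?_⟩
      obtain ⟨w, hw, hw'⟩ := (hp b K k' _).1 (h k' hk y)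
      refine ⟨w, ?_, hw'⟩
      rw [map_curry, map_tup]
      exact app_curry (hw.comp ((run_snd_pr _ _).pair (run_fst_pr _ _)))
    · obtain ⟨w, -, hw⟩ := r_all.1 hz k' hk y
      exact (hp b K k' _).2 w hw
  | ex φ _ =>
    cases φ with
    | falsum => exact ⟨.zero, fun b K _ k a => ⟨fun ⟨_, h⟩ => h.elim, fun _ h => ⟨0, r_ex.1 h⟩⟩⟩
    | equal t s =>
      -- A true existential equation has a witness that can be found by search; this is where `∃` in
      -- front of an atomic formula is special. The second component realizes the equation and is
      -- arbitrary.
      refine ⟨(search (.eqn (termS t) (termS s))).pair .zero, fun b K _ k a =>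
        ⟨?_, fun z hz => ⟨_, r_equal.1 (r_ex.1 hz)⟩⟩⟩
      have key : ∀ d : K.Dom k, (PRSym.eqn (termS t) (termS s)).ev (Fin.cons d a) = 0 ↔
          t.realize (Fin.cons d a : Fin _ → K.Dom k) = s.realize (Fin.cons d a : Fin _ → K.Dom k) := by
        intro d
        rw [ev_eqn_eq_zero, ev_termS, ev_termS]
      rintro ⟨d, hd⟩
      obtain ⟨m, hm, hm'⟩ := run_search _ d a ((key d).2 hd)
      refine ⟨_, hm.pair (run_zero _), r_ex.2 (r_equal.2 ?_)⟩
      rw [p1_pr]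
      exact (key m).1 hm'
    | rel R => exact R.elim
    | _ => exact hφ.elim

/-! ### Realizability of the axioms -/

/-- The program `p` realizes `φ`, uniformly in all models of `HA` and, for realizability combined
with truth, in all models of `HA + ECT₀`. -/
def Prog.Realizes {n : ℕ} (p : Prog) (φ : IFml LPR n) : Prop :=
  ∀ (b : Bool) (K : KripkeData.{0, 0, w} LPR) [Fact K.IsHAModel],
    (b = true → ∀ θ ∈ ECT₀, K.Models θ) → ∀ (k : K.Node) (a : Fin n → K.Dom k),
    ∃ z, p.Run (tup a) z ∧ K.R b φ k z a

theorem Prog.Realizes.all {n : ℕ} {p : Prog} {φ : IFml LPR (n + 1)} (h : Realizes.{w} p φ) :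
    Realizes.{w} (p.comp (.pair .snd .fst)).lam φ.all := by
  intro b K _ hE k a
  refine ⟨_, run_lam _ _, r_all.2 fun k' hk y => ?_⟩
  obtain ⟨w, hw, hw'⟩ := h b K hE k' (Fin.cons y (K.map hk ∘ a))
  refine ⟨w, ?_, hw'⟩
  rw [map_curry, map_tup]
  exact app_curry (hw.comp ((run_snd_pr _ _).pair (run_fst_pr _ _)))

theorem Prog.Realizes.closeAll {n : ℕ} {p : Prog} {φ : IFml LPR n} (h : Realizes.{w} p φ) :
    ∃ q, Realizes.{w} q φ.closeAll := by
  induction n generalizing p with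
  | zero => exact ⟨p, h⟩
  | succ n ih => exact ih h.all

/-- This covers all arithmetical axioms except induction: they are almost negative and true in the
model, hence realized. -/
theorem IFml.IsAlmostNeg.exists_realizes {n : ℕ} {φ : IFml LPR n} (hφ : φ.IsAlmostNeg)
    (h : ArithAx φ.closeAll) : ∃ p, Realizes.{w} p φ.closeAll := by
  obtain ⟨p, hp⟩ := hφ.exists_prog
  refine Realizes.closeAll (p := p) fun b K hK _ k a => ?_
  exact (hp b K k a).1 (hK.out.forces_of_arithAx h k a)

section Induction

/-- The recursion that realizes induction. -/
def indProg : Prog :=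
  -- With r = ⟨r₀, r₁⟩ a realizer of the premise of induction, the value at ⟨r, 0⟩ is r₀, and from
  -- the value y at ⟨r, m⟩ the next one is {{r₁}(m)}(y).
  .recur .fst (.ap (.ap (.comp .snd .fst) (.comp .fst .snd)) (.comp .snd .snd))

/-- Induction in the model on the formula "`indProg` terminates at ⟨r, x⟩ and its value realizes
φ(x)". This is as complex as the realizability formula of `φ`, so the full schema is used. -/
theorem run_indProg {K : KripkeData.{0, 0, w} LPR} [hK : Fact K.IsHAModel] {b : Bool} {n : ℕ}
    {φ : IFml LPR (n + 1)} {k : K.Node} {r : K.Dom k} {a : Fin n → K.Dom k}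
    (h₀ : K.R b (φ.inst tZero) k (p1 r) a)
    (hs : K.R b (φ.imp (φ.subst (Fin.cons (tSucc (vr 0)) (fun i => vr i.succ)))).all k (p2 r) a)
    (x : K.Dom k) : ∃ y, indProg.Run (pr r x) y ∧ K.R b φ k y (Fin.cons x a) := by
  let f : PRSym (n + 3) := .comp .kleeneT ![indProg.sym, .pair (.proj 2) (.proj 1), .proj 0]
  let Φ : IFml LPR (n + 2) := ((IFml.equal (fn f vr) tZero).and
    ((φ.rz b).subst (Fin.cons (fn PRSym.kleeneU ![vr 0])
      (Fin.cons (vr 1) fun i => vr i.succ.succ.succ)))).ex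
  have hΦ : ∀ {k : K.Node} (x r : K.Dom k) (a : Fin n → K.Dom k),
      K.Forces Φ k (Fin.cons x (Fin.cons r a : Fin (n + 1) → K.Dom k) : Fin (n + 2) → K.Dom k) ↔
        ∃ y, indProg.Run (pr r x) y ∧ K.R b φ k y (Fin.cons x a) := by
    intro k x r a
    have h₁ : ∀ u : K.Dom k, K.Forces (IFml.equal (fn f vr) tZero) k (Fin.cons u (Fin.cons x
        (Fin.cons r a : Fin (n + 1) → K.Dom k) : Fin (n + 2) → K.Dom k) : Fin (n + 3) → K.Dom k) ↔
        IsComp indProg.code (pr r x) u := by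
      intro u
      change f.ev _ = Term.realize _ _ ↔ _
      rw [realize_tZero, ev_comp₃, ev_sym, ev_pair, ev_proj_apply, ev_proj_apply, ev_proj_apply,
        ev_kleeneT]
      rfl
    have h₂ : ∀ u : K.Dom k, K.Forces ((φ.rz b).subst (Fin.cons (fn PRSym.kleeneU ![vr 0])
        (Fin.cons (vr 1) fun i => vr i.succ.succ.succ))) k (Fin.cons u (Fin.cons x
        (Fin.cons r a : Fin (n + 1) → K.Dom k) : Fin (n + 2) → K.Dom k) : Fin (n + 3) → K.Dom k) ↔
        K.R b φ k (tout u) (Fin.cons x a) := by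
      intro u
      rw [hK.out.forces_subst, realize_cons, realize_cons, realize_fn₁, realize_vr, ev_kleeneU]
      rfl
    constructor
    · rintro ⟨u, hu⟩
      exact ⟨_, ⟨u, (h₁ u).1 hu.1, rfl⟩, (h₂ u).1 hu.2⟩
    · rintro ⟨_, ⟨u, hu, rfl⟩, h⟩
      exact ⟨u, (h₁ u).2 hu, (h₂ u).2 h⟩
  rw [← hΦ]
  refine hK.out.forces_ind Φ k _ ?_ (fun k' h x hx => ?_) x
  · rw [hΦ]
    refine ⟨_, (run_fst r).recur_zero, ?_⟩
    rw [r_inst, realize_tZero] at h₀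
    exact h₀
  · rw [map_cons, hΦ] at hx ⊢
    obtain ⟨y, hy, hy'⟩ := hx
    obtain ⟨w₁, h₁, h₁'⟩ := r_all.1 hs k' h x
    obtain ⟨w₂, h₂, h₂'⟩ := r_imp_self h₁' hy'
    have e : K.map h (p2 r) = p2 (K.map h r) := by
      conv_rhs => rw [← pr_p1_p2 r, map_pr, p2_pr]
    rw [e] at h₁
    refine ⟨w₂, hy.recur_suc (Run.ap (Run.ap ((run_snd _).comp (run_fst_pr _ _))
      ((run_fst_pr _ _).comp (run_snd_pr _ _)) h₁) ((run_snd_pr _ _).comp (run_snd_pr _ _)) h₂), ?_⟩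
    rw [r_subst, realize_cons, realize_tSucc] at h₂'
    exact h₂'

theorem realizes_indFml {n : ℕ} (φ : IFml LPR (n + 1)) :
    Realizes.{w} (lam (comp indProg.lam .snd)) (indFml φ) := by
  intro b K hK hE k a
  refine ⟨_, run_lam _ _, r_imp.2 ⟨fun _ => hK.out.forces_of_arithAx (.ind φ) k a, fun k' h r hr => ?_⟩⟩
  rw [r_and] at hr
  refine ⟨indProg.curry r, ?_, r_all.2 fun k'' h' x => ?_⟩
  · rw [map_curry]
    exact app_curry ((run_lam _ _).comp (run_snd_pr _ _))
  · have h₀ := hr.1.mono h'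
    have hs := hr.2.mono h'
    have e : ∀ x : K.Dom k', K.map h' (p1 x) = p1 (K.map h' x) := by
      intro x
      conv_rhs => rw [← pr_p1_p2 x, map_pr, p1_pr]
    have e' : ∀ x : K.Dom k', K.map h' (p2 x) = p2 (K.map h' x) := by
      intro x
      conv_rhs => rw [← pr_p1_p2 x, map_pr, p2_pr]
    rw [e] at h₀
    rw [e'] at hs
    obtain ⟨y, hy, hy'⟩ := run_indProg h₀ hs x
    refine ⟨y, ?_, hy'⟩
    rw [map_curry]
    exact app_curry hy

end Induction

theorem ArithAx.exists_realizes {φ : ISent LPR} (h : ArithAx φ) : ∃ p, Realizes.{w} p φ := by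
  cases h with
  | ind φ => exact (realizes_indFml φ).closeAll
  | succ_ne_zero => exact IFml.IsAlmostNeg.exists_realizes ⟨trivial, trivial⟩ .succ_ne_zero
  | succ_inj => exact IFml.IsAlmostNeg.exists_realizes ⟨trivial, trivial⟩ .succ_inj
  | zero_or_succ => exact IFml.IsAlmostNeg.exists_realizes ⟨⟨trivial, trivial⟩, trivial⟩ .zero_or_succ
  | add_zero => exact IFml.IsAlmostNeg.exists_realizes trivial .add_zero
  | add_succ => exact IFml.IsAlmostNeg.exists_realizes trivial .add_succ
  | mul_zero => exact IFml.IsAlmostNeg.exists_realizes trivial .mul_zero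
  | mul_succ => exact IFml.IsAlmostNeg.exists_realizes trivial .mul_succ
  | proj i => exact IFml.IsAlmostNeg.exists_realizes trivial (.proj i)
  | comp f g => exact IFml.IsAlmostNeg.exists_realizes trivial (.comp f g)
  | prec_zero f g => exact IFml.IsAlmostNeg.exists_realizes trivial (.prec_zero f g)
  | prec_succ f g => exact IFml.IsAlmostNeg.exists_realizes trivial (.prec_succ f g)

section ChurchThesis

/-- Given a program `t` for the realizers of the premise, the program that maps `⟨⟨e, v⟩, x⟩` to
the realizer of `∃ y ψ(x, y, v)` obtained from the realizer `e` of
`∀ x (φ(x, v) → ∃ y ψ(x, y, v))`. -/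
def ectCore (t : Prog) : Prog :=
  .ap (.ap (.comp .fst .fst) .snd) (t.comp (.pair .snd (.comp .snd .fst)))

/-- The program for a realizer of `φ(x, v) → ∃ u (T(z, x, u) ∧ ψ(x, U(u), v))`. -/
def ectInner (t : Prog) : Prog :=
  .pair (.comp .trace (.pair (.comp (lam (.comp .fst (ectCore t))) (.comp .fst .fst))
      (.comp .snd .fst)))
    (.pair .zero (.comp .snd (.comp (ectCore t) .fst)))

variable {K : KripkeData.{0, 0, w} LPR} [hK : Fact K.IsHAModel] {b : Bool} {n : ℕ}
  {φ : IFml LPR (n + 1)} {ψ : IFml LPR (n + 2)} {t : Prog}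

/-- The premise is almost negative, so its mere truth provides a realizer, computed from x and the
parameters by `t`. Hence the witness y is a computable function of x alone, for given e and
parameters; `curry` yields the index of this function demanded by Church's thesis. -/
theorem run_ectCore
    (ht : ∀ (k : K.Node) (a : Fin (n + 1) → K.Dom k),
      K.Forces φ k a → ∃ z, t.Run (tup a) z ∧ K.R b φ k z a)
    {k : K.Node} {e x : K.Dom k} {a : Fin n → K.Dom k} (he : K.R b (φ.imp ψ.ex).all k e a)
    (hφ : K.Forces φ k (Fin.cons x a : Fin (n + 1) → K.Dom k)) :
    ∃ y u, (ectCore t).Run (pr (pr e (tup a)) x) y ∧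
      trace.Run (pr ((comp .fst (ectCore t)).curry (pr e (tup a))) x) u ∧
      IsComp ((comp .fst (ectCore t)).curry (pr e (tup a))) x u ∧
      K.R b ψ k (p2 y) (Fin.cons (tout u) (Fin.cons x a : Fin (n + 1) → K.Dom k)) := by
  obtain ⟨d, hd, hd'⟩ := ht k _ hφ
  obtain ⟨w, hw, hw'⟩ := r_all_self he x
  obtain ⟨y, hy, hy'⟩ := r_imp_self hw' hd'
  have hrun : (ectCore t).Run (pr (pr e (tup a)) x) y :=
    Run.ap (Run.ap ((run_fst_pr _ _).comp (run_fst_pr _ _)) (run_snd_pr _ _) hw)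
      (hd.comp ((run_snd_pr _ _).pair ((run_snd_pr _ _).comp (run_fst_pr _ _)))) hy
  have happ := app_curry ((run_fst y).comp hrun)
  obtain ⟨u, hu, hu'⟩ := run_trace happ
  refine ⟨y, u, hrun, hu, hu', ?_⟩
  rw [app_unique ⟨u, hu', rfl⟩ happ]
  exact r_ex.1 hy'

/-- The realizer of the inner implication may again ignore its input, because a realized almost
negative premise is true. In the variant with truth, the truth of this implication comes from the
realizer of ψ that `run_ectCore` produces from the truth of the premise. -/
theorem r_ectInner
    (ht : ∀ (k : K.Node) (a : Fin (n + 1) → K.Dom k),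
      (K.Forces φ k a → ∃ z, t.Run (tup a) z ∧ K.R b φ k z a) ∧
      ∀ z, K.R b φ k z a → K.Forces φ k a)
    {k : K.Node} {e : K.Dom k} (x : K.Dom k) {a : Fin n → K.Dom k}
    (he : K.R b (φ.imp ψ.ex).all k e a) :
    K.R b ((φ.rename (Fin.cons 0 (fun i : Fin n => i.succ.succ))).imp
      ((IFml.equal (fn PRSym.kleeneT ![vr 2, vr 1, vr 0]) tZero).and
        (ψ.subst (Fin.cons (fn PRSym.kleeneU ![vr 0])
          (Fin.cons (vr 1) (fun i : Fin n => vr i.succ.succ.succ))))).ex) k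
      ((ectInner t).curry (pr (pr e (tup a)) x))
      (Fin.cons x (Fin.cons ((comp .fst (ectCore t)).curry (pr e (tup a))) a :
        Fin (n + 1) → K.Dom k)) := by
  have hφ : ∀ (k : K.Node) (x z : K.Dom k) (a : Fin n → K.Dom k),
      K.Forces (φ.rename (Fin.cons 0 (fun i : Fin n => i.succ.succ))) k
        (Fin.cons x (Fin.cons z a : Fin (n + 1) → K.Dom k) : Fin (n + 2) → K.Dom k) →
      K.Forces φ k (Fin.cons x a : Fin (n + 1) → K.Dom k) := by
    intro k x z a h
    rw [hK.out.forces_rename] at h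
    convert h using 1
    funext i
    refine Fin.cases ?_ (fun i => ?_) i <;> rfl
  have hφ' : ∀ (k : K.Node) (y x z : K.Dom k) (a : Fin n → K.Dom k),
      K.R b (φ.rename (Fin.cons 0 (fun i : Fin n => i.succ.succ))) k y
        (Fin.cons x (Fin.cons z a : Fin (n + 1) → K.Dom k) : Fin (n + 2) → K.Dom k) →
      K.R b φ k y (Fin.cons x a : Fin (n + 1) → K.Dom k) := by
    intro k y x z a h
    rw [IFml.rename, r_subst] at h
    convert h using 1
    funext i
    refine Fin.cases ?_ (fun i => ?_) i <;> rfl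
  refine r_imp.2 ⟨?_, fun k' h y hy => ?_⟩
  · rintro rfl k' h hf
    rw [map_cons, map_cons, map_curry, map_pr, map_tup] at hf ⊢
    obtain ⟨y, u, -, -, hu, hr⟩ := run_ectCore (fun k a => (ht k a).1) (he.mono h) (hφ _ _ _ _ hf)
    refine ⟨u, forces_kleene.2 ⟨hu, ?_⟩⟩
    rw [hK.out.forces_subst, realize_cons, realize_cons, realize_fn₁, realize_vr, ev_kleeneU]
    exact hr.forces
  · simp only [map_cons, map_curry, map_pr, map_tup] at hy ⊢
    obtain ⟨w, u, hw, hu, hu', hr⟩ := run_ectCore (fun k a => (ht k a).1) (he.mono h)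
      ((ht _ _).2 y (hφ' _ _ _ _ _ hy))
    refine ⟨pr u (pr 0 (p2 w)), ?_, ?_⟩
    · refine app_curry (Run.pair (hu.comp (Run.pair ((run_lam _ _).comp ((run_fst_pr _ _).comp
        (run_fst_pr _ _))) ((run_snd_pr _ _).comp (run_fst_pr _ _)))) (Run.pair (run_zero _)
        ((run_snd w).comp (hw.comp (run_fst_pr _ _)))))
    · rw [r_ex, r_and, p1_pr, p2_pr, p1_pr, p2_pr, r_equal, realize_fn₃, realize_tZero, r_subst,
        realize_cons, realize_cons, realize_fn₁, realize_vr, ev_kleeneU]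
      exact ⟨(ev_kleeneT _ _ _).2 hu', hr⟩

theorem exists_realizes_ectFml (hφ : φ.IsAlmostNeg) : ∃ p, Realizes.{w} p (ectFml φ ψ) := by
  obtain ⟨t, ht⟩ := hφ.exists_prog
  refine ⟨lam (comp (pair (lam (comp .fst (ectCore t))) (lam (lam (ectInner t)))) (pair .snd .fst)),
    fun b K hK hE k a => ?_⟩
  refine ⟨_, run_lam _ _, r_imp.2 ⟨fun hb => ?_, fun k' h e he => ?_⟩⟩
  -- This truth component is the only use of ECT₀ in the model; plain realizability of ECT₀ needs
  -- only HA.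
  · exact (hK.out.models_closeAll _).1 (hE hb _ ⟨n, φ, ψ, hφ, rfl⟩) k a
  · refine ⟨pr ((comp .fst (ectCore t)).curry (pr e (tup (K.map h ∘ a))))
      ((lam (ectInner t)).curry (pr e (tup (K.map h ∘ a)))), ?_, ?_⟩
    · rw [map_curry, map_tup]
      exact app_curry (Run.comp (Run.pair (run_lam _ _) (run_lam _ _))
        (Run.pair (run_snd_pr _ _) (run_fst_pr _ _)))
    · rw [r_ex, p1_pr, p2_pr, r_all]
      intro k'' h' x
      rw [map_cons, map_curry, map_curry, map_pr, map_tup]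
      exact ⟨_, app_curry (run_lam _ _), r_ectInner (ht b K) x (he.mono h')⟩

end ChurchThesis

theorem exists_realizes_of_mem {φ : ISent LPR} (h : φ ∈ HA ∪ ECT₀) : ∃ p, Realizes.{w} p φ := by
  rcases h with h | ⟨n, φ, ψ, hφ, rfl⟩
  · exact ArithAx.exists_realizes h
  · obtain ⟨p, hp⟩ := exists_realizes_ectFml (ψ := ψ) hφ
    exact hp.closeAll

/-! ### Soundness of realizability -/

namespace KripkeData

variable (K : KripkeData.{0, 0, w} LPR) [hK : Fact K.IsHAModel] (b : Bool) {n : ℕ}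

/-- The number `c` is a tuple of realizers of the formulas of a list. -/
def RList : List (IFml LPR n) → (k : K.Node) → K.Dom k → (Fin n → K.Dom k) → Prop
  | [], _, _, _ => True
  | φ :: Γ, k, c, a => K.R b φ k (p1 c) a ∧ RList Γ k (p2 c) a

variable {K b} {Γ : List (IFml LPR n)} {k : K.Node} {c : K.Dom k} {a : Fin n → K.Dom k}

theorem RList.mono {k' : K.Node} (h : K.le k k') (hr : K.RList b Γ k c a) :
    K.RList b Γ k' (K.map h c) (K.map h ∘ a) := by
  induction Γ generalizing c with
  | nil => trivial
  | cons φ Γ ih =>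
    have e := map_pr h (p1 c) (p2 c)
    rw [pr_p1_p2] at e
    rw [e, RList, p1_pr, p2_pr]
    exact ⟨hr.1.mono h, ih hr.2⟩

theorem RList.lift (d : K.Dom k) (hr : K.RList b Γ k c a) :
    K.RList b (Γ.map IFml.lift) k c (Fin.cons d a) := by
  induction Γ generalizing c with
  | nil => trivial
  | cons φ Γ ih => exact ⟨r_lift.2 hr.1, ih hr.2⟩

theorem RList.forces (hr : K.RList true Γ k c a) : ∀ φ ∈ Γ, K.Forces φ k a := by
  induction Γ generalizing c with
  | nil => simp
  | cons φ Γ ih =>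
    intro ψ hψ
    rcases List.mem_cons.1 hψ with rfl | hψ
    exacts [hr.1.forces, ih hr.2 ψ hψ]

theorem RList.cons {φ : IFml LPR n} {y : K.Dom k} (hφ : K.R b φ k y a) (hr : K.RList b Γ k c a) :
    K.RList b (φ :: Γ) k (pr y c) a := by
  rw [RList, p1_pr, p2_pr]
  exact ⟨hφ, hr⟩

end KripkeData

theorem exists_prog_of_mem {n : ℕ} {Γ : List (IFml LPR n)} {φ : IFml LPR n} (h : φ ∈ Γ) :
    ∃ p : Prog, ∀ (b : Bool) (K : KripkeData.{0, 0, w} LPR) [Fact K.IsHAModel] (k : K.Node)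
      (c : K.Dom k) (a : Fin n → K.Dom k), K.RList b Γ k c a →
      ∃ z, p.Run c z ∧ K.R b φ k z a := by
  induction Γ with
  | nil => simp at h
  | cons ψ Γ ih =>
    rcases List.mem_cons.1 h with rfl | h
    · exact ⟨.fst, fun b K _ k c a hr => ⟨_, run_fst c, hr.1⟩⟩
    · obtain ⟨p, hp⟩ := ih h
      refine ⟨p.comp .snd, fun b K _ k c a hr => ?_⟩
      obtain ⟨z, hz, hz'⟩ := hp b K k (p2 c) a hr.2
      exact ⟨z, hz.comp (run_snd c), hz'⟩

/-- The program `p` maps realizers of `Γ` to realizers of `φ`. -/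
def Prog.RealizesSeq {n : ℕ} (p : Prog) (Γ : List (IFml LPR n)) (φ : IFml LPR n) : Prop :=
  ∀ (b : Bool) (K : KripkeData.{0, 0, w} LPR) [Fact K.IsHAModel],
    (b = true → ∀ θ ∈ ECT₀, K.Models θ) → ∀ (k : K.Node) (c : K.Dom k) (a : Fin n → K.Dom k),
    K.RList b Γ k c a → ∃ z, p.Run (pr c (tup a)) z ∧ K.R b φ k z a

theorem Prog.run_term {K : KripkeData.{0, 0, w} LPR} [Fact K.IsHAModel] {n : ℕ}
    (t : LPR.Term (Fin n)) {k : K.Node} (c : K.Dom k) (a : Fin n → K.Dom k) :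
    (comp (ofPR (termS t)) .snd).Run (pr c (tup a)) (t.realize a) := by
  have := run_ofPR (termS t) a
  rw [ev_termS] at this
  exact this.comp (run_snd_pr _ _)

/-- Soundness of realizability by induction on the derivation. The program depends on the derivation
only, not on the model, the node or the variant `b`. So a computation obtained through plain
realizability over HA also serves the variant with truth. -/
theorem Deriv.exists_realizesSeq {n : ℕ} {Γ : List (IFml LPR n)} {φ : IFml LPR n}
    (h : Deriv False (HA ∪ ECT₀) Γ φ) : ∃ p, RealizesSeq.{w} p Γ φ := by
  induction h with
  | @ax n Γ φ h =>
    obtain ⟨p, hp⟩ := exists_realizes_of_mem.{w} h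
    -- Axioms are sentences, and `0` is the code of the empty tuple of parameters.
    refine ⟨p.comp .zero, fun b K hK hE k c a _ => ?_⟩
    obtain ⟨z, hz, hz'⟩ := hp b K hE k Fin.elim0
    refine ⟨z, hz.comp (run_zero _), ?_⟩
    rw [IFml.rename, r_subst]
    convert hz'
  | hyp h =>
    obtain ⟨p, hp⟩ := exists_prog_of_mem.{w} h
    refine ⟨p.comp .fst, fun b K hK hE k c a hc => ?_⟩
    obtain ⟨z, hz, hz'⟩ := hp b K k c a hc
    exact ⟨z, hz.comp (run_fst_pr _ _), hz'⟩
  | falsumE _ ih =>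
    obtain ⟨p, hp⟩ := ih
    refine ⟨p, fun b K hK hE k c a hc => ?_⟩
    obtain ⟨z, -, hz⟩ := hp b K hE k c a hc
    exact hz.elim
  | andI _ _ ih₁ ih₂ =>
    obtain ⟨p, hp⟩ := ih₁
    obtain ⟨q, hq⟩ := ih₂
    refine ⟨p.pair q, fun b K hK hE k c a hc => ?_⟩
    obtain ⟨y, hy, hy'⟩ := hp b K hE k c a hc
    obtain ⟨z, hz, hz'⟩ := hq b K hE k c a hc
    refine ⟨_, hy.pair hz, ?_⟩
    rw [r_and, p1_pr, p2_pr]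
    exact ⟨hy', hz'⟩
  | andE₁ _ ih =>
    obtain ⟨p, hp⟩ := ih
    refine ⟨.comp .fst p, fun b K hK hE k c a hc => ?_⟩
    obtain ⟨z, hz, hz'⟩ := hp b K hE k c a hc
    exact ⟨_, (run_fst z).comp hz, (r_and.1 hz').1⟩
  | andE₂ _ ih =>
    obtain ⟨p, hp⟩ := ih
    refine ⟨.comp .snd p, fun b K hK hE k c a hc => ?_⟩
    obtain ⟨z, hz, hz'⟩ := hp b K hE k c a hc
    exact ⟨_, (run_snd z).comp hz, (r_and.1 hz').2⟩
  | orI₁ _ ih =>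
    obtain ⟨p, hp⟩ := ih
    refine ⟨.pair .zero p, fun b K hK hE k c a hc => ?_⟩
    obtain ⟨z, hz, hz'⟩ := hp b K hE k c a hc
    refine ⟨_, (run_zero _).pair hz, r_or.2 (Or.inl ?_)⟩
    rw [p1_pr, p2_pr]
    exact ⟨rfl, hz'⟩
  | orI₂ _ ih =>
    obtain ⟨p, hp⟩ := ih
    refine ⟨.pair (.comp .succ .zero) p, fun b K hK hE k c a hc => ?_⟩
    obtain ⟨z, hz, hz'⟩ := hp b K hE k c a hc
    refine ⟨_, ((run_succ _).comp (run_zero _)).pair hz, r_or.2 (Or.inr ?_)⟩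
    rw [p1_pr, p2_pr]
    exact ⟨rfl, hz'⟩
  | orE _ _ _ ih₁ ih₂ ih₃ =>
    obtain ⟨p, hp⟩ := ih₁
    obtain ⟨q₁, hq₁⟩ := ih₂
    obtain ⟨q₂, hq₂⟩ := ih₃
    -- A recursion on the tag of the disjunction selects the code of `q₁` or `q₂`, and only the
    -- selected program is run, since the other one might diverge on this input.
    refine ⟨.ap (.comp (.recur q₁.quote q₂.quote) (.pair .zero (.comp .fst p)))
      (.pair (.pair (.comp .snd p) .fst) .snd), fun b K hK hE k c a hc => ?_⟩
    obtain ⟨y, hy, hy'⟩ := hp b K hE k c a hc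
    have harg : (Prog.pair (.pair (.comp .snd p) .fst) .snd).Run (pr c (tup a))
        (pr (pr (p2 y) c) (tup a)) :=
      (((run_snd y).comp hy).pair (run_fst_pr _ _)).pair (run_snd_pr _ _)
    have h₀ : (recur q₁.quote q₂.quote).Run (pr (0 : K.Dom k) 0) q₁.code :=
      (run_quote q₁ _).recur_zero
    rcases r_or.1 hy' with ⟨h, h'⟩ | ⟨h, h'⟩
    · obtain ⟨z, hz, hz'⟩ := hq₁ b K hE k (pr (p2 y) c) a (hc.cons h')
      refine ⟨z, Run.ap (Run.comp h₀ ((run_zero _).pair ?_)) harg hz, hz'⟩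
      rw [← h]
      exact (run_fst y).comp hy
    · obtain ⟨z, hz, hz'⟩ := hq₂ b K hE k (pr (p2 y) c) a (hc.cons h')
      refine ⟨z, Run.ap (Run.comp (h₀.recur_suc (run_quote q₂ _)) ((run_zero _).pair ?_)) harg hz, hz'⟩
      have := (run_fst y).comp hy
      rw [h] at this
      exact this
  | @impI n Γ φ ψ hd ih =>
    obtain ⟨p, hp⟩ := ih
    refine ⟨lam (p.comp (.pair (.pair .snd (.comp .fst .fst)) (.comp .snd .fst))),
      fun b K hK hE k c a hc => ⟨_, run_lam _ _, r_imp.2 ⟨?_, fun k' h y hy => ?_⟩⟩⟩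
    -- Realized assumptions are true in this variant, so the truth of the implication is Kripke
    -- soundness.
    · rintro rfl
      refine hK.out.sound (T := HA ∪ ECT₀) ?_ (Deriv.impI hd) k a hc.forces
      rintro θ (h | h)
      exacts [hK.out.models_HA θ h, hE rfl θ h]
    · obtain ⟨z, hz, hz'⟩ := hp b K hE k' (pr y (K.map h c)) (K.map h ∘ a) ((hc.mono h).cons hy)
      refine ⟨z, ?_, hz'⟩
      rw [map_curry, map_pr, map_tup]
      exact app_curry (hz.comp (((run_snd_pr _ _).pair ((run_fst_pr _ _).comp (run_fst_pr _ _))).pair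
        ((run_snd_pr _ _).comp (run_fst_pr _ _))))
  | impE _ _ ih₁ ih₂ =>
    obtain ⟨p, hp⟩ := ih₁
    obtain ⟨q, hq⟩ := ih₂
    refine ⟨.ap p q, fun b K hK hE k c a hc => ?_⟩
    obtain ⟨y, hy, hy'⟩ := hp b K hE k c a hc
    obtain ⟨z, hz, hz'⟩ := hq b K hE k c a hc
    obtain ⟨w, hw, hw'⟩ := r_imp_self hy' hz'
    exact ⟨w, Run.ap hy hz hw, hw'⟩
  | allI _ ih =>
    obtain ⟨p, hp⟩ := ih
    refine ⟨lam (p.comp (.pair (.comp .fst .fst) (.pair .snd (.comp .snd .fst)))),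
      fun b K hK hE k c a hc => ⟨_, run_lam _ _, r_all.2 fun k' h y => ?_⟩⟩
    obtain ⟨z, hz, hz'⟩ := hp b K hE k' (K.map h c) (Fin.cons y (K.map h ∘ a))
      ((hc.mono h).lift y)
    refine ⟨z, ?_, hz'⟩
    rw [map_curry, map_pr, map_tup]
    exact app_curry (hz.comp (((run_fst_pr _ _).comp (run_fst_pr _ _)).pair
      ((run_snd_pr _ _).pair ((run_snd_pr _ _).comp (run_fst_pr _ _)))))
  | allE t _ ih =>
    obtain ⟨p, hp⟩ := ih
    refine ⟨.ap p (comp (ofPR (termS t)) .snd), fun b K hK hE k c a hc => ?_⟩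
    obtain ⟨y, hy, hy'⟩ := hp b K hE k c a hc
    obtain ⟨w, hw, hw'⟩ := r_all_self hy' (t.realize a)
    exact ⟨w, Run.ap hy (run_term t c a) hw, r_inst.2 hw'⟩
  | exI t _ ih =>
    obtain ⟨p, hp⟩ := ih
    refine ⟨.pair (comp (ofPR (termS t)) .snd) p, fun b K hK hE k c a hc => ?_⟩
    obtain ⟨y, hy, hy'⟩ := hp b K hE k c a hc
    refine ⟨_, (run_term t c a).pair hy, r_ex.2 ?_⟩
    rw [p1_pr, p2_pr]
    exact r_inst.1 hy'
  | exE _ _ ih₁ ih₂ =>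
    obtain ⟨p, hp⟩ := ih₁
    obtain ⟨q, hq⟩ := ih₂
    refine ⟨q.comp (.pair (.pair (.comp .snd p) .fst) (.pair (.comp .fst p) .snd)),
      fun b K hK hE k c a hc => ?_⟩
    obtain ⟨y, hy, hy'⟩ := hp b K hE k c a hc
    obtain ⟨z, hz, hz'⟩ := hq b K hE k (pr (p2 y) c) (Fin.cons (p1 y) a)
      ((hc.lift _).cons (r_ex.1 hy'))
    exact ⟨z, hz.comp ((((run_snd y).comp hy).pair (run_fst_pr _ _)).pair
      (((run_fst y).comp hy).pair (run_snd_pr _ _))), r_lift.1 hz'⟩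
  | eqRefl t => exact ⟨.zero, fun b K hK hE k c a _ => ⟨0, run_zero _, r_equal.2 rfl⟩⟩
  | eqSubst φ _ _ ih₁ ih₂ =>
    obtain ⟨p, hp⟩ := ih₁
    obtain ⟨q, hq⟩ := ih₂
    refine ⟨q, fun b K hK hE k c a hc => ?_⟩
    obtain ⟨y, -, hy⟩ := hp b K hE k c a hc
    obtain ⟨z, hz, hz'⟩ := hq b K hE k c a hc
    rw [r_inst, r_equal.1 hy] at hz'
    exact ⟨z, hz, r_inst.2 hz'⟩
  | dne h => exact h.elim

/-! ### Classical satisfaction -/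

namespace IFml

variable {L : FirstOrder.Language.{u, v}} {D : Type w} [L.Structure D]

theorem realize_subst {n m : ℕ} (φ : IFml L n) (σ : Fin n → L.Term (Fin m)) (a : Fin m → D) :
    (φ.subst σ).Realize a ↔ φ.Realize fun i => (σ i).realize a := by
  induction φ generalizing m with
  | falsum => rfl
  | equal t s => simp [subst, Realize, Term.realize_subst]
  | rel R ts => simp [subst, Realize, Term.realize_subst]
  | and φ ψ h₁ h₂ => simp only [subst, Realize, h₁, h₂]
  | or φ ψ h₁ h₂ => simp only [subst, Realize, h₁, h₂]
  | imp φ ψ h₁ h₂ => simp only [subst, Realize, h₁, h₂]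
  | all φ ih => simp only [subst, Realize, ih, IsPreModel.realize_liftSubst]
  | ex φ ih => simp only [subst, Realize, ih, IsPreModel.realize_liftSubst]

theorem realize_lift {n : ℕ} (φ : IFml L n) (d : D) (a : Fin n → D) :
    φ.lift.Realize (Fin.cons d a : Fin (n + 1) → D) ↔ φ.Realize a := realize_subst φ _ _

theorem realize_of_closeAll {n : ℕ} {φ : IFml L n} (h : φ.closeAll.TrueIn D) (a : Fin n → D) :
    φ.Realize a := by
  induction n with
  | zero => rwa [Subsingleton.elim a Fin.elim0]
  | succ n ih =>
    have := ih (φ := φ.all) h (Fin.tail a) (a 0)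
    rwa [Fin.cons_self_tail] at this

theorem IsQF.subst {n m : ℕ} {φ : IFml L n} (h : φ.IsQF) (σ : Fin n → L.Term (Fin m)) :
    (φ.subst σ).IsQF := by
  induction φ generalizing m with
  | falsum => trivial
  | equal t s => trivial
  | rel R ts => trivial
  | and φ ψ h₁ h₂ => exact ⟨h₁ h.1 σ, h₂ h.2 σ⟩
  | or φ ψ h₁ h₂ => exact ⟨h₁ h.1 σ, h₂ h.2 σ⟩
  | imp φ ψ h₁ h₂ => exact ⟨h₁ h.1 σ, h₂ h.2 σ⟩
  | all φ _ => exact h.elim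
  | ex φ _ => exact h.elim

theorem IsPi2.closeAll {n : ℕ} {φ : IFml L n} (h : φ.IsPi2) : φ.closeAll.IsPi2 := by
  induction n with
  | zero => exact h
  | succ n ih => exact ih h.all

/-- The conjunction of a list of formulas. -/
def conj {n : ℕ} : List (IFml L n) → IFml L n
  | [] => falsum.imp falsum
  | φ :: Γ => φ.and (conj Γ)

theorem isQF_conj {n : ℕ} {Γ : List (IFml L n)} (h : ∀ φ ∈ Γ, φ.IsQF) : (conj Γ).IsQF := by
  induction Γ with
  | nil => exact ⟨trivial, trivial⟩
  | cons φ Γ ih =>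
    rw [List.forall_mem_cons] at h
    exact ⟨h.1, ih h.2⟩

theorem realize_conj {n : ℕ} {Γ : List (IFml L n)} {a : Fin n → D} :
    (conj Γ).Realize a ↔ ∀ φ ∈ Γ, φ.Realize a := by
  induction Γ with
  | nil => simp [conj, Realize]
  | cons φ Γ ih =>
    rw [List.forall_mem_cons, ← ih]
    rfl

end IFml

/-! ### Transfer from Heyting arithmetic to models of the `Π₂`-consequences of Peano arithmetic -/

/-- Quantifier-free formulas are decided at every node, so ∃ may be moved in front: the models force
∃d (δ → ψ), with any d if δ fails. By completeness HA proves the universal closure, which is Π₂ and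
provable in PA, hence true in M. -/
theorem ModelsThPi2PA.exists_realize {M : Type w} [LPR.Structure M] (hM : ModelsThPi2PA M) {m : ℕ}
    {δ : IFml LPR m} {ψ : IFml LPR (m + 1)} (hδ : δ.IsQF) (hψ : ψ.IsQF)
    (h : ∀ (K : KripkeData.{0, 0, w} LPR), K.IsHAModel → ∀ (k : K.Node) (a : Fin m → K.Dom k),
      K.Forces δ k a → ∃ d, K.Forces ψ k (Fin.cons d a : Fin (m + 1) → K.Dom k))
    {e : Fin m → M} (he : δ.Realize e) :
    ∃ d : M, ψ.Realize (Fin.cons d e : Fin (m + 1) → M) := by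
  have hqf : (δ.lift.imp ψ).IsQF := ⟨hδ.subst _, hψ⟩
  have hp : ProvI HA (δ.lift.imp ψ).ex.closeAll := by
    by_contra hn
    obtain ⟨K, hK, -, -, hHA, hφ⟩ := exists_preModel_of_not_provI.{0, w} tZero hn
    have hK : K.IsHAModel := ⟨hK, hHA⟩
    rw [hK.models_closeAll] at hφ
    apply hφ
    intro k a
    have key : ∀ d : K.Dom k, (K.Forces δ k a → K.Forces ψ k (Fin.cons d a : Fin (m + 1) → K.Dom k)) →
        K.Forces (δ.lift.imp ψ).ex k a := by
      intro d hd
      refine ⟨d, ?_⟩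
      rw [hK.forces_iff_realize hδ, hK.forces_iff_realize hψ, ← IFml.realize_lift δ d] at hd
      rw [hK.forces_iff_realize hqf]
      exact hd
    by_cases hf : K.Forces δ k a
    · obtain ⟨d, hd⟩ := h K hK k a hf
      exact key d fun _ => hd
    · exact key 0 fun h => (hf h).elim
  have := hM _ (IFml.IsPi2.closeAll (.sigma (.ex (.qf hqf))))
    (Deriv.mono (T' := PA) hp False.elim subset_rfl)
  obtain ⟨d, hd⟩ := IFml.realize_of_closeAll this e
  exact ⟨d, hd ((IFml.realize_lift δ d e).2 he)⟩

/-! ### Literals -/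

namespace IFml

variable {L : FirstOrder.Language.{u, v}}

/-- Atomic and negated atomic formulas. -/
def IsLiteral {n : ℕ} (φ : IFml L n) : Prop :=
  φ.IsAtomic ∨ ∃ p : IFml L n, p.IsAtomic ∧ φ = p.neg

theorem IsAtomic.isQF {n : ℕ} {φ : IFml L n} (h : φ.IsAtomic) : φ.IsQF := by
  cases φ <;> trivial

theorem IsLiteral.isQF {n : ℕ} {φ : IFml L n} (h : φ.IsLiteral) : φ.IsQF := by
  rcases h with h | ⟨p, hp, rfl⟩
  exacts [h.isQF, ⟨hp.isQF, trivial⟩]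

variable {L' : FirstOrder.Language.{w, z}} {X : Type*}

theorem IsAtomic.tr (g : L →ᴸ L') {n m : ℕ} {φ : IFml L[[X]] n} (h : φ.IsAtomic)
    (ρ : X → L'.Term (Fin m)) (f : Fin n → L'.Term (Fin m)) : (φ.tr g ρ f).IsAtomic := by
  cases φ with
  | falsum => trivial
  | equal => trivial
  | rel R ts =>
    rcases R with R | R
    · trivial
    · exact Empty.elim R
  | _ => exact h.elim

theorem IsLiteral.tr (g : L →ᴸ L') {n m : ℕ} {φ : IFml L[[X]] n} (h : φ.IsLiteral)
    (ρ : X → L'.Term (Fin m)) (f : Fin n → L'.Term (Fin m)) : (φ.tr g ρ f).IsLiteral := by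
  rcases h with h | ⟨p, hp, rfl⟩
  · exact Or.inl (h.tr g ρ f)
  · exact Or.inr ⟨_, hp.tr g ρ f, rfl⟩

end IFml

/-- True literals are realized by every number. -/
theorem IFml.IsLiteral.r {K : KripkeData.{0, 0, w} LPR} [Fact K.IsHAModel] {b : Bool} {n : ℕ}
    {φ : IFml LPR n} (h : φ.IsLiteral) {k : K.Node} {z : K.Dom k} {a : Fin n → K.Dom k}
    (hf : K.Forces φ k a) : K.R b φ k z a := by
  have key : ∀ {φ : IFml LPR n}, φ.IsAtomic → ∀ {k : K.Node} {z : K.Dom k} {a : Fin n → K.Dom k},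
      K.R b φ k z a ↔ K.Forces φ k a := by
    intro φ h k z a
    cases φ with
    | falsum => rfl
    | equal => exact r_equal
    | rel R => exact R.elim
    | _ => exact h.elim
  rcases h with h | ⟨p, hp, rfl⟩
  · exact (key h).2 hf
  · exact r_imp.2 ⟨fun _ => hf, fun k' h y hy => (hf k' h ((key hp).1 hy)).elim⟩

/-- Literals have no computational content: once they are true, every number is a tuple of
realizers, and `0` can be used later. -/
theorem KripkeData.RList.of_literals {K : KripkeData.{0, 0, w} LPR} [Fact K.IsHAModel] {b : Bool}
    {n : ℕ} {Γ : List (IFml LPR n)} (h : ∀ φ ∈ Γ, φ.IsLiteral) {k : K.Node} {a : Fin n → K.Dom k}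
    (hf : ∀ φ ∈ Γ, K.Forces φ k a) (c : K.Dom k) : K.RList b Γ k c a := by
  induction Γ generalizing c with
  | nil => trivial
  | cons φ Γ ih =>
    rw [List.forall_mem_cons] at h hf
    exact ⟨h.1.r hf.1, ih h.2 hf.2 _⟩

/-! ### Reducts of models in the language with constants -/

theorem realize_trTerm {L : FirstOrder.Language.{u, v}} {X D α β : Type*} [L.Structure D]
    [L[[X]].Structure D] [(L.lhomWithConstants X).IsExpansionOn D] (ρ : X → L.Term β)
    (f : α → L.Term β) (t : L[[X]].Term α) (a : β → D)
    (h : ∀ x ∈ termConsts t, (ρ x).realize a = ((L.con x : L[[X]].Constants) : D)) :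
    (trTerm (LHom.id L) ρ f t).realize a = t.realize fun i => (f i).realize a := by
  induction t using withConstants_term_induction with
  | hvar => rfl
  | hfun F ts ih =>
    have := fun i => ih i fun x hx => h x (Set.mem_iUnion.2 ⟨i, hx⟩)
    simp only [trTerm_func, Term.realize_func, this]
    exact ((L.lhomWithConstants X).map_onFunction F _).symm
  | hcon x =>
    rw [trTerm_con, h x rfl, conTerm, Term.realize_constants]

namespace KripkeData

variable {M : Type w} (K : KripkeData.{w, 0, w} (LPR[[M]]))

instance reductStr (k : K.Node) : LPR.Structure (K.Dom k) :=
  (LPR.lhomWithConstants M).reduct (K.Dom k)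

/-- The reduct of a Kripke model to the language without constants. -/
@[reducible] def reduct : KripkeData.{0, 0, w} LPR where
  Node := K.Node
  le := K.le
  Dom := K.Dom
  str := K.reductStr
  map := K.map

/-- The interpretation of the constants. -/
def cst (k : K.Node) (c : M) : K.Dom k := ((LPR.con c : LPR[[M]].Constants) : K.Dom k)

variable {K}

theorem IsPreModel.reduct (hK : K.IsPreModel) : K.reduct.IsPreModel :=
  ⟨hK.refl, hK.trans, hK.map_self, hK.map_map, fun h _ _ a => hK.map_fun h _ a,
    fun _ _ R => R.elim⟩

theorem IsPreModel.map_cst (hK : K.IsPreModel) {k k' : K.Node} (h : K.le k k') (c : M) :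
    K.map h (K.cst k c) = K.cst k' c := by
  refine (hK.map_fun h (LPR.con c) default).trans ?_
  exact congrArg _ (Subsingleton.elim _ _)

theorem realize_trTerm {n m : ℕ} (ρ : M → LPR.Term (Fin m))
    (f : Fin n → LPR.Term (Fin m)) (t : LPR[[M]].Term (Fin n)) {k : K.Node}
    (a : Fin m → K.Dom k) (h : ∀ x ∈ termConsts t, (ρ x).realize a = K.cst k x) :
    (trTerm (LHom.id LPR) ρ f t).realize a =
      t.realize fun i => (f i).realize a := by
  exact _root_.realize_trTerm (D := K.Dom k) ρ f t a h

/-- Constants may be traded for terms that have the same values at the node, and the transition maps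
preserve this agreement. This links the language with constants to the arithmetical language of
realizability. -/
theorem IsPreModel.forces_tr (hK : K.IsPreModel) {n m : ℕ} (φ : IFml LPR[[M]] n)
    (ρ : M → LPR.Term (Fin m)) (f : Fin n → LPR.Term (Fin m)) {k : K.Node}
    (a : Fin m → K.Dom k) (h : ∀ x ∈ φ.consts, (ρ x).realize a = K.cst k x) :
    K.reduct.Forces (φ.tr (LHom.id LPR) ρ f) k a ↔
      K.Forces φ k fun i => (f i).realize a := by
  have key : ∀ {n m : ℕ} {φ : IFml LPR[[M]] n} {ρ : M → LPR.Term (Fin m)} {k k' : K.Node}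
      (hk : K.le k k') {a : Fin m → K.Dom k}, (∀ x ∈ φ.consts, (ρ x).realize a = K.cst k x) →
      ∀ x ∈ φ.consts, (ρ x).realize (K.map hk ∘ a) = K.cst k' x := by
    intro n m φ ρ k k' hk a h x hx
    rw [hK.reduct.realize_map, h x hx]
    exact hK.map_cst hk x
  have key₂ : ∀ {n m : ℕ} (f : Fin n → LPR.Term (Fin m)) {k k' : K.Node} (hk : K.le k k')
      (a : Fin m → K.Dom k),
      (fun i => (f i).realize (K.map hk ∘ a)) =
        K.map hk ∘ fun i => (f i).realize a := by
    intro n m f k k' hk a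
    funext i
    exact hK.reduct.realize_map _ _ _
  have key₃ : ∀ {n m : ℕ} {φ : IFml LPR[[M]] n} {ρ : M → LPR.Term (Fin m)} {k : K.Node}
      {a : Fin m → K.Dom k} (d : K.Dom k),
      (∀ x ∈ φ.consts, (ρ x).realize a = K.cst k x) →
      ∀ x ∈ φ.consts, ((ρ x).relabel Fin.succ).realize
        (Fin.cons d a : Fin (m + 1) → K.Dom k) = K.cst k x := by
    intro n m φ ρ k a d h x hx
    rw [Term.realize_relabel]
    exact h x hx
  induction φ generalizing m k with
  | falsum => rfl
  | equal t s =>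
    change _ = _ ↔ _ = _
    rw [realize_trTerm ρ f t a fun x hx => h x (Or.inl hx),
      realize_trTerm ρ f s a fun x hx => h x (Or.inr hx)]
  | rel R => rcases R with R | R <;> exact Empty.elim R
  | and φ ψ h₁ h₂ =>
    exact and_congr (h₁ ρ f a fun x hx => h x (Or.inl hx)) (h₂ ρ f a fun x hx => h x (Or.inr hx))
  | or φ ψ h₁ h₂ =>
    exact or_congr (h₁ ρ f a fun x hx => h x (Or.inl hx)) (h₂ ρ f a fun x hx => h x (Or.inr hx))
  | imp φ ψ h₁ h₂ =>
    refine forall_congr' fun k' => forall_congr' fun hk => ?_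
    have h' := key (φ := φ.imp ψ) hk h
    rw [← key₂ f hk a]
    exact imp_congr (h₁ ρ f _ fun x hx => h' x (Or.inl hx)) (h₂ ρ f _ fun x hx => h' x (Or.inr hx))
  | all φ ih =>
    refine forall_congr' fun k' => forall_congr' fun hk => forall_congr' fun d => ?_
    rw [← key₂ f hk a, ← IsPreModel.realize_liftSubst (D := K.Dom k')]
    exact ih _ _ _ (key₃ d (key (φ := φ) hk h))
  | ex φ ih =>
    refine exists_congr fun d => ?_
    rw [← IsPreModel.realize_liftSubst (D := K.Dom k)]
    exact ih _ _ _ (key₃ d h)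

theorem IsPreModel.models_reduct (hK : K.IsPreModel) (φ : ISent LPR) :
    K.reduct.Models φ ↔ K.Models (φ.onLang (LPR.lhomWithConstants M)) := by
  refine forall_congr' fun k => ?_
  have := hK.forces_tr (φ.onLang (LPR.lhomWithConstants M)) (fun _ => tZero) Fin.elim0
    (k := k) Fin.elim0 (by simp [IFml.consts_onLang])
  rw [IFml.tr_onLang, IFml.onLang_id] at this
  have e : φ.subst (Fin.elim0 : Fin 0 → LPR.Term (Fin 0)) = φ := by
    conv_rhs => rw [← IFml.subst_var φ]
    congr 1
    exact Subsingleton.elim _ _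
  rw [e] at this
  refine this.trans ?_
  exact ⟨forces_sentence, forces_sentence⟩

end KripkeData

/-! ### The theory `T_M` -/

namespace KripkeData

variable {M : Type w} {K : KripkeData.{w, 0, w} (LPR[[M]])}

theorem realize_conTerm {α : Type*} (c : M) {k : K.Node} (a : α → K.Dom k) :
    (conTerm LPR c).realize a = K.cst k c := Term.realize_constants

variable [LPR.Structure M]

theorem isHAModel_reduct (hK : K.IsPreModel) (hT : ∀ θ ∈ TM M, K.Models θ) :
    K.reduct.IsHAModel :=
  ⟨hK.reduct, fun θ hθ => (hK.models_reduct θ).2 (hT _ (Or.inl ⟨θ, Or.inl hθ, rfl⟩))⟩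

theorem models_ECT_reduct (hK : K.IsPreModel) (hT : ∀ θ ∈ TM M, K.Models θ) :
    ∀ θ ∈ ECT₀, K.reduct.Models θ :=
  fun θ hθ => (hK.models_reduct θ).2 (hT _ (Or.inl ⟨θ, Or.inr hθ, rfl⟩))

theorem realize_conTerm_self {α : Type*} (c : M) (a : α → M) :
    (conTerm LPR c).realize a = c := Term.realize_constants

/-- The equation f(a) = c true in M is an atomic sentence of the diagram and is therefore forced. So
M maps homomorphically into every node. -/
theorem cst_ev (hT : ∀ θ ∈ TM M, K.Models θ) (k : K.Node) {n : ℕ} (f : PRSym n) (a : Fin n → M) :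
    K.cst k (f.ev a) = f.ev (K.cst k ∘ a) := by
  let θ : ISent (LPR[[M]]) := .equal (.func (Sum.inl f) fun i => conTerm LPR (a i))
    (conTerm LPR (f.ev a))
  have hθ : θ ∈ TM M := by
    refine Or.inr ⟨?_, Or.inl trivial⟩
    change Term.realize _ _ = Term.realize _ _
    simp only [realize_conTerm_self]
    exact (LPR.lhomWithConstants M).map_onFunction (M := M) f a
  have : (f.ev fun i => (conTerm LPR (a i)).realize (Fin.elim0 : Fin 0 → K.Dom k)) =
      (conTerm LPR (f.ev a)).realize (Fin.elim0 : Fin 0 → K.Dom k) := hT θ hθ k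
  simp only [realize_conTerm] at this
  exact this.symm

/-- Distinct elements are kept apart by the negated equations of the diagram. -/
theorem cst_injective (hT : ∀ θ ∈ TM M, K.Models θ) (hK : K.IsPreModel) (k : K.Node) :
    Function.Injective (K.cst k) := by
  intro c d h
  by_contra hn
  let θ : ISent (LPR[[M]]) := .equal (conTerm LPR c) (conTerm LPR d)
  have hθ : θ.neg ∈ TM M := by
    refine Or.inr ⟨fun h => hn ?_, Or.inr ⟨θ, trivial, rfl⟩⟩
    change Term.realize _ _ = Term.realize _ _ at h
    rwa [realize_conTerm_self, realize_conTerm_self] at h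
  refine hK.forces_imp (hT _ hθ k) ?_
  change Term.realize _ _ = Term.realize _ _
  rw [realize_conTerm, realize_conTerm, h]

end KripkeData

/-! ### From proofs in `TM M` to realizers in M. -/

section

variable {M : Type w}

open Classical in
/-- Replace the constants in the range of `e` by variables. -/
noncomputable def constVar {m : ℕ} (e : Fin m → M) (x : M) : LPR.Term (Fin m) :=
  -- The default `tZero` is immaterial: in the applications all constants that occur lie in the
  -- range of `e`.
  if h : ∃ i, e i = x then vr h.choose else tZero

theorem constVar_spec {m : ℕ} {e : Fin m → M} {x : M} (h : x ∈ Set.range e) :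
    ∃ i, e i = x ∧ constVar e x = vr i := by
  have h : ∃ i, e i = x := h
  exact ⟨h.choose, h.choose_spec, dif_pos h⟩

theorem realize_constVar {m : ℕ} {e : Fin m → M} {x : M} (h : x ∈ Set.range e) {D : Type*}
    [LPR.Structure D] (g : M → D) : (constVar e x).realize (g ∘ e) = g x := by
  obtain ⟨i, rfl, hi⟩ := constVar_spec h
  rw [hi]
  rfl

/-- The formula without constants from which a sentence is obtained by the substitution of the
constants for the elements `e`. -/
noncomputable def IFml.abs {m : ℕ} (e : Fin m → M) {n : ℕ} (φ : IFml (LPR[[M]]) n)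
    (f : Fin n → LPR.Term (Fin m)) : IFml LPR m :=
  φ.tr (LHom.id LPR) (constVar e) f

theorem KripkeData.IsPreModel.forces_abs {K : KripkeData.{w, 0, w} (LPR[[M]])} (hK : K.IsPreModel)
    {m n : ℕ} {e : Fin m → M} {φ : IFml (LPR[[M]]) n} (hφ : φ.consts ⊆ Set.range e)
    (f : Fin n → LPR.Term (Fin m)) (k : K.Node) :
    K.reduct.Forces (φ.abs e f) k (K.cst k ∘ e) ↔
      K.Forces φ k fun i => (f i).realize (K.cst k ∘ e) :=
  hK.forces_tr φ (constVar e) f _ fun _ hx => realize_constVar (hφ hx) _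

theorem mem_map_abs {m : ℕ} {e : Fin m → M} {Δ : List (ISent (LPR[[M]]))} {P : IFml LPR m → Prop}
    (h : ∀ δ ∈ Δ, P (δ.abs e Fin.elim0)) : ∀ δ ∈ Δ.map fun δ => δ.abs e Fin.elim0, P δ := by
  intro _ h'
  obtain ⟨δ, hδ, rfl⟩ := List.mem_map.1 h'
  exact h δ hδ

variable [LPR.Structure M]

theorem IFml.IsLiteral.realize_abs {m : ℕ} {e : Fin m → M} {φ : ISent (LPR[[M]])}
    (h : φ.IsLiteral) (hφ : φ.consts ⊆ Set.range e) (hM : φ.TrueIn M) :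
    (φ.abs e Fin.elim0).Realize e := by
  have key : ∀ {φ : ISent (LPR[[M]])}, φ.IsAtomic → φ.consts ⊆ Set.range e →
      ((φ.abs e Fin.elim0).Realize e ↔ φ.TrueIn M) := by
    intro φ h hφ
    cases φ with
    | falsum => rfl
    | equal t s =>
      have ht : ∀ {t : LPR[[M]].Term (Fin 0)}, termConsts t ⊆ Set.range e →
          (trTerm (LHom.id LPR) (constVar e) Fin.elim0 t).realize e =
            t.realize (Fin.elim0 : Fin 0 → M) := by
        intro t ht
        rw [realize_trTerm (D := M) _ _ t e fun x hx => realize_constVar (ht hx) id]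
        congr 1
        exact Subsingleton.elim _ _
      change _ = _ ↔ _ = _
      rw [ht (Set.subset_union_left.trans hφ), ht (Set.subset_union_right.trans hφ)]
    | rel R => rcases R with R | R <;> exact Empty.elim R
    | _ => exact h.elim
  rcases h with h | ⟨p, hp, rfl⟩
  · exact (key h hφ).2 hM
  · exact fun h => hM ((key hp (Set.subset_union_left.trans hφ)).1 h)

/-- A sentence provable in `T_M` is realized by a program from the true literals of `M`. -/
theorem exists_realizesSeq_of_provI {χ : ISent (LPR[[M]])} (h : ProvI (TM M) χ) :
    ∃ (m : ℕ) (e : Fin m → M) (Δ : List (ISent (LPR[[M]]))) (p : Prog), χ.consts ⊆ Set.range e ∧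
      (∀ δ ∈ Δ, δ ∈ Diag LPR M ∧ δ.consts ⊆ Set.range e) ∧
      RealizesSeq.{w} p (Δ.map fun δ => δ.abs e Fin.elim0) (χ.abs e Fin.elim0) := by
  obtain ⟨Δ, hΔ, d⟩ := ProvI.exists_list h
  have hfin : (χ.consts ∪ ⋃ δ ∈ {δ | δ ∈ Δ}, IFml.consts δ).Finite :=
    (IFml.consts_finite χ).union (Set.Finite.biUnion (List.finite_toSet Δ)
      fun δ _ => IFml.consts_finite δ)
  obtain ⟨m, e, -, he⟩ := hfin.fin_param
  -- The axioms from HA and ECT₀ contain no constants, so replacing the constants by variables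
  -- leaves them alone; the diagram sentences have become open assumptions about these variables.
  have d' := d.tr (T' := HA ∪ ECT₀) (LHom.id LPR) ∅ (fun _ => tZero) (by
    rintro _ ⟨θ, hθ, rfl⟩ m ρ -
    refine ⟨θ, hθ, ?_⟩
    rw [IFml.tr_onLang, IFml.onLang_id, IFml.rename]
    congr 1
    exact Subsingleton.elim _ _) (constVar e) (by simp) Fin.elim0
  obtain ⟨p, hp⟩ := d'.exists_realizesSeq
  refine ⟨m, e, Δ, p, he ▸ Set.subset_union_left, fun δ hδ => ⟨hΔ δ hδ, ?_⟩, hp⟩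
  rw [he]
  exact (Set.subset_biUnion_of_mem (u := fun δ => IFml.consts δ) (show δ ∈ {δ | δ ∈ Δ} from hδ)).trans
    Set.subset_union_right

theorem isLiteral_of_mem_diag {δ : ISent (LPR[[M]])} (h : δ ∈ Diag LPR M) : δ.IsLiteral := h.2

/-- `T_M` is consistent. -/
theorem not_provI_falsum (hM : ModelsThPi2PA M) : ¬ ProvI (TM M) .falsum := by
  intro h
  obtain ⟨m, e, Δ, p, -, hΔ, hp⟩ := exists_realizesSeq_of_provI h
  have hl := mem_map_abs (P := IFml.IsLiteral) fun δ hδ =>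
    (isLiteral_of_mem_diag (hΔ δ hδ).1).tr (LHom.id LPR) (constVar e) Fin.elim0
  -- The existential quantifier is vacuous here. Plain realizability shows that no model of HA
  -- forces the literals, so HA refutes their conjunction, although they are true in M.
  have := hM.exists_realize (ψ := .falsum) (e := e)
    (IFml.isQF_conj fun δ hδ => (hl δ hδ).isQF) trivial
    (by
      intro K hK k a ha
      have : Fact K.IsHAModel := ⟨hK⟩
      rw [hK.forces_iff_realize (IFml.isQF_conj fun δ hδ => (hl δ hδ).isQF), IFml.realize_conj] at ha
      obtain ⟨z, -, hz⟩ := hp false K (by simp) k 0 a (RList.of_literals hl (fun δ hδ => by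
        rw [hK.forces_iff_realize (hl δ hδ).isQF]
        exact ha δ hδ) 0)
      exact hz.elim)
    (IFml.realize_conj.2 (mem_map_abs fun δ hδ =>
      (isLiteral_of_mem_diag (hΔ δ hδ).1).realize_abs (hΔ δ hδ).2 (hΔ δ hδ).1.1))
  obtain ⟨d, hd⟩ := this
  exact hd

/-- A sentence provable in `T_M` has a realizer in `M`. -/
theorem exists_realizer (hM : ModelsThPi2PA M) {χ : ISent (LPR[[M]])} (h : ProvI (TM M) χ) :
    ∃ (m : ℕ) (e : Fin m → M) (c : M), χ.consts ⊆ Set.range e ∧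
      ∀ K : KripkeData.{w, 0, w} (LPR[[M]]), K.IsPreModel → (∀ θ ∈ TM M, K.Models θ) →
        ∀ k : K.Node, K.reduct.R true (χ.abs e Fin.elim0) k (K.cst k c) (K.cst k ∘ e) := by
  obtain ⟨m, e, Δ, p, hχ, hΔ, hp⟩ := exists_realizesSeq_of_provI h
  have hl := mem_map_abs (P := IFml.IsLiteral) fun δ hδ =>
    (isLiteral_of_mem_diag (hΔ δ hδ).1).tr (LHom.id LPR) (constVar e) Fin.elim0
  let f : PRSym (m + 1) := .comp .kleeneT
    ![p.sym, .pair (.num 0) (.tupS fun i => .proj i.succ), .proj 0]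
  have hf : ∀ {D : Type w} [LPR.Structure D] [IsPRA D] (u : D) (a : Fin m → D),
      f.ev (Fin.cons u a) = 0 ↔ IsComp p.code (pr 0 (tup a)) u := by
    intro D _ _ u a
    simp only [f, ev_comp₃, ev_kleeneT, ev_sym, ev_pair, ev_num, ev_tupS, ev_proj_apply]
    rfl
  -- Termination is transferred to M by plain realizability, which needs only HA; the models
  -- considered here need not satisfy ECT₀.
  have hu := hM.exists_realize (ψ := .equal (fn f vr) tZero) (e := e)
    (IFml.isQF_conj fun δ hδ => (hl δ hδ).isQF) trivial
    (by
      intro K hK k a ha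
      have : Fact K.IsHAModel := ⟨hK⟩
      rw [hK.forces_iff_realize (IFml.isQF_conj fun δ hδ => (hl δ hδ).isQF), IFml.realize_conj] at ha
      obtain ⟨z, ⟨u, hu, -⟩, -⟩ := hp false K (by simp) k 0 a (RList.of_literals hl (fun δ hδ => by
        rw [hK.forces_iff_realize (hl δ hδ).isQF]
        exact ha δ hδ) 0)
      refine ⟨u, ?_⟩
      change f.ev _ = Term.realize _ _
      rw [realize_tZero]
      exact (hf u a).2 hu)
    (IFml.realize_conj.2 (mem_map_abs fun δ hδ =>
      (isLiteral_of_mem_diag (hΔ δ hδ).1).realize_abs (hΔ δ hδ).2 (hΔ δ hδ).1.1))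
  obtain ⟨u, hu⟩ := hu
  change f.ev _ = Term.realize _ _ at hu
  rw [realize_tZero] at hu
  refine ⟨m, e, PRSym.kleeneU.ev ![u], hχ, fun K hK hT k => ?_⟩
  have hHA := isHAModel_reduct hK hT
  have : Fact K.reduct.IsHAModel := ⟨hHA⟩
  -- In a model of `TM M`, where ECT₀ holds, the same program produces a realizer with truth.
  obtain ⟨z, hz, hz'⟩ := hp true K.reduct (fun _ => models_ECT_reduct hK hT) k 0 (K.cst k ∘ e)
    (RList.of_literals hl (mem_map_abs (P := fun δ => K.reduct.Forces δ k (K.cst k ∘ e))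
      fun δ hδ => (hK.forces_abs (hΔ δ hδ).2 _ k).2
        (forces_sentence (hT δ (Or.inr (hΔ δ hδ).1) k))) 0)
  have hu' : f.ev (Fin.cons (K.cst k u) (K.cst k ∘ e)) = 0 := by
    have h₁ := cst_ev hT k f (Fin.cons u e)
    have h₂ : K.cst k (0 : M) = 0 := (cst_ev hT k PRSym.zero ![]).trans (ev_zero _)
    rw [show f.ev (Fin.cons u e) = (0 : M) from hu, h₂] at h₁
    rw [h₁]
    congr 1
    funext i
    refine Fin.cases ?_ (fun i => ?_) i <;> rfl
  have : IsPRA (K.Dom k) := hHA.isPRA k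
  -- The image of the computation found in M is a computation at the node, so by determinism its
  -- value is the realizer `z`.
  have hc : K.cst k (PRSym.kleeneU.ev ![u]) = z := by
    have h₁ := cst_ev hT k PRSym.kleeneU ![u]
    have h₂ : K.cst k ∘ ![u] = ![K.cst k u] := by
      funext i
      fin_cases i
      rfl
    rw [h₁, h₂, ev_kleeneU]
    exact app_unique (K := K.reduct) (k := k) ⟨K.cst k u, (hf _ _).1 hu', rfl⟩ hz
  rw [hc]
  exact hz'

end

/-! ### The disjunction and existence properties of `T_M` -/

section

variable {M : Type w} [LPR.Structure M]

theorem exists_preModel_of_not_provI_TM {φ : ISent (LPR[[M]])} (h : ¬ ProvI (TM M) φ) :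
    ∃ K : KripkeData.{w, 0, w} (LPR[[M]]), K.IsPreModel ∧ Nonempty K.Node ∧
      (∀ {k₁ k₂}, K.le k₁ k₂ → K.le k₂ k₁ → k₁ = k₂) ∧ (∀ θ ∈ TM M, K.Models θ) ∧ ¬ K.Models φ :=
  exists_preModel_of_not_provI.{w, w} (.func (Sum.inl PRSym.zero) ![]) h

theorem provI_of_forall_models {φ : ISent (LPR[[M]])}
    (h : ∀ K : KripkeData.{w, 0, w} (LPR[[M]]), K.IsPreModel → (∀ θ ∈ TM M, K.Models θ) →
      ∀ k : K.Node, K.Forces φ k Fin.elim0) : ProvI (TM M) φ := by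
  by_contra hn
  obtain ⟨K, hK, -, -, hT, hφ⟩ := exists_preModel_of_not_provI_TM hn
  exact hφ (h K hK hT)

theorem cst_ev₁ {K : KripkeData.{w, 0, w} (LPR[[M]])} (hT : ∀ θ ∈ TM M, K.Models θ) (k : K.Node)
    (f : PRSym 1) (c : M) : K.cst k (f.ev ![c]) = f.ev ![K.cst k c] := by
  rw [cst_ev hT]
  congr 1
  funext i
  fin_cases i
  rfl

theorem cst_zero {K : KripkeData.{w, 0, w} (LPR[[M]])} (hT : ∀ θ ∈ TM M, K.Models θ) (k : K.Node) :
    K.cst k (0 : M) = 0 := (cst_ev hT k PRSym.zero ![]).trans (ev_zero _)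

/-- Whether the tag of the realizer is `0` is decided once and for all in M and is preserved by the
injective maps into the nodes. Hence all models of `TM M` force the same disjunct, and completeness
applies. -/
theorem provI_or_of_provI_or (hM : ModelsThPi2PA M) {φ ψ : ISent (LPR[[M]])}
    (h : ProvI (TM M) (φ.or ψ)) : ProvI (TM M) φ ∨ ProvI (TM M) ψ := by
  obtain ⟨m, e, c, hc, hr⟩ := exists_realizer hM h
  have hφ : φ.consts ⊆ Set.range e := Set.subset_union_left.trans hc
  have hψ : ψ.consts ⊆ Set.range e := Set.subset_union_right.trans hc
  by_cases h₀ : PRSym.fstS.ev ![c] = (0 : M)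
  · refine Or.inl (provI_of_forall_models fun K hK hT k => ?_)
    have hHA := isHAModel_reduct hK hT
    have : Fact K.reduct.IsHAModel := ⟨hHA⟩
    have h₁ : PRSym.fstS.ev ![K.cst k c] = (0 : K.Dom k) := by
      rw [← cst_ev₁ hT, h₀, cst_zero hT]
    rcases r_or.1 (hr K hK hT k) with ⟨-, h⟩ | ⟨h, -⟩
    · exact forces_sentence ((hK.forces_abs hφ _ k).1 h.forces)
    · exact (hHA.suc_ne_zero (k := k) _ (h.symm.trans h₁)).elim
  · refine Or.inr (provI_of_forall_models fun K hK hT k => ?_)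
    have hHA := isHAModel_reduct hK hT
    have : Fact K.reduct.IsHAModel := ⟨hHA⟩
    rcases r_or.1 (hr K hK hT k) with ⟨h, -⟩ | ⟨-, h⟩
    · refine (h₀ (cst_injective hT hK k ?_)).elim
      rw [cst_ev₁ hT, cst_zero hT]
      exact h
    · exact forces_sentence ((hK.forces_abs hψ _ k).1 h.forces)

/-- The first component of the realizer, computed in M, is a witness in all models of `TM M` at
once. -/
theorem exists_provI_of_provI_ex (hM : ModelsThPi2PA M) {φ : IFml (LPR[[M]]) 1}
    (h : ProvI (TM M) φ.ex) : ∃ d : M, ProvI (TM M) (φ.inst (conTerm LPR d)) := by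
  obtain ⟨m, e, c, hc, hr⟩ := exists_realizer hM h
  refine ⟨PRSym.fstS.ev ![c], provI_of_forall_models fun K hK hT k => ?_⟩
  have : Fact K.reduct.IsHAModel := ⟨isHAModel_reduct hK hT⟩
  have h₁ := (r_ex.1 (hr K hK hT k)).forces
  rw [hK.forces_tr φ _ _ _ (by
    intro x hx
    rw [Term.realize_relabel]
    exact realize_constVar (hc hx) (K.cst k)), IsPreModel.realize_liftSubst] at h₁
  rw [hK.forces_inst, realize_conTerm, cst_ev₁ hT]
  convert h₁ using 2
  rfl

end

/-! ### The universal model -/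

section

variable {M : Type w} [LPR.Structure M] {S : Type w} {K : S → KripkeData.{w, 0, w} (LPR[[M]])}

/-- Only the maps out of the root are new. They are injective homomorphisms by `cst_injective` and
`cst_ev`, and compatible with the maps of `K θ` because these preserve constants. -/
theorem univModel_isKripkeModel (hK : ∀ θ, (K θ).IsKripkeModel)
    (hT : ∀ θ, ∀ φ ∈ TM M, (K θ).Models φ) : (univModel M K).IsKripkeModel where
  nonempty := ⟨none⟩
  refl := by
    rintro (_ | ⟨θ, k⟩)
    · trivial
    · exact ⟨rfl, (hK θ).refl k⟩
  trans := by
    intro k₁ k₂ k₃ h h'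
    rcases k₁ with _ | ⟨θ, k⟩
    · trivial
    rcases k₂ with _ | ⟨θ', k'⟩
    · exact h.elim
    rcases k₃ with _ | ⟨θ'', k''⟩
    · exact h'.elim
    obtain ⟨rfl, h⟩ := h
    obtain ⟨rfl, h'⟩ := h'
    exact ⟨rfl, (hK θ).trans h h'⟩
  antisymm := by
    rintro (_ | ⟨θ, k⟩) (_ | ⟨θ', k'⟩) h h'
    · rfl
    · exact h'.elim
    · exact h.elim
    · obtain ⟨rfl, h⟩ := h
      obtain ⟨_, h'⟩ := h'
      rw [show k = k' from (hK θ).antisymm h h']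
  dom_nonempty := by
    rintro (_ | ⟨θ, k⟩)
    · exact ⟨(0 : M)⟩
    · exact (hK θ).dom_nonempty k
  map_self := by
    rintro (_ | ⟨θ, k⟩) h d
    · rfl
    · exact (hK θ).map_self h.2 d
  map_map := by
    intro k₁ k₂ k₃ h h' h'' d
    rcases k₁ with _ | ⟨θ, k⟩
    · rcases k₂ with _ | ⟨θ', k'⟩
      · rfl
      rcases k₃ with _ | ⟨θ'', k''⟩
      · exact h'.elim
      obtain ⟨rfl, h'⟩ := h'
      exact (hK θ').isPreModel.map_cst h' d
    rcases k₂ with _ | ⟨θ', k'⟩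
    · exact h.elim
    rcases k₃ with _ | ⟨θ'', k''⟩
    · exact h'.elim
    obtain ⟨rfl, h⟩ := h
    obtain ⟨rfl, h'⟩ := h'
    exact (hK θ).map_map h h' h''.2 d
  map_injective := by
    rintro (_ | ⟨θ, k⟩) (_ | ⟨θ', k'⟩) h
    · exact fun _ _ h => h
    · exact cst_injective (hT θ') (hK θ').isPreModel k'
    · exact h.elim
    · obtain ⟨rfl, h⟩ := h
      exact (hK θ).map_injective h
  map_fun := by
    rintro (_ | ⟨θ, k⟩) (_ | ⟨θ', k'⟩) h n f a
    · rfl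
    · rcases f with f | f
      · refine Eq.trans ?_ (cst_ev (hT θ') k' f a)
        exact congrArg ((K θ').cst k') ((LPR.lhomWithConstants M).map_onFunction (M := M) f a)
      · cases n with
        | zero =>
          exact congrArg (Structure.funMap (L := LPR[[M]]) (M := (K θ').Dom k')
            (Sum.inr f : LPR[[M]].Functions 0)) (Subsingleton.elim _ _)
        | succ n => exact PEmpty.elim f
    · exact h.elim
    · obtain ⟨rfl, h⟩ := h
      exact (hK θ).map_fun h f a
  map_rel := by
    rintro k k' h n (R | R) a <;> exact Empty.elim R

/-- All nodes above a non-root node lie in the same component, so forcing there is unchanged. -/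
theorem univModel_forces_some (φ : IFml (LPR[[M]]) n) {θ : S} {k : (K θ).Node}
    {a : Fin n → (K θ).Dom k} :
    (univModel M K).Forces φ (some ⟨θ, k⟩) a ↔ (K θ).Forces φ k a := by
  induction φ generalizing k with
  | falsum => rfl
  | equal => rfl
  | rel => rfl
  | and φ ψ h₁ h₂ => exact and_congr h₁ h₂
  | or φ ψ h₁ h₂ => exact or_congr h₁ h₂
  | imp φ ψ h₁ h₂ =>
    constructor
    · intro h k' hk hφ
      exact h₂.1 (h (some ⟨θ, k'⟩) ⟨rfl, hk⟩ (h₁.2 hφ))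
    · rintro h (_ | ⟨θ', k'⟩) hk hφ
      · exact hk.elim
      · obtain ⟨rfl, hk⟩ := hk
        exact h₂.2 (h k' hk (h₁.1 hφ))
  | all φ ih =>
    constructor
    · intro h k' hk d
      exact ih.1 (h (some ⟨θ, k'⟩) ⟨rfl, hk⟩ d)
    · rintro h (_ | ⟨θ', k'⟩) hk d
      · exact hk.elim
      · obtain ⟨rfl, hk⟩ := hk
        exact ih.2 (h k' hk d)
  | ex φ ih => exact exists_congr fun d => ih

end

/-! ### Forcing at the root is provability in `TM M`. -/

section

variable {M : Type w} [LPR.Structure M] {K : Unprovable (TM M) → KripkeData.{w, 0, w} (LPR[[M]])}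

/-- One direction is soundness. For the other, an unprovable sentence fails in the member of the
family that was chosen as its own countermodel. -/
theorem provI_subst_iff (hK : ∀ φ, (K φ).IsCountermodel (TM M) φ.1) {n : ℕ}
    (φ : IFml (LPR[[M]]) n) (c : Fin n → M) :
    ProvI (TM M) (φ.subst fun i => conTerm LPR (c i) : ISent (LPR[[M]])) ↔
      ∀ θ k, (K θ).Forces φ k ((K θ).cst k ∘ c) := by
  have key : ∀ θ k, (K θ).Forces (φ.subst fun i => conTerm LPR (c i)) k Fin.elim0 ↔
      (K θ).Forces φ k ((K θ).cst k ∘ c) := by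
    intro θ k
    rw [(hK θ).1.isPreModel.forces_subst]
    simp only [realize_conTerm]
    rfl
  constructor
  · intro h θ k
    exact (key θ k).1 ((hK θ).1.isPreModel.models_of_provI (hK θ).2.1 h k)
  · intro h
    by_contra hn
    exact (hK ⟨_, hn⟩).2.2 fun k => (key _ k).2 (h _ k)

/-- Conjunctions, implications and universal formulas compare root and provability through
`provI_subst_iff`; disjunctions and existential formulas use the disjunction and existence
properties. -/
theorem univModel_forces_root (hM : ModelsThPi2PA M)
    (hK : ∀ φ, (K φ).IsCountermodel (TM M) φ.1) {n : ℕ} (φ : IFml (LPR[[M]]) n) (c : Fin n → M) :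
    (univModel M K).Forces φ none c ↔
      ProvI (TM M) (φ.subst fun i => conTerm LPR (c i) : ISent (LPR[[M]])) := by
  have hcons : ∀ {n : ℕ} (d : M) (c : Fin n → M) θ (k : (K θ).Node),
      (K θ).cst k ∘ (Fin.cons d c : Fin (n + 1) → M) =
        Fin.cons ((K θ).cst k d) ((K θ).cst k ∘ c) := by
    intro n d c θ k
    funext i
    refine Fin.cases ?_ (fun i => ?_) i <;> rfl
  have hmap : ∀ {n : ℕ} (c : Fin n → M) θ (k k' : (K θ).Node) (h : (K θ).le k k'),
      (K θ).map h ∘ ((K θ).cst k ∘ c) = (K θ).cst k' ∘ c := by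
    intro n c θ k k' h
    funext i
    exact (hK θ).1.isPreModel.map_cst h _
  induction φ with
  | falsum => exact ⟨False.elim, fun h => not_provI_falsum hM h⟩
  | equal t s =>
    have e : ∀ t : LPR[[M]].Term (Fin _), (t.subst fun i => conTerm LPR (c i)).realize
        (Fin.elim0 : Fin 0 → M) = t.realize c := by
      intro t
      rw [Term.realize_subst]
      simp only [realize_conTerm_self]
    have e' : IFml.TrueIn M (IFml.subst (.equal t s) fun i => conTerm LPR (c i)) ↔
        t.realize c = s.realize c := by
      change Term.realize _ _ = Term.realize _ _ ↔ _
      rw [e, e]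
    refine e'.symm.trans ⟨fun h => ProvI.of_mem (Or.inr ⟨h, Or.inl trivial⟩), fun h => ?_⟩
    by_contra hn
    -- A provable equation that is false in M would contradict its negation, which belongs to the
    -- diagram.
    refine not_provI_falsum hM (Deriv.impE (ProvI.of_mem (Or.inr ⟨?_, Or.inr ⟨_, ?_, rfl⟩⟩)) h)
    exacts [hn, trivial]
  | rel R => rcases R with R | R <;> exact Empty.elim R
  | and φ ψ h₁ h₂ =>
    rw [provI_subst_iff hK]
    refine (and_congr (h₁ c) (h₂ c)).trans ?_
    rw [provI_subst_iff hK, provI_subst_iff hK]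
    exact ⟨fun h θ k => ⟨h.1 θ k, h.2 θ k⟩, fun h => ⟨fun θ k => (h θ k).1, fun θ k => (h θ k).2⟩⟩
  | or φ ψ h₁ h₂ =>
    refine (or_congr (h₁ c) (h₂ c)).trans ⟨fun h => ?_, fun h => provI_or_of_provI_or hM h⟩
    exact h.elim Deriv.orI₁ Deriv.orI₂
  | imp φ ψ h₁ h₂ =>
    rw [provI_subst_iff hK]
    constructor
    · intro h θ k k' hk hφ
      rw [hmap] at hφ ⊢
      exact (univModel_forces_some ψ).1 (h (some ⟨θ, k'⟩) trivial ((univModel_forces_some φ).2 hφ))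
    -- At the root itself, the premise is provable by the induction hypothesis, hence forced in
    -- every `K θ`; so is the conclusion, which is therefore provable and forced at the root.
    · rintro h (_ | ⟨θ, k⟩) _ hφ
      · refine (h₂ c).2 ((provI_subst_iff hK ψ c).2 fun θ k => ?_)
        exact (hK θ).1.isPreModel.forces_imp (h θ k) ((provI_subst_iff hK φ c).1 ((h₁ c).1 hφ) θ k)
      · refine (univModel_forces_some ψ).2 ?_
        exact (hK θ).1.isPreModel.forces_imp (h θ k) ((univModel_forces_some φ).1 hφ)
  | all φ ih =>
    rw [provI_subst_iff hK]
    constructor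
    · intro h θ k k' hk d
      rw [hmap]
      exact (univModel_forces_some φ).1 (h (some ⟨θ, k'⟩) trivial d)
    · intro h
      have hall : ∀ (d : M) θ k, (K θ).Forces φ k ((K θ).cst k ∘ (Fin.cons d c : Fin _ → M)) := by
        intro d θ k
        rw [hcons]
        exact (hK θ).1.isPreModel.forces_all (h θ k) _
      rintro (_ | ⟨θ, k⟩) _ d
      · exact (ih _).2 ((provI_subst_iff hK φ _).2 (hall d))
      · exact (univModel_forces_some φ).2 ((hK θ).1.isPreModel.forces_all (h θ k) d)
  | ex φ ih =>
    constructor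
    · have hex : ∀ d : M, (univModel M K).Forces φ none (Fin.cons d c : Fin _ → M) →
          ∀ θ k, (K θ).Forces φ.ex k ((K θ).cst k ∘ c) := by
        intro d hd θ k
        have := (provI_subst_iff hK φ _).1 ((ih _).1 hd) θ k
        rw [hcons] at this
        exact ⟨_, this⟩
      rintro ⟨d, hd⟩
      exact (provI_subst_iff hK _ _).2 (hex d hd)
    · intro h
      obtain ⟨d, hd⟩ := exists_provI_of_provI_ex hM h
      refine ⟨d, (ih (Fin.cons d c)).2 ?_⟩
      rw [IFml.inst, IFml.subst_subst] at hd
      convert hd using 2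
      funext i
      refine Fin.cases ?_ (fun i => ?_) i
      · rfl
      · change conTerm LPR (c i) = _
        rw [IFml.liftSubst, Fin.cons_succ, conTerm_relabel, conTerm_subst]

end

theorem theoremt8 {M : Type w} [LPR.Structure M] (hM : ModelsThPi2PA M) :
    (∀ φ : ISent (LPR[[M]]), ¬ ProvI (TM M) φ →
      ∃ K : KripkeData.{w, 0, w} (LPR[[M]]), K.IsCountermodel (TM M) φ) ∧
    ∀ K : Unprovable (TM M) → KripkeData.{w, 0, w} (LPR[[M]]),
      (∀ φ, (K φ).IsCountermodel (TM M) φ.1) →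
        (univModel M K).IsKripkeModel ∧
        ∀ φ : ISent (LPR[[M]]), (univModel M K).Models φ ↔ ProvI (TM M) φ := by
  refine ⟨fun φ h => ?_, fun K hK => ⟨univModel_isKripkeModel (fun θ => (hK θ).1)
    fun θ => (hK θ).2.1, fun φ => ?_⟩⟩
  · obtain ⟨K, hK, hne, hanti, hT, hφ⟩ := exists_preModel_of_not_provI_TM h
    refine ⟨K, ⟨hne, hK.refl, hK.trans, hanti, fun k => ⟨(0 : K.Dom k)⟩, hK.map_self, hK.map_map,
      -- Completeness leaves the injectivity of the transition maps open; it follows from the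
      -- decidability of equality in HA.
      fun h => (isHAModel_reduct hK hT).map_injective h, hK.map_fun, hK.map_rel⟩, hT, hφ⟩
  · have e : φ.subst (fun i : Fin 0 => conTerm LPR ((Fin.elim0 : Fin 0 → M) i)) = φ := by
      conv_rhs => rw [← IFml.subst_var φ]
      congr 1
      exact Subsingleton.elim _ _
    have key := univModel_forces_root hM hK φ (Fin.elim0 : Fin 0 → M)
    rw [e] at key
    constructor
    · exact fun h => key.1 (forces_sentence (h none))
    · rintro h (_ | ⟨θ, k⟩)
      · exact forces_sentence (key.2 h)
      · exact forces_sentence ((univModel_forces_some φ (a := Fin.elim0)).2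
          ((hK θ).1.isPreModel.models_of_provI (hK θ).2.1 h k))
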